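/- Supermanifolds are complex (holomorphic). For a supermanifold $\mathcal M$ of dimension $2|2$ let $\mathcal J\subset\mathcal O_{\mathcal M}$ be the sheaf of ideals generated by the odd sections, $\mathcal M_{red}$ the reduced manifold, with structure sheaf $\mathcal O_{\mathcal M}/\mathcal J$, and $\mathcal F_{\mathcal M}=\mathcal J/\mathcal J^2$ the fermionic sheaf; multiplication identifies $Sym^2\mathcal F_{\mathcal M}$ with $\mathcal J^2$. The differences of local splittings of $0\to\mathcal J\to\mathcal O_{\mathcal M}\to\mathcal O_{\mathcal M_{red}}\to 0$ are derivations $\mathcal O_{\mathcal M_{red}}\to\mathcal J^2$ and define the obstruction class $\omega_{\mathcal M}\in H^1(\mathcal M_{red},\mathcal T_{\mathcal M_{red}}\otimes Sym^2\mathcal F_{\mathcal M})$; $\mathcal M$ is projected if this sequence has a global splitting. On $\mathbb P^2$ with homogeneous coordinates $X_0,X_1,X_2$ let $U_i=\{X_i\ne0\}$, with affine coordinates $(z_{10},z_{20})=(X_1/X_0,X_2/X_0)$, $(z_{11},z_{21})=(X_0/X_1,X_2/X_1)$, $(z_{12},z_{22})=(X_0/X_2,X_1/X_2)$. Let $\theta_{li}$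 denote $dz_{li}$ regarded as an odd section of $\Pi\Omega^1_{\mathbb P^2}$ over $U_i$. The space $H^1(\mathbb P^2,\mathcal T_{\mathbb P^2}\otimes Sym^2\Pi\Omega^1_{\mathbb P^2})\cong\mathbb C$ is generated by the class $[\omega]$ of the Čech cocycle $$\omega_{01}=\frac{\theta_{11}\theta_{21}}{z_{11}^2}\,\partial_{z_{20}},\qquad \omega_{12}=-\frac{\theta_{12}\theta_{22}}{z_{22}^2}\,\partial_{z_{11}},\qquad \omega_{20}=-\frac{\theta_{10}\theta_{20}}{z_{20}^2}\,\partial_{z_{22}}.$$ For $\lambda\in\mathbb C$, say that $\mathcal M$ is given by the triple $(\mathbb P^2,\Pi\Omega^1_{\mathbb P^2},\lambda)$ if there are isomorphisms $\mathcal M_{red}\cong\mathbb P^2$ and $\mathcal F_{\mathcal M}\cong\Pi\Omega^1_{\mathbb P^2}$ under which $\omega_{\mathcal M}=\lambda[\omega]$. Let $\mathbb P^2_\Pi$ be Manin's $\Pi$-projective plane, the Grassmannian of $1|1$-dimensional $\Pi$-symmetric subspaces of $\mathbb C^{3|3}$. It is glued from three copies of $\mathbb C^{2|2}$, with coordinates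 $z_{1i},z_{2i}\,|\,\theta_{1i},\theta_{2i}$ $(i=0,1,2)$, by row reduction of the big cell matrices $\begin{pmatrix}x&\xi\\-\xi&x\end{pmatrix}$. Here $x$ is the row with entry $1$ at place $i$ and $z_{1i},z_{2i}$ at the other places, and $\xi$ is the row with entry $0$ at place $i$ and $\theta_{1i},\theta_{2i}$ at the other places. **Theorem.** Let $\lambda\in\mathbb C$, $\lambda\neq0$. Then $\mathbb P^2_\Pi$ is a supermanifold given by the triple $(\mathbb P^2,\Pi\Omega^1_{\mathbb P^2},\lambda)$, and every supermanifold $\mathcal M$ of dimension $2|2$ given by this triple is non-projected and isomorphic to $\mathbb P^2_\Pi$. -/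

import Mathlib

open CategoryTheory TopologicalSpace Opposite

/-! ## The Grassmann algebra on two odd generators -/

/-- The complex Grassmann algebra `Λ[θ₁, θ₂]`; the element with the coefficients
`c0, c1, c2, c12` is `c0 + c1 θ₁ + c2 θ₂ + c12 θ₁θ₂`. -/
@[ext]
structure Grass where
  c0 : ℂ
  c1 : ℂ
  c2 : ℂ
  c12 : ℂ

namespace Grass

instance : Zero Grass := ⟨⟨0, 0, 0, 0⟩⟩
instance : One Grass := ⟨⟨1, 0, 0, 0⟩⟩
instance : Add Grass := ⟨fun x y => ⟨x.c0 + y.c0, x.c1 + y.c1, x.c2 + y.c2, x.c12 + y.c12⟩⟩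
instance : Neg Grass := ⟨fun x => ⟨-x.c0, -x.c1, -x.c2, -x.c12⟩⟩
instance : SMul ℂ Grass := ⟨fun t x => ⟨t * x.c0, t * x.c1, t * x.c2, t * x.c12⟩⟩
/-- The product determined by `θ₁² = θ₂² = 0` and `θ₂θ₁ = -θ₁θ₂`. -/
instance : Mul Grass := ⟨fun x y =>
  ⟨x.c0 * y.c0, x.c0 * y.c1 + x.c1 * y.c0, x.c0 * y.c2 + x.c2 * y.c0,
    x.c0 * y.c12 + x.c12 * y.c0 + x.c1 * y.c2 - x.c2 * y.c1⟩⟩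

@[simp] theorem zero_c0 : (0 : Grass).c0 = 0 := rfl
@[simp] theorem zero_c1 : (0 : Grass).c1 = 0 := rfl
@[simp] theorem zero_c2 : (0 : Grass).c2 = 0 := rfl
@[simp] theorem zero_c12 : (0 : Grass).c12 = 0 := rfl
@[simp] theorem one_c0 : (1 : Grass).c0 = 1 := rfl
@[simp] theorem one_c1 : (1 : Grass).c1 = 0 := rfl
@[simp] theorem one_c2 : (1 : Grass).c2 = 0 := rfl
@[simp] theorem one_c12 : (1 : Grass).c12 = 0 := rfl
@[simp] theorem add_c0 (x y : Grass) : (x + y).c0 = x.c0 + y.c0 := rfl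
@[simp] theorem add_c1 (x y : Grass) : (x + y).c1 = x.c1 + y.c1 := rfl
@[simp] theorem add_c2 (x y : Grass) : (x + y).c2 = x.c2 + y.c2 := rfl
@[simp] theorem add_c12 (x y : Grass) : (x + y).c12 = x.c12 + y.c12 := rfl
@[simp] theorem neg_c0 (x : Grass) : (-x).c0 = -x.c0 := rfl
@[simp] theorem neg_c1 (x : Grass) : (-x).c1 = -x.c1 := rfl
@[simp] theorem neg_c2 (x : Grass) : (-x).c2 = -x.c2 := rfl
@[simp] theorem neg_c12 (x : Grass) : (-x).c12 = -x.c12 := rfl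
@[simp] theorem smul_c0 (t : ℂ) (x : Grass) : (t • x).c0 = t * x.c0 := rfl
@[simp] theorem smul_c1 (t : ℂ) (x : Grass) : (t • x).c1 = t * x.c1 := rfl
@[simp] theorem smul_c2 (t : ℂ) (x : Grass) : (t • x).c2 = t * x.c2 := rfl
@[simp] theorem smul_c12 (t : ℂ) (x : Grass) : (t • x).c12 = t * x.c12 := rfl
@[simp] theorem mul_c0 (x y : Grass) : (x * y).c0 = x.c0 * y.c0 := rfl
@[simp] theorem mul_c1 (x y : Grass) : (x * y).c1 = x.c0 * y.c1 + x.c1 * y.c0 := rfl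
@[simp] theorem mul_c2 (x y : Grass) : (x * y).c2 = x.c0 * y.c2 + x.c2 * y.c0 := rfl
@[simp] theorem mul_c12 (x y : Grass) :
    (x * y).c12 = x.c0 * y.c12 + x.c12 * y.c0 + x.c1 * y.c2 - x.c2 * y.c1 := rfl

instance : Ring Grass where
  add_assoc x y z := by ext <;> simp <;> ring
  zero_add x := by ext <;> simp
  add_zero x := by ext <;> simp
  add_comm x y := by ext <;> simp <;> ring
  neg_add_cancel x := by ext <;> simp
  left_distrib x y z := by ext <;> simp <;> ring
  right_distrib x y z := by ext <;> simp <;> ring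
  zero_mul x := by ext <;> simp
  mul_zero x := by ext <;> simp
  mul_assoc x y z := by ext <;> simp <;> ring
  one_mul x := by ext <;> simp
  mul_one x := by ext <;> simp
  nsmul := nsmulRec
  zsmul := zsmulRec

instance : Module ℂ Grass where
  one_smul x := by ext <;> simp
  mul_smul s t x := by ext <;> simp <;> ring
  smul_zero t := by ext <;> simp
  smul_add t x y := by ext <;> simp <;> ring
  add_smul s t x := by ext <;> simp <;> ring
  zero_smul x := by ext <;> simp

instance : Algebra ℂ Grass :=
  Algebra.ofModule (fun t x y => by ext <;> simp <;> ring) (fun t x y => by ext <;> simp <;> ring)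

/-- The scalar `t` as an element of the Grassmann algebra. -/
def const (t : ℂ) : Grass := ⟨t, 0, 0, 0⟩

/-- The odd generators `θ₁`, `θ₂`. -/
def theta : Fin 2 → Grass := ![⟨0, 1, 0, 0⟩, ⟨0, 0, 1, 0⟩]

def IsEven (x : Grass) : Prop := x.c1 = 0 ∧ x.c2 = 0
def IsOdd (x : Grass) : Prop := x.c0 = 0 ∧ x.c12 = 0

def evenPart (x : Grass) : Grass := ⟨x.c0, 0, 0, x.c12⟩
def oddPart (x : Grass) : Grass := ⟨0, x.c1, x.c2, 0⟩

end Grass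

/-! ## Complex superspaces -/

/-- A complex superspace: a topological space with a sheaf of associative unital `ℂ`-algebras which
are `ℤ/2`-graded and supercommutative, the grading being respected by the restriction maps. -/
structure Superspace extends AlgebraicGeometry.SheafedSpace.{1, 0, 0} (AlgCat.{0} ℂ) where
  even : ∀ U : Opens carrier, Submodule ℂ (presheaf.obj (op U))
  odd : ∀ U : Opens carrier, Submodule ℂ (presheaf.obj (op U))
  isCompl : ∀ U, IsCompl (even U) (odd U)
  one_even : ∀ U, 1 ∈ even U
  even_mul_even : ∀ U, ∀ a ∈ even U, ∀ b ∈ even U, a * b ∈ even U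
  even_mul_odd : ∀ U, ∀ a ∈ even U, ∀ b ∈ odd U, a * b ∈ odd U
  odd_mul_odd : ∀ U, ∀ a ∈ odd U, ∀ b ∈ odd U, a * b ∈ even U
  even_comm : ∀ U, ∀ a ∈ even U, ∀ b, a * b = b * a
  odd_anticomm : ∀ U, ∀ a ∈ odd U, ∀ b ∈ odd U, a * b = -(b * a)
  map_even : ∀ {U V : Opens carrier} (i : U ⟶ V), ∀ a ∈ even V,
    (presheaf.map i.op).hom a ∈ even U
  map_odd : ∀ {U V : Opens carrier} (i : U ⟶ V), ∀ a ∈ odd V,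
    (presheaf.map i.op).hom a ∈ odd U

namespace Superspace

/-- The algebra of sections over `U`. -/
abbrev sec (M : Superspace) (U : Opens M.carrier) : AlgCat.{0} ℂ := M.presheaf.obj (op U)

/-- The restriction of sections. -/
def res (M : Superspace) {U V : Opens M.carrier} (h : U ≤ V) : M.sec V →ₐ[ℂ] M.sec U :=
  (M.presheaf.map (homOfLE h).op).hom

/-- The open subsuperspace with the underlying space `U`. -/
noncomputable def restrict (M : Superspace) (U : Opens M.carrier) : Superspace where
  toSheafedSpace := M.toSheafedSpace.restrict U.isOpenEmbedding
  even V := M.even (U.isOpenEmbedding.isOpenMap.functor.obj V)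
  odd V := M.odd (U.isOpenEmbedding.isOpenMap.functor.obj V)
  isCompl _ := M.isCompl _
  one_even _ := M.one_even _
  even_mul_even _ := M.even_mul_even _
  even_mul_odd _ := M.even_mul_odd _
  odd_mul_odd _ := M.odd_mul_odd _
  even_comm _ := M.even_comm _
  odd_anticomm _ := M.odd_anticomm _
  map_even i := M.map_even (U.isOpenEmbedding.isOpenMap.functor.map i)
  map_odd i := M.map_odd (U.isOpenEmbedding.isOpenMap.functor.map i)

/-- An isomorphism of superspaces: a homeomorphism together with parity-preserving isomorphisms
of the algebras of sections, compatible with the restriction maps. -/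
structure Iso (M N : Superspace) where
  homeo : M.carrier ≃ₜ N.carrier
  pull : ∀ V : Opens N.carrier, N.sec V ≃ₐ[ℂ] M.sec (V.comap homeo)
  pull_res : ∀ {V W : Opens N.carrier} (h : W ≤ V) (s : N.sec V),
    pull W (N.res h s) = M.res (fun _ hx => h hx) (pull V s)
  pull_even : ∀ V, ∀ s ∈ N.even V, pull V s ∈ M.even (V.comap homeo)
  pull_odd : ∀ V, ∀ s ∈ N.odd V, pull V s ∈ M.odd (V.comap homeo)

/-- The ideal of `O_M(U)` generated by the odd sections over `U`. -/
def oddIdeal (M : Superspace) (U : Opens M.carrier) : Ideal (M.sec U) :=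
  Ideal.span {s | s ∈ M.odd U}

/-- The ideal of `O_M(U)` generated by the products of two odd sections over `U`. -/
def oddIdealSq (M : Superspace) (U : Opens M.carrier) : Ideal (M.sec U) :=
  Ideal.span {s | ∃ a ∈ M.odd U, ∃ b ∈ M.odd U, s = a * b}

theorem res_res (M : Superspace) {U V W : Opens M.carrier} (h : U ≤ V) (h' : V ≤ W)
    (s : M.sec W) : M.res h (M.res h' s) = M.res (h.trans h') s := by
  have : (M.presheaf.map (homOfLE (h.trans h')).op) =
      M.presheaf.map (homOfLE h').op ≫ M.presheaf.map (homOfLE h).op := by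
    rw [← M.presheaf.map_comp]; rfl
  simp only [res, this]
  rfl

theorem res_mem_oddIdeal (M : Superspace) {U V : Opens M.carrier} (h : U ≤ V) (s : M.sec V)
    (hs : s ∈ M.oddIdeal V) : M.res h s ∈ M.oddIdeal U := by
  have : M.oddIdeal V ≤ (M.oddIdeal U).comap (M.res h) :=
    Ideal.span_le.2 fun a ha => Ideal.subset_span (M.map_odd (homOfLE h) a ha)
  exact this hs

theorem res_mem_oddIdealSq (M : Superspace) {U V : Opens M.carrier} (h : U ≤ V) (s : M.sec V)
    (hs : s ∈ M.oddIdealSq V) : M.res h s ∈ M.oddIdealSq U := by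
  have : M.oddIdealSq V ≤ (M.oddIdealSq U).comap (M.res h) := by
    refine Ideal.span_le.2 ?_
    rintro _ ⟨a, ha, b, hb, rfl⟩
    exact Ideal.subset_span ⟨_, M.map_odd (homOfLE h) a ha, _, M.map_odd (homOfLE h) b hb,
      map_mul (M.res h) a b⟩
  exact this hs

/-- Sections of the nilpotent sheaf `J_M`: the sheaf of ideals generated by the odd sections. -/
def nil (M : Superspace) (U : Opens M.carrier) : Ideal (M.sec U) where
  carrier := {s | ∀ x ∈ U, ∃ (V : Opens M.carrier) (h : V ≤ U), x ∈ V ∧ M.res h s ∈ M.oddIdeal V}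
  zero_mem' x hx := ⟨U, le_rfl, hx, by rw [map_zero]; exact Ideal.zero_mem _⟩
  add_mem' {s t} hs ht x hx := by
    obtain ⟨V, hV, hxV, h1⟩ := hs x hx
    obtain ⟨W, hW, hxW, h2⟩ := ht x hx
    refine ⟨V ⊓ W, inf_le_left.trans hV, ⟨hxV, hxW⟩, ?_⟩
    rw [map_add]
    refine Ideal.add_mem _ ?_ ?_
    · rw [← M.res_res inf_le_left hV]; exact M.res_mem_oddIdeal _ _ h1
    · rw [← M.res_res inf_le_right hW]; exact M.res_mem_oddIdeal _ _ h2
  smul_mem' a s hs x hx := by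
    obtain ⟨V, hV, hxV, h1⟩ := hs x hx
    refine ⟨V, hV, hxV, ?_⟩
    rw [smul_eq_mul, map_mul]
    exact Ideal.mul_mem_left _ _ h1

/-- Sections of `J_M²`. -/
def nilSq (M : Superspace) (U : Opens M.carrier) : Ideal (M.sec U) where
  carrier := {s | ∀ x ∈ U, ∃ (V : Opens M.carrier) (h : V ≤ U), x ∈ V ∧ M.res h s ∈ M.oddIdealSq V}
  zero_mem' x hx := ⟨U, le_rfl, hx, by rw [map_zero]; exact Ideal.zero_mem _⟩
  add_mem' {s t} hs ht x hx := by
    obtain ⟨V, hV, hxV, h1⟩ := hs x hx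
    obtain ⟨W, hW, hxW, h2⟩ := ht x hx
    refine ⟨V ⊓ W, inf_le_left.trans hV, ⟨hxV, hxW⟩, ?_⟩
    rw [map_add]
    refine Ideal.add_mem _ ?_ ?_
    · rw [← M.res_res inf_le_left hV]; exact M.res_mem_oddIdealSq _ _ h1
    · rw [← M.res_res inf_le_right hW]; exact M.res_mem_oddIdealSq _ _ h2
  smul_mem' a s hs x hx := by
    obtain ⟨V, hV, hxV, h1⟩ := hs x hx
    refine ⟨V, hV, hxV, ?_⟩
    rw [smul_eq_mul, map_mul]
    exact Ideal.mul_mem_left _ _ h1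

theorem res_mem_nil (M : Superspace) {U V : Opens M.carrier} (h : U ≤ V) (s : M.sec V)
    (hs : s ∈ M.nil V) : M.res h s ∈ M.nil U := by
  intro x hx
  obtain ⟨W, hW, hxW, h1⟩ := hs x (h hx)
  refine ⟨U ⊓ W, inf_le_left, ⟨hx, hxW⟩, ?_⟩
  rw [M.res_res, ← M.res_res inf_le_right hW]
  exact M.res_mem_oddIdeal _ _ h1

/-- The structural exact sequence `0 → J_M → O_M → O_M / J_M → 0` is split by a morphism
of superspaces `M → M_red` which is the identity on `M_red`. The pull-back along such a
morphism is the same thing as a morphism `e : O_M → O_M` of sheaves of superalgebras which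
kills `J_M` and is the identity modulo `J_M`. -/
def IsProjected (M : Superspace) : Prop :=
  ∃ e : ∀ U : Opens M.carrier, M.sec U →ₐ[ℂ] M.sec U,
    (∀ {U V : Opens M.carrier} (h : U ≤ V) (s : M.sec V), e U (M.res h s) = M.res h (e V s)) ∧
    (∀ U s, e U s ∈ M.even U) ∧
    (∀ U, ∀ s ∈ M.nil U, e U s = 0) ∧
    ∀ U s, s - e U s ∈ M.nil U

end Superspace

/-! ## Sheaves of functions -/

/-- Data for a sheaf of `ℂ`-superalgebras whose sections are dependent functions: a condition
`IsSec` on functions which is local and defines subalgebras closed under taking even parts. -/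
structure SuperfunctionSheaf (X : TopCat.{0}) (T : X → Type) [∀ x, Ring (T x)]
    [∀ x, Algebra ℂ (T x)] where
  sub : ∀ U : Opens X, Subalgebra ℂ (∀ x : U, T x)
  res_mem : ∀ {U V : Opens X} (h : U ≤ V), ∀ f ∈ sub V, (fun x : U => f ⟨x.1, h x.2⟩) ∈ sub U
  locality : ∀ {U : Opens X} (f : ∀ x : U, T x),
    (∀ x : U, ∃ (V : Opens X) (_ : x.1 ∈ V) (h : V ≤ U),
      (fun y : V => f ⟨y.1, h y.2⟩) ∈ sub V) → f ∈ sub U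
  ev : ∀ x, Submodule ℂ (T x)
  od : ∀ x, Submodule ℂ (T x)
  one_ev : ∀ x, 1 ∈ ev x
  ev_mul_ev : ∀ x, ∀ a ∈ ev x, ∀ b ∈ ev x, a * b ∈ ev x
  ev_mul_od : ∀ x, ∀ a ∈ ev x, ∀ b ∈ od x, a * b ∈ od x
  od_mul_od : ∀ x, ∀ a ∈ od x, ∀ b ∈ od x, a * b ∈ ev x
  ev_comm : ∀ x, ∀ a ∈ ev x, ∀ b, a * b = b * a
  od_anticomm : ∀ x, ∀ a ∈ od x, ∀ b ∈ od x, a * b = -(b * a)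
  disj : ∀ x, ∀ a ∈ ev x, a ∈ od x → a = 0
  split : ∀ {U : Opens X}, ∀ f ∈ sub U, ∃ g ∈ sub U, ∃ h ∈ sub U,
    (∀ x : U, g x ∈ ev x) ∧ (∀ x : U, h x ∈ od x) ∧ g + h = f

namespace SuperfunctionSheaf

variable {X : TopCat.{0}} {T : X → Type} [∀ x, Ring (T x)] [∀ x, Algebra ℂ (T x)]

def resHom (S : SuperfunctionSheaf X T) {U V : Opens X} (h : U ≤ V) :
    S.sub V →ₐ[ℂ] S.sub U where
  toFun f := ⟨fun x => f.1 ⟨x.1, h x.2⟩, S.res_mem h f.1 f.2⟩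
  map_one' := rfl
  map_mul' _ _ := rfl
  map_zero' := rfl
  map_add' _ _ := rfl
  commutes' _ := rfl

def presheaf (S : SuperfunctionSheaf X T) : TopCat.Presheaf (AlgCat.{0} ℂ) X where
  obj U := AlgCat.of ℂ (S.sub U.unop)
  map i := AlgCat.ofHom (S.resHom i.unop.le)

def localPredicate (S : SuperfunctionSheaf X T) : TopCat.LocalPredicate T where
  pred {U} f := f ∈ S.sub U
  res i f hf := S.res_mem i.le f hf
  locality f w := S.locality f fun x => by
    obtain ⟨V, hx, i, h⟩ := w x
    exact ⟨V, hx, i.le, h⟩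

theorem isSheaf (S : SuperfunctionSheaf X T) : S.presheaf.IsSheaf := by
  rw [TopCat.Presheaf.isSheaf_iff_isSheaf_comp (CategoryTheory.forget (AlgCat.{0} ℂ))]
  exact TopCat.subpresheafToTypes.isSheaf S.localPredicate

/-- The superspace with the given structure sheaf of superfunctions. -/
def toSuperspace (S : SuperfunctionSheaf X T) : Superspace where
  carrier := X
  presheaf := S.presheaf
  IsSheaf := S.isSheaf
  even U :=
    { carrier := {f : S.sub U | ∀ x : U, f.1 x ∈ S.ev x}
      zero_mem' := fun _ => Submodule.zero_mem _
      add_mem' := fun ha hb x => Submodule.add_mem _ (ha x) (hb x)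
      smul_mem' := fun t _ ha x => Submodule.smul_mem _ t (ha x) }
  odd U :=
    { carrier := {f : S.sub U | ∀ x : U, f.1 x ∈ S.od x}
      zero_mem' := fun _ => Submodule.zero_mem _
      add_mem' := fun ha hb x => Submodule.add_mem _ (ha x) (hb x)
      smul_mem' := fun t _ ha x => Submodule.smul_mem _ t (ha x) }
  isCompl U := by
    refine ⟨Submodule.disjoint_def.2 fun f h1 h2 => ?_, codisjoint_iff.2 ?_⟩
    · exact Subtype.ext (funext fun x => S.disj x _ (h1 x) (h2 x))
    · refine eq_top_iff.2 fun f _ => ?_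
      obtain ⟨g, hg, h, hh, h1, h2, h3⟩ := S.split f.1 f.2
      exact Submodule.mem_sup.2 ⟨⟨g, hg⟩, h1, ⟨h, hh⟩, h2, Subtype.ext h3⟩
  one_even _ x := S.one_ev x
  even_mul_even _ _ ha _ hb x := S.ev_mul_ev x _ (ha x) _ (hb x)
  even_mul_odd _ _ ha _ hb x := S.ev_mul_od x _ (ha x) _ (hb x)
  odd_mul_odd _ _ ha _ hb x := S.od_mul_od x _ (ha x) _ (hb x)
  even_comm _ _ ha b := Subtype.ext (funext fun x => S.ev_comm x _ (ha x) (b.1 x))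
  odd_anticomm _ _ ha _ hb := Subtype.ext (funext fun x => S.od_anticomm x _ (ha x) _ (hb x))
  map_even i _ ha x := ha ⟨x.1, i.le x.2⟩
  map_odd i _ ha x := ha ⟨x.1, i.le x.2⟩

end SuperfunctionSheaf

/-! ## Superfunctions in two even and two odd variables -/

/-- All the coefficients of the Grassmann-algebra-valued function `F` are holomorphic near `z`. -/
def SuperAnalyticAt (F : (Fin 2 → ℂ) → Grass) (z : Fin 2 → ℂ) : Prop :=
  AnalyticAt ℂ (fun w => (F w).c0) z ∧ AnalyticAt ℂ (fun w => (F w).c1) z ∧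
    AnalyticAt ℂ (fun w => (F w).c2) z ∧ AnalyticAt ℂ (fun w => (F w).c12) z

/-- The value of a holomorphic function `a` at a pair `Z` of even elements of the
Grassmann algebra: since the nilpotent part `n θ₁θ₂` of `Z = z + n θ₁θ₂` has square zero, the
Taylor expansion reads `a(Z) = a(z) + da(z)(n) θ₁θ₂`. -/
noncomputable def taylor (a : (Fin 2 → ℂ) → ℂ) (Z : Fin 2 → Grass) : Grass :=
  ⟨a fun k => (Z k).c0, 0, 0, fderiv ℂ a (fun k => (Z k).c0) fun k => (Z k).c12⟩

/-- The substitution of `Z` for the even and `Θ` for the odd coordinates in the superfunction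
`F = a + b θ₁ + c θ₂ + d θ₁θ₂`. -/
noncomputable def superEval (F : (Fin 2 → ℂ) → Grass) (Z Θ : Fin 2 → Grass) : Grass :=
  taylor (fun w => (F w).c0) Z + taylor (fun w => (F w).c1) Z * Θ 0 +
    taylor (fun w => (F w).c2) Z * Θ 1 + taylor (fun w => (F w).c12) Z * (Θ 0 * Θ 1)

namespace SuperAnalyticAt

variable {F G : (Fin 2 → ℂ) → Grass} {z : Fin 2 → ℂ}

theorem const (x : Grass) : SuperAnalyticAt (fun _ => x) z :=
  ⟨analyticAt_const, analyticAt_const, analyticAt_const, analyticAt_const⟩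

theorem add (hF : SuperAnalyticAt F z) (hG : SuperAnalyticAt G z) : SuperAnalyticAt (F + G) z :=
  ⟨hF.1.add hG.1, hF.2.1.add hG.2.1, hF.2.2.1.add hG.2.2.1, hF.2.2.2.add hG.2.2.2⟩

theorem mul (hF : SuperAnalyticAt F z) (hG : SuperAnalyticAt G z) : SuperAnalyticAt (F * G) z := by
  obtain ⟨a, b, c, d⟩ := hF
  obtain ⟨a', b', c', d'⟩ := hG
  exact ⟨a.mul a', (a.mul b').add (b.mul a'), (a.mul c').add (c.mul a'),
    (((a.mul d').add (d.mul a')).add (b.mul c')).sub (c.mul b')⟩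

theorem congr (hF : SuperAnalyticAt F z) (h : F =ᶠ[nhds z] G) : SuperAnalyticAt G z :=
  ⟨hF.1.congr (h.mono fun _ e => by simp only [e]), hF.2.1.congr (h.mono fun _ e => by simp only [e]),
    hF.2.2.1.congr (h.mono fun _ e => by simp only [e]),
    hF.2.2.2.congr (h.mono fun _ e => by simp only [e])⟩

theorem evenPart (hF : SuperAnalyticAt F z) : SuperAnalyticAt (fun w => (F w).evenPart) z :=
  ⟨hF.1, analyticAt_const, analyticAt_const, hF.2.2.2⟩

theorem oddPart (hF : SuperAnalyticAt F z) : SuperAnalyticAt (fun w => (F w).oddPart) z :=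
  ⟨analyticAt_const, hF.2.1, hF.2.2.1, analyticAt_const⟩

end SuperAnalyticAt

section superEval

variable {F G : (Fin 2 → ℂ) → Grass} {Z Θ : Fin 2 → Grass}

theorem superEval_congr (h : F =ᶠ[nhds fun k => (Z k).c0] G) :
    superEval F Z Θ = superEval G Z Θ := by
  have key : ∀ p : Grass → ℂ, taylor (fun w => p (F w)) Z = taylor (fun w => p (G w)) Z := by
    intro p
    have h' : (fun w => p (F w)) =ᶠ[nhds fun k => (Z k).c0] fun w => p (G w) :=
      h.mono fun w e => by simp only [e]
    simp only [taylor, h'.fderiv_eq, h'.eq_of_nhds]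
  simp only [superEval, key Grass.c0, key Grass.c1, key Grass.c2, key Grass.c12]

theorem superEval_const (x : ℂ) : superEval (fun _ => Grass.const x) Z Θ = Grass.const x := by
  ext <;> simp [superEval, taylor, Grass.const]

theorem superEval_add (hF : SuperAnalyticAt F fun k => (Z k).c0)
    (hG : SuperAnalyticAt G fun k => (Z k).c0) :
    superEval (F + G) Z Θ = superEval F Z Θ + superEval G Z Θ := by
  have key : ∀ p : Grass → ℂ, (∀ x y, p (x + y) = p x + p y) →
      AnalyticAt ℂ (fun w => p (F w)) (fun k => (Z k).c0) →
      AnalyticAt ℂ (fun w => p (G w)) (fun k => (Z k).c0) →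
      taylor (fun w => p ((F + G) w)) Z = taylor (fun w => p (F w)) Z + taylor (fun w => p (G w)) Z := by
    intro p hp h1 h2
    have : (fun w => p ((F + G) w)) = (fun w => p (F w)) + fun w => p (G w) := by
      funext w; exact hp _ _
    rw [this]
    ext <;> simp [taylor, fderiv_add h1.differentiableAt h2.differentiableAt]
  obtain ⟨a, b, c, d⟩ := hF
  obtain ⟨a', b', c', d'⟩ := hG
  simp only [superEval]
  rw [key Grass.c0 (fun _ _ => rfl) a a', key Grass.c1 (fun _ _ => rfl) b b',
    key Grass.c2 (fun _ _ => rfl) c c', key Grass.c12 (fun _ _ => rfl) d d']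
  simp only [add_mul]
  abel

theorem superEval_mul (hF : SuperAnalyticAt F fun k => (Z k).c0)
    (hG : SuperAnalyticAt G fun k => (Z k).c0) (hΘ : ∀ k, (Θ k).IsOdd) :
    superEval (F * G) Z Θ = superEval F Z Θ * superEval G Z Θ := by
  have h00 := (hΘ 0).1
  have h01 := (hΘ 0).2
  have h10 := (hΘ 1).1
  have h11 := (hΘ 1).2
  have hd : fderiv ℂ (fun w => ((F * G) w).c0) (fun k => (Z k).c0) (fun k => (Z k).c12) =
      (F fun k => (Z k).c0).c0 * fderiv ℂ (fun w => (G w).c0) (fun k => (Z k).c0)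
        (fun k => (Z k).c12) +
      (G fun k => (Z k).c0).c0 * fderiv ℂ (fun w => (F w).c0) (fun k => (Z k).c0)
        (fun k => (Z k).c12) := by
    have : (fun w => ((F * G) w).c0) = (fun w => (F w).c0) * fun w => (G w).c0 := rfl
    rw [this, fderiv_mul hF.1.differentiableAt hG.1.differentiableAt]
    simp
  ext
  · simp [superEval, taylor, h00, h10]
  · simp [superEval, taylor, h00, h10]; ring
  · simp [superEval, taylor, h00, h10]; ring
  · simp only [superEval, taylor, Grass.add_c12, Grass.mul_c12, Grass.add_c0, Grass.add_c1,
      Grass.add_c2, Grass.mul_c0, Grass.mul_c1, Grass.mul_c2, h00, h01, h10, h11, hd]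
    simp only [Pi.mul_apply, Grass.mul_c12, Grass.mul_c1, Grass.mul_c2]
    ring

theorem superEval_evenPart (hΘ : ∀ k, (Θ k).IsOdd) :
    superEval (fun w => (F w).evenPart) Z Θ = (superEval F Z Θ).evenPart := by
  have h00 := (hΘ 0).1
  have h01 := (hΘ 0).2
  have h10 := (hΘ 1).1
  have h11 := (hΘ 1).2
  ext <;> simp [superEval, taylor, Grass.evenPart, h00, h01, h10, h11]

theorem superEval_oddPart (hΘ : ∀ k, (Θ k).IsOdd) :
    superEval (fun w => (F w).oddPart) Z Θ = (superEval F Z Θ).oddPart := by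
  have h00 := (hΘ 0).1
  have h01 := (hΘ 0).2
  have h10 := (hΘ 1).1
  have h11 := (hΘ 1).2
  ext <;> simp [superEval, taylor, Grass.oddPart, h00, h01, h10, h11]

end superEval

namespace Grass

def evenSub : Submodule ℂ Grass where
  carrier := {x | x.IsEven}
  zero_mem' := ⟨rfl, rfl⟩
  add_mem' ha hb := ⟨by simp [ha.1, hb.1], by simp [ha.2, hb.2]⟩
  smul_mem' t _ ha := ⟨by simp [ha.1], by simp [ha.2]⟩

def oddSub : Submodule ℂ Grass where
  carrier := {x | x.IsOdd}
  zero_mem' := ⟨rfl, rfl⟩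
  add_mem' ha hb := ⟨by simp [ha.1, hb.1], by simp [ha.2, hb.2]⟩
  smul_mem' t _ ha := ⟨by simp [ha.1], by simp [ha.2]⟩

theorem algebraMap_eq (t : ℂ) : algebraMap ℂ Grass t = const t := by
  rw [Algebra.algebraMap_eq_smul_one]
  ext <;> simp [const]

end Grass

/-- The extension by zero of a function on an open set. -/
noncomputable def extendZero {X E : Type} [Zero E] [TopologicalSpace X] {U : Opens X} (f : U → E) :
    X → E :=
  open Classical in fun z => if h : z ∈ U then f ⟨z, h⟩ else 0

theorem extendZero_res {X E : Type} [Zero E] [TopologicalSpace X] {U V : Opens X} (h : V ≤ U)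
    (f : U → E) {z : X} (hz : z ∈ V) :
    extendZero (fun x : V => f ⟨x.1, h x.2⟩) =ᶠ[nhds z] extendZero f := by
  filter_upwards [V.isOpen.mem_nhds hz] with w hw
  have hw' : w ∈ V := hw
  simp [extendZero, hw', h hw']

/-- The superdomain `ℂ^{2|2}`: its superfunctions over an open set `U ⊆ ℂ²` are the holomorphic
functions from `U` to the Grassmann algebra in two odd generators. -/
noncomputable def superfunctionsC22 :
    SuperfunctionSheaf (TopCat.of (Fin 2 → ℂ)) (fun _ => Grass) where
  sub U :=
    { carrier := {f | ∀ z ∈ U, SuperAnalyticAt (extendZero f) z}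
      mul_mem' := fun {f g} hf hg z hz => by
        refine ((hf z hz).mul (hg z hz)).congr (Filter.Eventually.of_forall fun w => ?_)
        by_cases h : w ∈ U <;> simp [extendZero, h]
      add_mem' := fun {f g} hf hg z hz => by
        refine ((hf z hz).add (hg z hz)).congr (Filter.Eventually.of_forall fun w => ?_)
        by_cases h : w ∈ U <;> simp [extendZero, h]
      algebraMap_mem' := fun t z hz => by
        refine (SuperAnalyticAt.const (Grass.const t)).congr ?_
        filter_upwards [U.isOpen.mem_nhds hz] with w hw
        have hw' : w ∈ U := hw
        simp [extendZero, hw', Grass.algebraMap_eq] }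
  res_mem h f hf z hz := (hf z (h hz)).congr (extendZero_res h f hz).symm
  locality {U} f hf z hz := by
    obtain ⟨V, hV, h, h1⟩ := hf ⟨z, hz⟩
    exact (h1 z hV).congr (extendZero_res h f hV)
  ev _ := Grass.evenSub
  od _ := Grass.oddSub
  one_ev _ := ⟨rfl, rfl⟩
  ev_mul_ev _ a ha b hb := ⟨by simp [ha.1, hb.1], by simp [ha.2, hb.2]⟩
  ev_mul_od _ a ha b hb := ⟨by simp [hb.1], by simp [ha.1, ha.2, hb.1, hb.2]⟩
  od_mul_od _ a ha b hb := ⟨by simp [ha.1, hb.1], by simp [ha.1, hb.1]⟩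
  ev_comm _ a ha b := by
    ext <;> simp [ha.1, ha.2] <;> ring
  od_anticomm _ a ha b hb := by
    ext <;> simp [ha.1, ha.2, hb.1, hb.2]
    ring
  disj _ a ha hb := Grass.ext hb.1 ha.1 ha.2 hb.2
  split {U} f hf := by
    refine ⟨fun x => (f x).evenPart, fun z hz => ?_, fun x => (f x).oddPart, fun z hz => ?_,
      fun x => ⟨rfl, rfl⟩, fun x => ⟨rfl, rfl⟩, ?_⟩
    · refine (hf z hz).evenPart.congr (Filter.Eventually.of_forall fun w => ?_)
      by_cases h : w ∈ U <;> simp [extendZero, h, Grass.evenPart]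
      rfl
    · refine (hf z hz).oddPart.congr (Filter.Eventually.of_forall fun w => ?_)
      by_cases h : w ∈ U <;> simp [extendZero, h, Grass.oddPart]
      rfl
    · funext x
      ext <;> simp [Grass.evenPart, Grass.oddPart]

noncomputable def C22 : Superspace := superfunctionsC22.toSuperspace

/-- `M` is a complex supermanifold of dimension `2|2`: it is locally isomorphic to open
subsuperspaces of `ℂ^{2|2}`. -/
def Superspace.IsSupermanifold22 (M : Superspace) : Prop :=
  ∀ x : M.carrier, ∃ U : Opens M.carrier, x ∈ U ∧
    ∃ W : Opens (C22.carrier), Nonempty ((M.restrict U).Iso (C22.restrict W))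

/-! ## The complex projective plane -/

/-- The complex projective plane with the quotient topology. -/
def P2 : TopCat.{0} :=
  @TopCat.of (Projectivization ℂ (Fin 3 → ℂ))
    (inferInstanceAs (TopologicalSpace (Quotient (projectivizationSetoid ℂ (Fin 3 → ℂ)))))

namespace P2

/-- The homogeneous coordinates of (a representative of) a point. -/
noncomputable def rep (x : P2) : Fin 3 → ℂ := Projectivization.rep (K := ℂ) (V := Fin 3 → ℂ) x

/-- The point with the given homogeneous coordinates. -/
noncomputable def mk (v : Fin 3 → ℂ) (hv : v ≠ 0) : P2 := Projectivization.mk ℂ v hv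

theorem rep_ne_zero (x : P2) : rep x ≠ 0 := Projectivization.rep_nonzero _

theorem mk_rep (x : P2) : mk (rep x) (rep_ne_zero x) = x := Projectivization.mk_rep _

theorem rep_mk (v : Fin 3 → ℂ) (hv : v ≠ 0) : ∃ a : ℂ, a ≠ 0 ∧ rep (mk v hv) = a • v := by
  obtain ⟨a, ha⟩ := Projectivization.exists_smul_eq_mk_rep ℂ v hv
  exact ⟨a, a.ne_zero, ha.symm⟩

theorem continuous_mk' : Continuous fun v : {v : Fin 3 → ℂ // v ≠ 0} => mk v.1 v.2 :=
  continuous_quotient_mk'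

theorem isOpen_iff (s : Set P2) :
    IsOpen s ↔ IsOpen ((fun v : {v : Fin 3 → ℂ // v ≠ 0} => mk v.1 v.2) ⁻¹' s) := Iff.rfl

/-- The standard open set `U_i = {X_i ≠ 0}`. -/
def affine (i : Fin 3) : Opens P2 where
  carrier := {x | rep x i ≠ 0}
  is_open' := by
    rw [isOpen_iff]
    have : (fun v : {v : Fin 3 → ℂ // v ≠ 0} => mk v.1 v.2) ⁻¹' {x | rep x i ≠ 0} =
        {v | v.1 i ≠ 0} := by
      ext v
      obtain ⟨a, ha, h⟩ := rep_mk v.1 v.2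
      simp [h, ha]
    rw [this]
    exact isOpen_ne_fun ((continuous_apply i).comp continuous_subtype_val) continuous_const

theorem mem_affine {i : Fin 3} {x : P2} : x ∈ affine i ↔ rep x i ≠ 0 := Iff.rfl

/-- The homogeneous coordinates with `X_i = 1` of the point of `U_i` with the affine
coordinates `z`, the remaining homogeneous coordinates being listed in increasing order. -/
noncomputable def homog (i : Fin 3) (z : Fin 2 → ℂ) : Fin 3 → ℂ := i.insertNth (α := fun _ => ℂ) 1 z

theorem homog_self (i : Fin 3) (z : Fin 2 → ℂ) : homog i z i = 1 := by simp [homog]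

theorem homog_ne_zero (i : Fin 3) (z : Fin 2 → ℂ) : homog i z ≠ 0 := fun h => by
  simpa [homog_self] using congrFun h i

/-- The parametrization of `U_i` by `ℂ²`. -/
noncomputable def param (i : Fin 3) (z : Fin 2 → ℂ) : P2 := mk (homog i z) (homog_ne_zero i z)

/-- The affine coordinates `z_{1i}, z_{2i}` on `U_i`: on `U_0` these are `X_1/X_0, X_2/X_0`, on
`U_1` they are `X_0/X_1, X_2/X_1`, and on `U_2` they are `X_0/X_2, X_1/X_2`. -/
noncomputable def coord (i : Fin 3) (x : P2) : Fin 2 → ℂ :=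
  fun k => rep x (i.succAbove k) / rep x i

/-- The affine coordinates in the chart `i` as functions of those in the chart `j`. -/
noncomputable def change (i j : Fin 3) (w : Fin 2 → ℂ) : Fin 2 → ℂ :=
  fun k => homog j w (i.succAbove k) / homog j w i

theorem continuous_param (i : Fin 3) : Continuous (param i) := by
  have : Continuous fun z : Fin 2 → ℂ =>
      (⟨homog i z, homog_ne_zero i z⟩ : {v : Fin 3 → ℂ // v ≠ 0}) := by
    refine Continuous.subtype_mk (continuous_pi fun m => ?_) _
    refine Fin.succAboveCases i ?_ (fun k => ?_) m
    · simp only [homog_self]; exact continuous_const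
    · simp only [homog, Fin.insertNth_apply_succAbove]; exact continuous_apply k
  exact continuous_mk'.comp this

theorem param_mem (i : Fin 3) (z : Fin 2 → ℂ) : param i z ∈ affine i := by
  obtain ⟨a, ha, h⟩ := rep_mk (homog i z) (homog_ne_zero i z)
  rw [mem_affine, param, h]
  simp [homog_self, ha]

theorem homog_coord {i : Fin 3} {x : P2} (hx : x ∈ affine i) (m : Fin 3) :
    homog i (coord i x) m = rep x m / rep x i := by
  refine Fin.succAboveCases i ?_ (fun k => ?_) m
  · rw [homog_self, div_self hx]
  · simp [homog, coord]

theorem param_coord {i : Fin 3} {x : P2} (hx : x ∈ affine i) : param i (coord i x) = x := by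
  conv_rhs => rw [← mk_rep x]
  refine (Projectivization.mk_eq_mk_iff' ℂ _ _ _ _).2 ⟨(rep x i)⁻¹, ?_⟩
  funext m
  rw [homog_coord hx, Pi.smul_apply, smul_eq_mul, div_eq_inv_mul]

theorem change_coord {i j : Fin 3} {x : P2} (hj : x ∈ affine j) :
    change i j (coord j x) = coord i x := by
  funext k
  rw [change, homog_coord hj, homog_coord hj, coord, div_div_div_cancel_right₀ hj]

/-- The expression in the `i`-th affine chart, extended by zero, of a function `s` on `U` which
depends on a point and a standard affine chart around it. -/
noncomputable def inChart {E : Type} [Zero E] {U : Opens P2}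
    (s : ∀ x : U, {i // x.1 ∈ affine i} → E) (i : Fin 3) : (Fin 2 → ℂ) → E :=
  open Classical in fun z =>
    if h : param i z ∈ U then s ⟨param i z, h⟩ ⟨i, param_mem i z⟩ else 0

theorem inChart_of_mem {E : Type} [Zero E] {U : Opens P2}
    (s : ∀ x : U, {i // x.1 ∈ affine i} → E) {i : Fin 3} {z : Fin 2 → ℂ} (h : param i z ∈ U) :
    inChart s i z = s ⟨param i z, h⟩ ⟨i, param_mem i z⟩ := by
  simp [inChart, h]

theorem inChart_of_notMem {E : Type} [Zero E] {U : Opens P2}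
    (s : ∀ x : U, {i // x.1 ∈ affine i} → E) {i : Fin 3} {z : Fin 2 → ℂ} (h : param i z ∉ U) :
    inChart s i z = 0 := by
  simp [inChart, h]

theorem eventually_mem {U : Opens P2} {x : P2} (hx : x ∈ U) {i : Fin 3} (hi : x ∈ affine i) :
    ∀ᶠ z in nhds (coord i x), param i z ∈ U := by
  refine (continuous_param i).continuousAt.eventually_mem (U.isOpen.mem_nhds ?_)
  rw [param_coord hi]; exact hx

theorem inChart_res {E : Type} [Zero E] {U V : Opens P2} (h : V ≤ U)
    (s : ∀ x : U, {i // x.1 ∈ affine i} → E) {x : P2} (hx : x ∈ V) {i : Fin 3}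
    (hi : x ∈ affine i) :
    inChart (fun (y : V) k => s ⟨y.1, h y.2⟩ k) i =ᶠ[nhds (coord i x)] inChart s i := by
  filter_upwards [eventually_mem hx hi] with z hz
  rw [inChart_of_mem _ hz, inChart_of_mem _ (h hz)]

/-- The expression of a function `f` on `U` in the `i`-th affine chart, extended by zero. -/
noncomputable def fnInChart {U : Opens P2} (f : U → ℂ) (i : Fin 3) : (Fin 2 → ℂ) → ℂ :=
  inChart (fun x _ => f x) i

/-- The structure sheaf of the projective plane: holomorphic functions. -/
def hol (U : Opens P2) : Subalgebra ℂ (U → ℂ) where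
  carrier := {f | ∀ x ∈ U, ∀ i, x ∈ affine i → AnalyticAt ℂ (fnInChart f i) (coord i x)}
  mul_mem' {f g} hf hg x hx i hi := by
    refine ((hf x hx i hi).mul (hg x hx i hi)).congr (Filter.Eventually.of_forall fun z => ?_)
    by_cases h : param i z ∈ U <;> simp [fnInChart, inChart, h]
  add_mem' {f g} hf hg x hx i hi := by
    refine ((hf x hx i hi).add (hg x hx i hi)).congr (Filter.Eventually.of_forall fun z => ?_)
    by_cases h : param i z ∈ U <;> simp [fnInChart, inChart, h]
  algebraMap_mem' t x hx i hi := by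
    refine (analyticAt_const (v := t)).congr ?_
    filter_upwards [eventually_mem hx hi] with z hz
    simp [fnInChart, inChart, hz]

/-- The restriction of holomorphic functions. -/
def holRes {U V : Opens P2} (h : U ≤ V) : hol V →ₐ[ℂ] hol U where
  toFun f := ⟨fun x => f.1 ⟨x.1, h x.2⟩, fun x hx i hi =>
    (f.2 x (h hx) i hi).congr (inChart_res h (fun y _ => f.1 y) hx hi).symm⟩
  map_one' := rfl
  map_mul' _ _ := rfl
  map_zero' := rfl
  map_add' _ _ := rfl
  commutes' _ := rfl

/-- The sheaf `Ω¹` of holomorphic one-forms on the projective plane. A form on `U` is given at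
`x ∈ U` by its coefficients `s x i` with respect to `dz_{1i}, dz_{2i}` for every `i` with
`x ∈ U_i`; the coefficients are holomorphic and transform by the chain rule. -/
noncomputable def forms (U : Opens P2) :
    Submodule ℂ (∀ x : U, {i // x.1 ∈ affine i} → (Fin 2 → ℂ)) where
  carrier := {s |
    (∀ x : U, ∀ i : {i // x.1 ∈ affine i}, AnalyticAt ℂ (inChart s i.1) (coord i.1 x.1)) ∧
    ∀ x : U, ∀ i j : {i // x.1 ∈ affine i}, ∀ l : Fin 2,
      s x j l = ∑ k, s x i k *
        fderiv ℂ (fun w => change i.1 j.1 w k) (coord j.1 x.1) (Pi.single l 1)}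
  add_mem' {s t} hs ht := by
    refine ⟨fun x i => ?_, fun x i j l => ?_⟩
    · refine ((hs.1 x i).add (ht.1 x i)).congr (Filter.Eventually.of_forall fun z => ?_)
      by_cases h : param i.1 z ∈ U <;> simp [inChart, h]
    · simp only [Pi.add_apply, add_mul, Finset.sum_add_distrib, ← hs.2 x i j l, ← ht.2 x i j l]
  zero_mem' := by
    refine ⟨fun x i => ?_, fun x i j l => by simp⟩
    refine (analyticAt_const (v := 0)).congr (Filter.Eventually.of_forall fun z => ?_)
    by_cases h : param i.1 z ∈ U <;> simp [inChart, h]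
  smul_mem' t s hs := by
    refine ⟨fun x i => ?_, fun x i j l => ?_⟩
    · refine ((hs.1 x i).const_smul (c := t)).congr (Filter.Eventually.of_forall fun z => ?_)
      by_cases h : param i.1 z ∈ U <;> simp [inChart, h]
    · simp only [Pi.smul_apply, smul_eq_mul, mul_assoc, ← Finset.mul_sum, ← hs.2 x i j l]

/-! ## The `Π`-projective plane -/

/-- The super big cell matrix in the chart `i`: the first row is the even vector `(x | ξ)`, where
`x` has the entry `1` at the position `i` and the even coordinates `Z` at the others, and `ξ` has
the entry `0` at the position `i` and the odd coordinates `Θ` at the others; the second row is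
the image `(-ξ | x)` of the first one under the odd involution of `ℂ^{3|3}`. -/
def bigCell (i : Fin 3) (Z Θ : Fin 2 → Grass) : Matrix (Fin 2) (Fin 3 ⊕ Fin 3) Grass :=
  Matrix.of
    ![Sum.elim (i.insertNth (α := fun _ => Grass) 1 Z) (i.insertNth (α := fun _ => Grass) 0 Θ),
      Sum.elim (fun m => -(i.insertNth (α := fun _ => Grass) 0 Θ m))
        (i.insertNth (α := fun _ => Grass) 1 Z)]

/-- The `1|1 × 1|1` minor formed by the `i`-th even and the `i`-th odd column. -/
def minor (i : Fin 3) (A : Matrix (Fin 2) (Fin 3 ⊕ Fin 3) Grass) : Matrix (Fin 2) (Fin 2) Grass :=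
  A.submatrix id ![Sum.inl i, Sum.inr i]

/-- The row reduction `B⁻¹ A` of the big cell matrix `A` of the chart `j` at the point with even
coordinates `w`, where `B` is the `i`-th minor of `A`. Its rows span the same `1|1`-submodule as
those of `A`, and it is the big cell matrix of this submodule in the chart `i`. -/
noncomputable def reduced (i j : Fin 3) (w : Fin 2 → ℂ) : Matrix (Fin 2) (Fin 3 ⊕ Fin 3) Grass :=
  Ring.inverse (minor i (bigCell j (fun k => Grass.const (w k)) Grass.theta)) *
    bigCell j (fun k => Grass.const (w k)) Grass.theta

/-- The even coordinates of the chart `i` in terms of those of the chart `j`. -/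
noncomputable def transEven (i j : Fin 3) (w : Fin 2 → ℂ) : Fin 2 → Grass :=
  fun k => reduced i j w 0 (Sum.inl (i.succAbove k))

/-- The odd coordinates of the chart `i` in terms of those of the chart `j`. -/
noncomputable def transOdd (i j : Fin 3) (w : Fin 2 → ℂ) : Fin 2 → Grass :=
  fun k => reduced i j w 0 (Sum.inr (i.succAbove k))

/-- The odd part of the first row of the big cell matrix in the chart `j`. -/
def oddRow (j : Fin 3) : Fin 3 → Grass := j.insertNth (α := fun _ => Grass) 0 Grass.theta

theorem theta_isOdd (k : Fin 2) : (Grass.theta k).IsOdd := by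
  fin_cases k <;> exact ⟨rfl, rfl⟩

theorem oddRow_isOdd (j m : Fin 3) : (oddRow j m).IsOdd := by
  refine Fin.succAboveCases j ?_ (fun k => ?_) m
  · simp only [oddRow, Fin.insertNth_apply_same]; exact ⟨rfl, rfl⟩
  · simp only [oddRow, Fin.insertNth_apply_succAbove]; exact theta_isOdd k

theorem evenRow_eq (j : Fin 3) (w : Fin 2 → ℂ) (m : Fin 3) :
    j.insertNth (α := fun _ => Grass) 1 (fun k => Grass.const (w k)) m =
      Grass.const (homog j w m) := by
  refine Fin.succAboveCases j ?_ (fun k => ?_) m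
  · simp only [homog, Fin.insertNth_apply_same]; rfl
  · simp only [homog, Fin.insertNth_apply_succAbove]

theorem bigCell_eq (j : Fin 3) (w : Fin 2 → ℂ) :
    bigCell j (fun k => Grass.const (w k)) Grass.theta =
      Matrix.of ![Sum.elim (fun m => Grass.const (homog j w m)) (oddRow j),
        Sum.elim (fun m => -oddRow j m) (fun m => Grass.const (homog j w m))] := by
  have h := funext (evenRow_eq j w)
  rw [bigCell, h]
  rfl

theorem inverse_minor (i j : Fin 3) (w : Fin 2 → ℂ) (h : homog j w i ≠ 0) :
    Ring.inverse (minor i (bigCell j (fun k => Grass.const (w k)) Grass.theta)) =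
      !![Grass.const (homog j w i)⁻¹, -(Grass.const ((homog j w i) ^ 2)⁻¹ * oddRow j i);
        Grass.const ((homog j w i) ^ 2)⁻¹ * oddRow j i, Grass.const (homog j w i)⁻¹] := by
  set x := homog j w i with hx
  obtain ⟨h0, h12⟩ := oddRow_isOdd j i
  set ξ := oddRow j i with hξ
  have hA : minor i (bigCell j (fun k => Grass.const (w k)) Grass.theta) =
      !![Grass.const x, ξ; -ξ, Grass.const x] := by
    rw [bigCell_eq]
    refine Matrix.ext fun a b => ?_
    fin_cases a <;> fin_cases b <;> rfl
  rw [hA]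
  let u : (Matrix (Fin 2) (Fin 2) Grass)ˣ :=
    { val := !![Grass.const x, ξ; -ξ, Grass.const x]
      inv := !![Grass.const x⁻¹, -(Grass.const (x ^ 2)⁻¹ * ξ);
        Grass.const (x ^ 2)⁻¹ * ξ, Grass.const x⁻¹]
      val_inv := by
        rw [Matrix.mul_fin_two, Matrix.one_fin_two]
        refine Matrix.ext fun a b => ?_
        fin_cases a <;> fin_cases b <;> ext <;> simp [Grass.const, h0, h12, h] <;>
          field_simp <;> ring
      inv_val := by
        rw [Matrix.mul_fin_two, Matrix.one_fin_two]
        refine Matrix.ext fun a b => ?_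
        fin_cases a <;> fin_cases b <;> ext <;> simp [Grass.const, h0, h12, h] <;>
          field_simp <;> ring }
  exact Ring.inverse_unit u

theorem transEven_apply (i j : Fin 3) (w : Fin 2 → ℂ) (h : homog j w i ≠ 0) (k : Fin 2) :
    transEven i j w k = Grass.const (homog j w (i.succAbove k) / homog j w i) +
      Grass.const ((homog j w i) ^ 2)⁻¹ * (oddRow j i * oddRow j (i.succAbove k)) := by
  rw [transEven, reduced, inverse_minor i j w h, bigCell_eq, Matrix.mul_apply, Fin.sum_univ_two]
  simp [Grass.const]
  ext <;> simp <;> ring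

theorem transOdd_apply (i j : Fin 3) (w : Fin 2 → ℂ) (h : homog j w i ≠ 0) (k : Fin 2) :
    transOdd i j w k = Grass.const (homog j w i)⁻¹ * oddRow j (i.succAbove k) -
      Grass.const (homog j w (i.succAbove k) / (homog j w i) ^ 2) * oddRow j i := by
  rw [transOdd, reduced, inverse_minor i j w h, bigCell_eq, Matrix.mul_apply, Fin.sum_univ_two]
  obtain ⟨h0, h12⟩ := oddRow_isOdd j i
  simp [Grass.const]
  ext <;> simp [h0, h12, sub_eq_add_neg] <;> ring

theorem transOdd_isOdd (i j : Fin 3) (w : Fin 2 → ℂ) (h : homog j w i ≠ 0) (k : Fin 2) :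
    (transOdd i j w k).IsOdd := by
  obtain ⟨h0, h12⟩ := oddRow_isOdd j i
  obtain ⟨h0', h12'⟩ := oddRow_isOdd j (i.succAbove k)
  rw [transOdd_apply i j w h k]
  constructor <;> simp [Grass.const, sub_eq_add_neg, h0, h12, h0', h12']

theorem transEven_body (i j : Fin 3) (w : Fin 2 → ℂ) (h : homog j w i ≠ 0) :
    (fun k => (transEven i j w k).c0) = change i j w := by
  obtain ⟨h0, h12⟩ := oddRow_isOdd j i
  funext k
  rw [transEven_apply i j w h k]
  simp [Grass.const, change, h0]

/-- The reduced matrix is the big cell matrix of the chart `i` in the new coordinates. -/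
theorem reduced_eq_bigCell (i j : Fin 3) (w : Fin 2 → ℂ) (h : homog j w i ≠ 0) :
    reduced i j w = bigCell i (transEven i j w) (transOdd i j w) := by
  obtain ⟨h0, h12⟩ := oddRow_isOdd j i
  have h1 : ∀ m, reduced i j w 0 (Sum.inl m) = reduced i j w 1 (Sum.inr m) := by
    intro m
    rw [reduced, inverse_minor i j w h, bigCell_eq, Matrix.mul_apply, Matrix.mul_apply,
      Fin.sum_univ_two, Fin.sum_univ_two]
    simp [Grass.const]
    ext <;> simp <;> ring
  have h2 : ∀ m, reduced i j w 1 (Sum.inl m) = -reduced i j w 0 (Sum.inr m) := by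
    intro m
    rw [reduced, inverse_minor i j w h, bigCell_eq, Matrix.mul_apply, Matrix.mul_apply,
      Fin.sum_univ_two, Fin.sum_univ_two]
    simp [Grass.const]
  have h3 : ∀ m, reduced i j w 0 (Sum.inl m) =
      i.insertNth (α := fun _ => Grass) 1 (transEven i j w) m := by
    intro m
    refine Fin.succAboveCases i ?_ (fun k => ?_) m
    · rw [Fin.insertNth_apply_same, reduced, inverse_minor i j w h, bigCell_eq, Matrix.mul_apply,
        Fin.sum_univ_two]
      ext <;> simp [Grass.const, h0, h12, h] <;> ring
    · rw [Fin.insertNth_apply_succAbove, transEven]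
  have h4 : ∀ m, reduced i j w 0 (Sum.inr m) =
      i.insertNth (α := fun _ => Grass) 0 (transOdd i j w) m := by
    intro m
    refine Fin.succAboveCases i ?_ (fun k => ?_) m
    · rw [Fin.insertNth_apply_same, reduced, inverse_minor i j w h, bigCell_eq, Matrix.mul_apply,
        Fin.sum_univ_two]
      ext <;> simp [Grass.const, h0, h12] <;> field_simp <;> ring
    · rw [Fin.insertNth_apply_succAbove, transOdd]
  refine Matrix.ext fun a b => ?_
  fin_cases a <;> rcases b with m | m
  · exact h3 m
  · exact h4 m
  · exact (h2 m).trans (congrArg _ (h4 m))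
  · exact (h1 m).symm.trans (h3 m)


theorem homog_coord_ne_zero {i j : Fin 3} {x : P2} (hi : x ∈ affine i) (hj : x ∈ affine j) :
    homog j (coord j x) i ≠ 0 := by
  rw [homog_coord hj]; exact div_ne_zero hi hj

theorem transEven_body_coord {i j : Fin 3} {x : P2} (hi : x ∈ affine i) (hj : x ∈ affine j) :
    (fun k => (transEven i j (coord j x) k).c0) = coord i x := by
  rw [transEven_body _ _ _ (homog_coord_ne_zero hi hj), change_coord hj]

/-- The condition on `s` to be a superfunction on the `Π`-projective plane: for `x ∈ U_i`, the
value at `x` of the `i`-th chart expression `F_i(z_{1i}, z_{2i}, θ_{1i}, θ_{2i})` is `s x i`; the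
chart expressions are holomorphic, and the substitution of the transition functions between
the big cells turns `F_i` into `F_j`. -/
def IsPiSuperfunction {U : Opens P2} (s : ∀ x : U, {i // x.1 ∈ affine i} → Grass) : Prop :=
  ∀ (x : U) (i : {i // x.1 ∈ affine i}), SuperAnalyticAt (inChart s i.1) (coord i.1 x.1) ∧
    ∀ j : {i // x.1 ∈ affine i}, s x j = superEval (inChart s i.1)
      (transEven i.1 j.1 (coord j.1 x.1)) (transOdd i.1 j.1 (coord j.1 x.1))

namespace IsPiSuperfunction

variable {U V : Opens P2} {s t : ∀ x : U, {i // x.1 ∈ affine i} → Grass}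

theorem add (hs : IsPiSuperfunction s) (ht : IsPiSuperfunction t) : IsPiSuperfunction (s + t) := by
  intro x i
  have e : inChart (s + t) i.1 = inChart s i.1 + inChart t i.1 := by
    funext z
    by_cases h : param i.1 z ∈ U <;> simp [inChart, h]
  rw [e]
  refine ⟨(hs x i).1.add (ht x i).1, fun j => ?_⟩
  have hb := transEven_body_coord i.2 j.2
  rw [superEval_add (hb ▸ (hs x i).1) (hb ▸ (ht x i).1), ← (hs x i).2 j, ← (ht x i).2 j]
  rfl

theorem mul (hs : IsPiSuperfunction s) (ht : IsPiSuperfunction t) : IsPiSuperfunction (s * t) := by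
  intro x i
  have e : inChart (s * t) i.1 = inChart s i.1 * inChart t i.1 := by
    funext z
    by_cases h : param i.1 z ∈ U <;> simp [inChart, h]
  rw [e]
  refine ⟨(hs x i).1.mul (ht x i).1, fun j => ?_⟩
  have hb := transEven_body_coord i.2 j.2
  rw [superEval_mul (hb ▸ (hs x i).1) (hb ▸ (ht x i).1)
    (transOdd_isOdd _ _ _ (homog_coord_ne_zero i.2 j.2)), ← (hs x i).2 j, ← (ht x i).2 j]
  rfl

theorem const (a : ℂ) : IsPiSuperfunction (U := U) fun _ _ => Grass.const a := by
  intro x i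
  have e : (fun _ => Grass.const a) =ᶠ[nhds (coord i.1 x.1)]
      inChart (U := U) (fun _ _ => Grass.const a) i.1 := by
    filter_upwards [eventually_mem x.2 i.2] with z hz
    rw [inChart_of_mem _ hz]
  refine ⟨(SuperAnalyticAt.const _).congr e, fun j => ?_⟩
  have hb := transEven_body_coord i.2 j.2
  rw [← superEval_congr (hb ▸ e), superEval_const]

theorem congr_at (hs : IsPiSuperfunction s) (h : V ≤ U) :
    IsPiSuperfunction fun (x : V) i => s ⟨x.1, h x.2⟩ i := by
  intro x i
  have e := inChart_res h s x.2 i.2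
  refine ⟨(hs ⟨x.1, h x.2⟩ i).1.congr e.symm, fun j => ?_⟩
  have hb := transEven_body_coord i.2 j.2
  rw [superEval_congr (hb ▸ e), ← (hs ⟨x.1, h x.2⟩ i).2 j]

theorem of_local (s : ∀ x : U, {i // x.1 ∈ affine i} → Grass)
    (hs : ∀ x : U, ∃ (V : Opens P2) (_ : x.1 ∈ V) (h : V ≤ U),
      IsPiSuperfunction fun (x : V) i => s ⟨x.1, h x.2⟩ i) : IsPiSuperfunction s := by
  intro x i
  obtain ⟨V, hx, h, h1⟩ := hs x
  have e := inChart_res h s hx i.2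
  refine ⟨(h1 ⟨x.1, hx⟩ i).1.congr e, fun j => ?_⟩
  have hb := transEven_body_coord i.2 j.2
  rw [← superEval_congr (hb ▸ e)]
  exact (h1 ⟨x.1, hx⟩ i).2 j

theorem evenPart (hs : IsPiSuperfunction s) : IsPiSuperfunction fun x i => (s x i).evenPart := by
  intro x i
  have e : inChart (fun x i => (s x i).evenPart) i.1 = fun z => (inChart s i.1 z).evenPart := by
    funext z
    by_cases h : param i.1 z ∈ U <;> simp [inChart, h]
    rfl
  rw [e]
  refine ⟨(hs x i).1.evenPart, fun j => ?_⟩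
  rw [superEval_evenPart (transOdd_isOdd _ _ _ (homog_coord_ne_zero i.2 j.2)), ← (hs x i).2 j]

theorem oddPart (hs : IsPiSuperfunction s) : IsPiSuperfunction fun x i => (s x i).oddPart := by
  intro x i
  have e : inChart (fun x i => (s x i).oddPart) i.1 = fun z => (inChart s i.1 z).oddPart := by
    funext z
    by_cases h : param i.1 z ∈ U <;> simp [inChart, h]
    rfl
  rw [e]
  refine ⟨(hs x i).1.oddPart, fun j => ?_⟩
  rw [superEval_oddPart (transOdd_isOdd _ _ _ (homog_coord_ne_zero i.2 j.2)), ← (hs x i).2 j]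

end IsPiSuperfunction

/-- The structure sheaf of the `Π`-projective plane. -/
noncomputable def superfunctionsPi :
    SuperfunctionSheaf P2 (fun x => {i // x ∈ affine i} → Grass) where
  sub U :=
    { carrier := {s | IsPiSuperfunction s}
      mul_mem' := fun hs ht => hs.mul ht
      add_mem' := fun hs ht => hs.add ht
      algebraMap_mem' := fun a => by
        have : (algebraMap ℂ (∀ x : U, {i // x.1 ∈ affine i} → Grass) a) =
            fun _ _ => Grass.const a := by
          funext x i
          exact Grass.algebraMap_eq a
        rw [this]
        exact IsPiSuperfunction.const a }
  res_mem h _ hs := IsPiSuperfunction.congr_at hs h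
  locality s hs := IsPiSuperfunction.of_local s hs
  ev _ :=
    { carrier := {a | ∀ i, (a i).IsEven}
      zero_mem' := fun _ => Grass.evenSub.zero_mem
      add_mem' := fun ha hb i => Grass.evenSub.add_mem (ha i) (hb i)
      smul_mem' := fun t _ ha i => Grass.evenSub.smul_mem t (ha i) }
  od _ :=
    { carrier := {a | ∀ i, (a i).IsOdd}
      zero_mem' := fun _ => Grass.oddSub.zero_mem
      add_mem' := fun ha hb i => Grass.oddSub.add_mem (ha i) (hb i)
      smul_mem' := fun t _ ha i => Grass.oddSub.smul_mem t (ha i) }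
  one_ev _ _ := ⟨rfl, rfl⟩
  ev_mul_ev _ a ha b hb i := by
    obtain ⟨h1, h2⟩ := ha i
    obtain ⟨h3, h4⟩ := hb i
    exact ⟨by simp [h1, h3], by simp [h2, h4]⟩
  ev_mul_od _ a ha b hb i := by
    obtain ⟨h1, h2⟩ := ha i
    obtain ⟨h3, h4⟩ := hb i
    exact ⟨by simp [h3], by simp [h1, h2, h3, h4]⟩
  od_mul_od _ a ha b hb i := by
    obtain ⟨h1, h2⟩ := ha i
    obtain ⟨h3, h4⟩ := hb i
    exact ⟨by simp [h1, h3], by simp [h1, h3]⟩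
  ev_comm _ a ha b := by
    funext i
    obtain ⟨h1, h2⟩ := ha i
    ext <;> simp [h1, h2] <;> ring
  od_anticomm _ a ha b hb := by
    funext i
    obtain ⟨h1, h2⟩ := ha i
    obtain ⟨h3, h4⟩ := hb i
    ext <;> simp [h1, h2, h3, h4]
    ring
  disj _ a ha hb := funext fun i => Grass.ext (hb i).1 (ha i).1 (ha i).2 (hb i).2
  split s hs := ⟨_, IsPiSuperfunction.evenPart hs, _, IsPiSuperfunction.oddPart hs,
    fun _ _ => ⟨rfl, rfl⟩, fun _ _ => ⟨rfl, rfl⟩, by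
      funext x i
      ext <;> simp [Grass.evenPart, Grass.oddPart]⟩

end P2

/-- Manin's `Π`-projective plane, the Grassmannian of the `1|1`-dimensional `Π`-symmetric
subspaces of `ℂ^{3|3}`: the three big cells, with coordinates `z_{1i}, z_{2i}, θ_{1i}, θ_{2i}`, are
glued by means of row reduction of the big cell matrices. -/
noncomputable def PiProjectivePlane : Superspace := P2.superfunctionsPi.toSuperspace

/-! ## Supermanifolds over the projective plane and their invariants -/

namespace Superspace

/-- An isomorphism `M_red ≅ ℙ²`, in the form of the structural exact sequence
`0 → J_M → O_M → O_{ℙ²} → 0` of sheaves of algebras. -/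
structure Reduction (M : Superspace) where
  homeo : M.carrier ≃ₜ P2
  proj : ∀ V : Opens P2, M.sec (V.comap homeo) →ₐ[ℂ] P2.hol V
  proj_res : ∀ {V W : Opens P2} (h : W ≤ V) (s : M.sec (V.comap homeo)),
    proj W (M.res (fun _ hx => h hx) s) = P2.holRes h (proj V s)
  locally_surjective : ∀ (V : Opens P2) (f : P2.hol V), ∀ x ∈ V,
    ∃ (W : Opens P2) (h : W ≤ V) (s : M.sec (W.comap homeo)), x ∈ W ∧ proj W s = P2.holRes h f
  ker : ∀ (V : Opens P2) (s : M.sec (V.comap homeo)),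
    proj V s = 0 ↔ s ∈ M.nil (V.comap homeo)

namespace Reduction

variable {M : Superspace}

/-- The open subset of `M` corresponding to an open subset of `ℙ²`. -/
abbrev pre (r : M.Reduction) (V : Opens P2) : Opens M.carrier := V.comap r.homeo

theorem pre_mono (r : M.Reduction) {W V : Opens P2} (h : W ≤ V) : r.pre W ≤ r.pre V :=
  fun _ hx => h hx

/-- An isomorphism `F_M = J_M / J_M² ≅ Π Ω¹_{ℙ²}` of sheaves of `O_{ℙ²}`-modules, in the form of an
exact sequence `0 → J_M² → J_M → Ω¹_{ℙ²} → 0`. (The sheaf `J_M / J_M²` is purely odd.) -/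
structure CotangentFermions (r : M.Reduction) where
  form : ∀ V : Opens P2, M.nil (r.pre V) →+ P2.forms V
  form_res : ∀ {V W : Opens P2} (h : W ≤ V) (s : M.nil (r.pre V)) (x : W) (i),
    (form W ⟨M.res (r.pre_mono h) s.1, M.res_mem_nil _ _ s.2⟩).1 x i =
      (form V s).1 ⟨x.1, h x.2⟩ i
  form_smul : ∀ (V : Opens P2) (a : M.sec (r.pre V)) (s : M.nil (r.pre V)) (x : V) (i),
    (form V (a • s)).1 x i = (r.proj V a).1 x • (form V s).1 x i
  locally_surjective : ∀ (V : Opens P2) (α : P2.forms V), ∀ x ∈ V,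
    ∃ (W : Opens P2) (h : W ≤ V) (s : M.nil (r.pre W)), x ∈ W ∧
      ∀ (y : W) (i), (form W s).1 y i = α.1 ⟨y.1, h y.2⟩ i
  ker : ∀ (V : Opens P2) (s : M.nil (r.pre V)), form V s = 0 ↔ s.1 ∈ M.nilSq (r.pre V)

/-- A splitting over `U` of the structural exact sequence: a morphism of sheaves of
superalgebras `O_{ℙ²}|_U → O_M|_U` which is a section of `O_M → O_{ℙ²}`. -/
structure Splitting (r : M.Reduction) (U : Opens P2) where
  lift : ∀ W : Opens P2, W ≤ U → (P2.hol W →ₐ[ℂ] M.sec (r.pre W))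
  lift_res : ∀ {V W : Opens P2} (h : W ≤ V) (hV : V ≤ U) (f : P2.hol V),
    lift W (h.trans hV) (P2.holRes h f) = M.res (r.pre_mono h) (lift V hV f)
  lift_even : ∀ (W : Opens P2) (hW : W ≤ U) (f : P2.hol W), lift W hW f ∈ M.even (r.pre W)
  proj_lift : ∀ (W : Opens P2) (hW : W ≤ U) (f : P2.hol W), r.proj W (lift W hW f) = f

/-- A section over `U` of `T_{ℙ²} ⊗ Sym² F_M`, where `Sym² F_M` is identified with `J_M²` by
multiplication (and `J_M³ = 0` makes `J_M²` an `O_{ℙ²}`-module): a `ℂ`-linear derivation of sheaves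
`O_{ℙ²}|_U → J_M²|_U`. -/
structure Derivation (r : M.Reduction) (U : Opens P2) where
  toFun : ∀ W : Opens P2, W ≤ U → (P2.hol W →ₗ[ℂ] M.sec (r.pre W))
  map_res : ∀ {V W : Opens P2} (h : W ≤ V) (hV : V ≤ U) (f : P2.hol V),
    toFun W (h.trans hV) (P2.holRes h f) = M.res (r.pre_mono h) (toFun V hV f)
  mem_nilSq : ∀ (W : Opens P2) (hW : W ≤ U) (f : P2.hol W), toFun W hW f ∈ M.nilSq (r.pre W)
  leibniz : ∀ (W : Opens P2) (hW : W ≤ U), ∀ a ∈ M.even (r.pre W), ∀ b ∈ M.even (r.pre W),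
    toFun W hW (r.proj W a * r.proj W b) =
      a * toFun W hW (r.proj W b) + b * toFun W hW (r.proj W a)

/-- For `j = i + 1` and the remaining index `k` modulo 3, the function
`ε_j (X_j/X_i)² ∂f/∂(X_k/X_i)` on `U_i ∩ U_j`, with `ε_1 = 1`, `ε_2 = ε_0 = -1`. -/
noncomputable def stdCoeff {W : Opens P2} (f : P2.hol W) (i : Fin 3) (x : P2) : ℂ :=
  ![1, -1, -1] i * (P2.rep x (i + 1) / P2.rep x i) ^ 2 *
    fderiv ℂ (P2.fnInChart f.1 i) (P2.coord i x) fun l => if i.succAbove l = i + 2 then 1 else 0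

/-- The standard Čech 1-cocycle of `T_{ℙ²} ⊗ Sym² F_M` for the covering by `U_0, U_1, U_2`, given by
`ω_{ij} = ε_j (X_j/X_i)² θ_{1j} θ_{2j} ∂/∂(X_k/X_i)` for `(i, j, k)` a cyclic permutation of
`(0, 1, 2)`, where `θ_{lj} ∈ J_M` are any lifts of `dz_{lj}`; explicitly
`ω_{01} = z_{11}⁻² θ_{11} θ_{21} ∂/∂z_{20}`, `ω_{12} = -z_{22}⁻² θ_{12} θ_{22} ∂/∂z_{11}`,
`ω_{20} = -z_{20}⁻² θ_{10} θ_{20} ∂/∂z_{22}`. The signs are due to the fact that under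
`Ω² ≅ O(-3)` the form `dz_{1j} ∧ dz_{2j}` corresponds to `(-1)^j X_j⁻³`; the class of `ω` is the
generator of `H¹(T_{ℙ²} ⊗ Sym² F_M) ≅ H¹(T_{ℙ²}(-3)) ≅ H²(O(-3)) ≅ ℂ` given by
`1 / (X_0 X_1 X_2)`, up to sign. -/
def IsStandardCocycle {r : M.Reduction} (φ : r.CotangentFermions)
    (c : ∀ i : Fin 3, r.Derivation (P2.affine i ⊓ P2.affine (i + 1))) : Prop :=
  ∀ (i : Fin 3) (W : Opens P2) (hW : W ≤ P2.affine i ⊓ P2.affine (i + 1)) (f : P2.hol W),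
    ∀ a ∈ M.even (r.pre W), (∀ x : W, (r.proj W a).1 x = stdCoeff f i x.1) →
    ∀ t₁ t₂ : M.nil (r.pre W),
      (∀ x : W, (φ.form W t₁).1 x ⟨i + 1, (hW x.2).2⟩ = Pi.single 0 1) →
      (∀ x : W, (φ.form W t₂).1 x ⟨i + 1, (hW x.2).2⟩ = Pi.single 1 1) →
      (c i).toFun W hW f = a * (t₁.1 * t₂.1)

/-- The obstruction class `ω_M ∈ H¹(T_{ℙ²} ⊗ Sym² F_M)` is `lam` times the class of the standard
cocycle `ω`. The obstruction class is represented by the differences `σ_i - σ_j` of local splittings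
of the structural exact sequence, here over the covering by the affine planes `U_i`;
the Čech classes agree when `σ_i - σ_j` and `lam ω_{ij}` differ by the coboundary of a
0-cochain `d`. -/
def HasObstructionClass {r : M.Reduction} (φ : r.CotangentFermions) (lam : ℂ) : Prop :=
  ∃ c : ∀ i : Fin 3, r.Derivation (P2.affine i ⊓ P2.affine (i + 1)), IsStandardCocycle φ c ∧
    ∃ (σ : ∀ i : Fin 3, r.Splitting (P2.affine i)) (d : ∀ i : Fin 3, r.Derivation (P2.affine i)),
      ∀ (i : Fin 3) (W : Opens P2) (hW : W ≤ P2.affine i ⊓ P2.affine (i + 1)) (f : P2.hol W),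
        (σ i).lift W (hW.trans inf_le_left) f - (σ (i + 1)).lift W (hW.trans inf_le_right) f =
          lam • (c i).toFun W hW f + ((d i).toFun W (hW.trans inf_le_left) f -
            (d (i + 1)).toFun W (hW.trans inf_le_right) f)

end Reduction

/-- `M` is a complex supermanifold of dimension `2|2` given by the triple `(ℙ², Π Ω¹_{ℙ²}, lam)`: its
reduced manifold is `ℙ²`, its fermionic sheaf is `Π Ω¹_{ℙ²}`, and its obstruction class is `lam` in
`H¹(T_{ℙ²} ⊗ Sym² Π Ω¹_{ℙ²}) ≅ ℂ`. -/
def IsGivenByTriple (M : Superspace) (lam : ℂ) : Prop :=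
  M.IsSupermanifold22 ∧ ∃ (r : M.Reduction) (φ : r.CotangentFermions),
    Reduction.HasObstructionClass φ lam

end Superspace

/-!
A supermanifold `M` of dimension `2|2` with reduced manifold `ℙ²` and fermionic sheaf `Π Ω¹` is
rigid once its obstruction class is known, because `J³ = 0`: an odd section is the same thing as a
one-form (`eq_of_oddForm_eq`, `exists_odd_lift`), since the odd part of `J` meets `J²` in zero. So
over the affine plane `U_i` there are canonical odd coordinates `θ_{li}` representing `dz_{li}`, and
a splitting `σ_i` of `O_M → O_{ℙ²}` over `U_i` identifies `O_M` with the Grassmann-algebra-valued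
holomorphic functions (`frame_bijective`). If the obstruction class is `lam [ω]`, the derivations
of a coboundary can be absorbed in the splittings, so that `σ_i - σ_{i+1} = lam ω_{i,i+1}` exactly
(`HasObstructionClass.exists_isAdapted`). The transition functions between the frames then involve
only the Jacobians of the coordinate changes and `lam` (`frame_transition`); consequently any two
supermanifolds given by the same triple are isomorphic (`IsGivenByTriple.nonempty_iso`).

If `M` were projected, a global splitting would turn the `σ_i` into derivations `D_i` on `U_i` with
values in `J²` and with `D_0 - D_1 = lam ω_{01}`. Applied to `X_2/X_0` and restricted to the line
`X_2 = 0`, this is an identity `z² G(z) + lam z + H(z⁻¹) = 0` with entire functions `G` and `H`, and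
Liouville's theorem gives `lam = 0` (`false_of_isProjected`).

For the `Π`-projective plane, row reduction shows that the odd transition functions are those of
`dz_{1i}, dz_{2i}` (`P2.fderiv_change`) and that the substitution of the even ones changes a
function `f` by the coefficient of `d log (X_i/X_j) ∧ df` (`P2.fderiv_transEven_c12`). For `j = i + 1`
this is the standard cocycle (`P2.stdCoeff_eq_defect`). Representing `t dz_{li}` rather than
`dz_{li}` by `θ_{li}` multiplies the class by `t²`; hence every nonzero `lam` occurs
(`PiProjectivePlane.hasObstructionClass`).
-/

namespace Superspace

variable {M : Superspace}

/-! ### Sections of a superspace: gluing and parity -/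

theorem res_self {U : Opens M.carrier} (h : U ≤ U) (s : M.sec U) : M.res h s = s := by
  have : (homOfLE h) = 𝟙 U := rfl
  simp only [res, this, op_id, CategoryTheory.Functor.map_id]
  rfl

theorem ext_of_locally {V : Opens M.carrier} {s t : M.sec V}
    (h : ∀ x ∈ V, ∃ (W : Opens M.carrier) (h : W ≤ V), x ∈ W ∧ M.res h s = M.res h t) :
    s = t := by
  choose W hW hx he using h
  refine TopCat.Sheaf.eq_of_locally_eq' M.sheaf (fun x : V => W x.1 x.2) V
    (fun x => homOfLE (hW x.1 x.2)) (fun x hxV => ?_) s t fun x => he x.1 x.2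
  exact Opens.mem_iSup.2 ⟨⟨x, hxV⟩, hx x hxV⟩

theorem exists_glue {ι : Type} {V : Opens M.carrier} {U : ι → Opens M.carrier}
    (hU : ∀ i, U i ≤ V) (hc : ∀ x ∈ V, ∃ i, x ∈ U i) (s : ∀ i, M.sec (U i))
    (hs : ∀ i j, M.res (inf_le_left : U i ⊓ U j ≤ U i) (s i) =
      M.res (inf_le_right : U i ⊓ U j ≤ U j) (s j)) :
    ∃ t : M.sec V, ∀ i, M.res (hU i) t = s i := by
  obtain ⟨t, ht, -⟩ := TopCat.Sheaf.existsUnique_gluing' M.sheaf U V (fun i => homOfLE (hU i))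
    (fun x hx => Opens.mem_iSup.2 (hc x hx)) s fun i j => hs i j
  exact ⟨t, ht⟩

theorem exists_even_add_odd {U : Opens M.carrier} (s : M.sec U) :
    ∃ e ∈ M.even U, ∃ o ∈ M.odd U, e + o = s :=
  Submodule.mem_sup.1 ((M.isCompl U).sup_eq_top ▸ Submodule.mem_top (x := s))

theorem eq_zero_of_even_of_odd {U : Opens M.carrier} {s : M.sec U} (h : s ∈ M.even U)
    (h' : s ∈ M.odd U) : s = 0 :=
  Submodule.disjoint_def.1 (M.isCompl U).disjoint s h h'

theorem parts_eq {U : Opens M.carrier} {e e' o o' : M.sec U} (he : e ∈ M.even U)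
    (he' : e' ∈ M.even U) (ho : o ∈ M.odd U) (ho' : o' ∈ M.odd U) (h : e + o = e' + o') :
    e = e' ∧ o = o' := by
  have h1 : e - e' = o' - o := by
    rw [sub_eq_sub_iff_add_eq_add, h, add_comm]
  have h2 : e - e' = 0 := eq_zero_of_even_of_odd (Submodule.sub_mem _ he he')
    (h1 ▸ Submodule.sub_mem _ ho' ho)
  exact ⟨sub_eq_zero.1 h2, (sub_eq_zero.1 (h1 ▸ h2)).symm⟩

theorem res_even {U V : Opens M.carrier} (h : U ≤ V) {s : M.sec V} (hs : s ∈ M.even V) :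
    M.res h s ∈ M.even U := M.map_even _ s hs

theorem res_odd {U V : Opens M.carrier} (h : U ≤ V) {s : M.sec V} (hs : s ∈ M.odd V) :
    M.res h s ∈ M.odd U := M.map_odd _ s hs

theorem even_of_locally {V : Opens M.carrier} {s : M.sec V}
    (h : ∀ x ∈ V, ∃ (W : Opens M.carrier) (h : W ≤ V), x ∈ W ∧ M.res h s ∈ M.even W) :
    s ∈ M.even V := by
  obtain ⟨e, he, o, ho, rfl⟩ := exists_even_add_odd s
  have : o = 0 := by
    refine ext_of_locally fun x hx => ?_
    obtain ⟨W, hW, hxW, h1⟩ := h x hx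
    refine ⟨W, hW, hxW, ?_⟩
    rw [map_add] at h1
    rw [map_zero]
    exact (parts_eq h1 (res_even hW he) (Submodule.zero_mem _) (res_odd hW ho) (by simp)).2.symm
  rw [this, add_zero]
  exact he

theorem odd_of_locally {V : Opens M.carrier} {s : M.sec V}
    (h : ∀ x ∈ V, ∃ (W : Opens M.carrier) (h : W ≤ V), x ∈ W ∧ M.res h s ∈ M.odd W) :
    s ∈ M.odd V := by
  obtain ⟨e, he, o, ho, rfl⟩ := exists_even_add_odd s
  have : e = 0 := by
    refine ext_of_locally fun x hx => ?_
    obtain ⟨W, hW, hxW, h1⟩ := h x hx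
    refine ⟨W, hW, hxW, ?_⟩
    rw [map_add] at h1
    rw [map_zero]
    exact (parts_eq (res_even hW he) (Submodule.zero_mem _) (res_odd hW ho) h1 (by simp)).1
  rw [this, zero_add]
  exact ho

theorem odd_mul_self {U : Opens M.carrier} {s : M.sec U} (hs : s ∈ M.odd U) : s * s = 0 := by
  have h : (2 : ℂ) • (s * s) = 0 := by
    rw [two_smul]
    nth_rw 1 [M.odd_anticomm U s hs s hs]
    exact neg_add_cancel _
  rw [← one_smul ℂ (s * s), ← inv_mul_cancel₀ (two_ne_zero (α := ℂ)), mul_smul, h, smul_zero]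

theorem odd_mul_even {U : Opens M.carrier} {a b : M.sec U} (ha : a ∈ M.odd U)
    (hb : b ∈ M.even U) : a * b ∈ M.odd U :=
  M.even_comm U b hb a ▸ M.even_mul_odd U b hb a ha

/-! ### The nilpotent ideals -/

theorem odd_le_nil {U : Opens M.carrier} {s : M.sec U} (hs : s ∈ M.odd U) : s ∈ M.nil U :=
  fun _ hx => ⟨U, le_rfl, hx, by rw [res_self]; exact Ideal.subset_span hs⟩

theorem odd_mul_odd_mem_nilSq {U : Opens M.carrier} {s t : M.sec U} (hs : s ∈ M.odd U)
    (ht : t ∈ M.odd U) : s * t ∈ M.nilSq U :=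
  fun _ hx => ⟨U, le_rfl, hx, by rw [res_self]; exact Ideal.subset_span ⟨s, hs, t, ht, rfl⟩⟩

theorem nilSq_le_nil {U : Opens M.carrier} {s : M.sec U} (hs : s ∈ M.nilSq U) : s ∈ M.nil U := by
  intro x hx
  obtain ⟨V, hV, hxV, h⟩ := hs x hx
  have : M.oddIdealSq V ≤ M.oddIdeal V := by
    refine Ideal.span_le.2 ?_
    rintro _ ⟨a, _, b, hb, rfl⟩
    exact Ideal.mul_mem_left _ _ (Ideal.subset_span hb)
  exact ⟨V, hV, hxV, this h⟩

/-- The even part of a combination of odd sections is a combination of products of two odd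
sections. -/
theorem mem_oddIdealSq_of_even {U : Opens M.carrier} {s : M.sec U} (hs : s ∈ M.oddIdeal U)
    (he : s ∈ M.even U) : s ∈ M.oddIdealSq U := by
  have key : ∃ e ∈ M.even U, e ∈ M.oddIdealSq U ∧ ∃ o ∈ M.odd U, e + o = s := by
    clear he
    induction hs using Submodule.span_induction with
    | mem s h => exact ⟨0, Submodule.zero_mem _, Ideal.zero_mem _, s, h, zero_add s⟩
    | zero => exact ⟨0, Submodule.zero_mem _, Ideal.zero_mem _, 0, Submodule.zero_mem _, zero_add 0⟩
    | add s t _ _ h1 h2 =>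
      obtain ⟨e, he, he', o, ho, rfl⟩ := h1
      obtain ⟨f, hf, hf', p, hp, rfl⟩ := h2
      exact ⟨e + f, Submodule.add_mem _ he hf, Ideal.add_mem _ he' hf', o + p,
        Submodule.add_mem _ ho hp, by abel⟩
    | smul a s _ h =>
      obtain ⟨e, he, he', o, ho, rfl⟩ := h
      obtain ⟨b, hb, c, hc, rfl⟩ := exists_even_add_odd a
      refine ⟨b * e + c * o, Submodule.add_mem _ (M.even_mul_even U _ hb _ he)
        (M.odd_mul_odd U _ hc _ ho), Ideal.add_mem _ (Ideal.mul_mem_left _ _ he')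
        (Ideal.subset_span ⟨c, hc, o, ho, rfl⟩), b * o + c * e,
        Submodule.add_mem _ (M.even_mul_odd U _ hb _ ho) (odd_mul_even hc he), ?_⟩
      rw [smul_eq_mul, add_mul, mul_add, mul_add]
      abel
  obtain ⟨e, he', h, o, ho, h2⟩ := key
  have := (parts_eq he' he ho (Submodule.zero_mem _) (by rw [h2, add_zero])).1
  exact this ▸ h

theorem mem_nilSq_of_even {U : Opens M.carrier} {s : M.sec U} (hs : s ∈ M.nil U)
    (he : s ∈ M.even U) : s ∈ M.nilSq U := by
  intro x hx
  obtain ⟨V, hV, hxV, h⟩ := hs x hx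
  exact ⟨V, hV, hxV, mem_oddIdealSq_of_even h (res_even hV he)⟩

/-- The two algebraic consequences of being locally isomorphic to `ℂ^{2|2}` on which the
classification rests: `J³ = 0`, and `J²` is locally generated by a product of two odd sections
whose annihilator lies in `J`. -/
structure IsLocallyGrassmann (M : Superspace) : Prop where
  odd_mul_odd_mul_odd : ∀ U : Opens M.carrier, ∀ a ∈ M.odd U, ∀ b ∈ M.odd U, ∀ c ∈ M.odd U,
    a * b * c = 0
  exists_pair : ∀ x : M.carrier, ∃ U : Opens M.carrier, x ∈ U ∧ ∃ e₁ ∈ M.odd U, ∃ e₂ ∈ M.odd U,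
    ∀ (V : Opens M.carrier) (h : V ≤ U) (a : M.sec V),
      a * (M.res h e₁ * M.res h e₂) = 0 → a ∈ M.nil V

namespace IsLocallyGrassmann

theorem oddIdealSq_mul_odd (hM : M.IsLocallyGrassmann) {U : Opens M.carrier} {s t : M.sec U}
    (hs : s ∈ M.oddIdealSq U) (ht : t ∈ M.odd U) : s * t = 0 := by
  induction hs using Submodule.span_induction with
  | mem s h =>
    obtain ⟨a, ha, b, hb, rfl⟩ := h
    exact hM.odd_mul_odd_mul_odd U a ha b hb t ht
  | zero => exact zero_mul t
  | add s u _ _ h1 h2 => rw [add_mul, h1, h2, add_zero]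
  | smul a s _ h => rw [smul_eq_mul, mul_assoc, h, mul_zero]

theorem oddIdealSq_le_even (hM : M.IsLocallyGrassmann) {U : Opens M.carrier} {s : M.sec U}
    (hs : s ∈ M.oddIdealSq U) : s ∈ M.even U := by
  refine Submodule.span_induction (p := fun s _ => s ∈ M.even U) ?_ (Submodule.zero_mem _)
    (fun _ _ _ _ => Submodule.add_mem _) (fun a s h1 h => ?_) hs
  · rintro _ ⟨a, ha, b, hb, rfl⟩
    exact M.odd_mul_odd U a ha b hb
  · obtain ⟨b, hb, c, hc, rfl⟩ := exists_even_add_odd a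
    rw [smul_eq_mul, add_mul, ← M.even_comm U s h c, hM.oddIdealSq_mul_odd h1 hc, add_zero]
    exact M.even_mul_even U b hb s h

theorem nilSq_le_even (hM : M.IsLocallyGrassmann) {U : Opens M.carrier} {s : M.sec U}
    (hs : s ∈ M.nilSq U) : s ∈ M.even U := by
  refine even_of_locally fun x hx => ?_
  obtain ⟨V, hV, hxV, h⟩ := hs x hx
  exact ⟨V, hV, hxV, hM.oddIdealSq_le_even h⟩

theorem nilSq_mul_nil (hM : M.IsLocallyGrassmann) {U : Opens M.carrier} {s t : M.sec U}
    (hs : s ∈ M.nilSq U) (ht : t ∈ M.nil U) : s * t = 0 := by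
  refine ext_of_locally fun x hx => ?_
  obtain ⟨V, hV, hxV, h⟩ := hs x hx
  obtain ⟨W, hW, hxW, h'⟩ := ht x hx
  refine ⟨V ⊓ W, inf_le_left.trans hV, ⟨hxV, hxW⟩, ?_⟩
  rw [map_zero, map_mul]
  have h1 : M.res (inf_le_left.trans hV) s ∈ M.oddIdealSq (V ⊓ W) := by
    rw [← M.res_res inf_le_left hV]
    exact M.res_mem_oddIdealSq _ _ h
  have h2 : M.res (inf_le_left.trans hV) t ∈ M.oddIdeal (V ⊓ W) := by
    have := M.res_mem_oddIdeal (inf_le_right : V ⊓ W ≤ W) _ h'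
    rwa [M.res_res] at this
  generalize M.res (inf_le_left.trans hV) s = s at h1
  generalize M.res (inf_le_left.trans hV) t = t at h2
  induction h2 using Submodule.span_induction with
  | mem t h => exact hM.oddIdealSq_mul_odd h1 h
  | zero => exact mul_zero s
  | add t u _ _ h1 h2 => rw [mul_add, h1, h2, add_zero]
  | smul a t _ h =>
    rw [smul_eq_mul, ← mul_assoc, M.even_comm _ s (hM.oddIdealSq_le_even h1), mul_assoc, h,
      mul_zero]

theorem nil_mul_nilSq (hM : M.IsLocallyGrassmann) {U : Opens M.carrier} {s t : M.sec U}
    (hs : s ∈ M.nil U) (ht : t ∈ M.nilSq U) : s * t = 0 := by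
  rw [← M.even_comm U t (hM.nilSq_le_even ht), hM.nilSq_mul_nil ht hs]

end IsLocallyGrassmann

end Superspace

/-! ### The local model -/

theorem extendZero_of_mem {X E : Type} [Zero E] [TopologicalSpace X] {U : Opens X} (f : U → E)
    {z : X} (hz : z ∈ U) : extendZero f z = f ⟨z, hz⟩ := dif_pos hz

theorem extendZero_of_notMem {X E : Type} [Zero E] [TopologicalSpace X] {U : Opens X} (f : U → E)
    {z : X} (hz : z ∉ U) : extendZero f z = 0 := dif_neg hz

namespace Superspace

variable {M : Superspace}

/-- Sections over equal open sets are identified by restriction. -/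
def resEquiv (M : Superspace) {U V : Opens M.carrier} (h : U = V) : M.sec V ≃ₐ[ℂ] M.sec U :=
  AlgEquiv.ofAlgHom (M.res h.le) (M.res h.ge)
    (by ext s; exact (M.res_res _ _ s).trans (M.res_self _ s))
    (by ext s; exact (M.res_res _ _ s).trans (M.res_self _ s))

/-- A superspace isomorphic to an open part of `ℂ^{2|2}` near `x`, with all the isomorphisms of
algebras of sections over open subsets of `M` itself. -/
theorem IsSupermanifold22.exists_local_model (hM : M.IsSupermanifold22) (x : M.carrier) :
    ∃ U : Opens M.carrier, x ∈ U ∧ ∃ (A : Opens M.carrier → Opens C22.carrier)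
      (hA : ∀ V ≤ U, A V ≤ A U) (p : ∀ V ≤ U, C22.sec (A V) ≃ₐ[ℂ] M.sec V),
      (∀ V h, ∀ s ∈ C22.even (A V), p V h s ∈ M.even V) ∧
      (∀ V h, ∀ s ∈ C22.odd (A V), p V h s ∈ M.odd V) ∧
      ∀ V (h : V ≤ U) s, p V h (C22.res (hA V h) s) = M.res h (p U le_rfl s) := by
  obtain ⟨U, hx, W, ⟨f⟩⟩ := hM x
  let B : Opens M.carrier → Opens (C22.restrict W).carrier := fun V =>
    Opens.comap ⟨f.homeo.symm, f.homeo.symm.continuous⟩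
      (Opens.comap (⟨Subtype.val, continuous_subtype_val⟩ : C(U, M.carrier)) V)
  let B' : Opens M.carrier → Opens (M.restrict U).carrier := fun V => (B V).comap f.homeo
  have hB : ∀ V ≤ U, V = U.isOpenEmbedding.isOpenMap.functor.obj (B' V) := by
    intro V hV
    ext y
    constructor
    · intro hy
      refine ⟨⟨y, hV hy⟩, ?_, rfl⟩
      exact (congrArg (fun w : U => w.1 ∈ V) (f.homeo.symm_apply_apply ⟨y, hV hy⟩)).mpr hy
    · rintro ⟨z, hz, rfl⟩
      exact (congrArg (fun w : U => w.1 ∈ V) (f.homeo.symm_apply_apply z)).mp hz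
  have hBm : ∀ V ≤ U, B V ≤ B U := fun V hV y hy => hV hy
  refine ⟨U, hx, fun V => W.isOpenEmbedding.isOpenMap.functor.obj (B V),
    fun V hV => (W.isOpenEmbedding.isOpenMap.functor.map (homOfLE (hBm V hV))).le,
    fun V hV => (f.pull (B V)).trans (M.resEquiv (hB V hV)), ?_, ?_, ?_⟩
  · intro V hV s hs
    exact res_even _ (f.pull_even (B V) s hs)
  · intro V hV s hs
    exact res_odd _ (f.pull_odd (B V) s hs)
  · intro V hV s
    have h1 : U.isOpenEmbedding.isOpenMap.functor.obj (B' V) ≤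
        U.isOpenEmbedding.isOpenMap.functor.obj (B' U) := by
      rw [← hB V hV, ← hB U le_rfl]
      exact hV
    let t : M.sec (U.isOpenEmbedding.isOpenMap.functor.obj (B' U)) := f.pull (B U) s
    refine (congrArg (M.res (hB V hV).le) (f.pull_res (hBm V hV) s)).trans ?_
    change M.res (hB V hV).le (M.res h1 t) = M.res hV (M.res (hB U le_rfl).le t)
    exact (M.res_res _ _ _).trans (M.res_res _ _ _).symm

/-- A superfunction on `ℂ^{2|2}` without constant term lies in the ideal of the odd coordinates. -/
theorem C22_exists_decomposition {A : Opens C22.carrier} (a : C22.sec A)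
    (ha : ∀ z, (a.1 z).c0 = 0) : ∃ b c d : C22.sec A, ∀ t₁ t₂ : C22.sec A,
      (∀ z, t₁.1 z = Grass.theta 0) → (∀ z, t₂.1 z = Grass.theta 1) →
        a = b * t₁ + c * t₂ + d * (t₁ * t₂) := by
  have key : ∀ (p : Grass → ℂ) (_ : p 0 = 0)
      (_ : ∀ z ∈ A, AnalyticAt ℂ (fun w => p (extendZero a.1 w)) z),
      (fun z : A => Grass.const (p (a.1 z))) ∈ superfunctionsC22.sub A := by
    intro p hp h z hz
    refine SuperAnalyticAt.congr (F := fun w => Grass.const (p (extendZero a.1 w)))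
      ⟨h z hz, analyticAt_const, analyticAt_const, analyticAt_const⟩ ?_
    refine Filter.Eventually.of_forall fun w => ?_
    by_cases hw : w ∈ A
    · exact (congrArg (fun y => Grass.const (p y)) (extendZero_of_mem a.1 hw)).trans
        (extendZero_of_mem (fun z : A => Grass.const (p (a.1 z))) hw).symm
    · refine (congrArg (fun y => Grass.const (p y)) (extendZero_of_notMem a.1 hw)).trans
        (Eq.trans ?_ (extendZero_of_notMem (fun z : A => Grass.const (p (a.1 z))) hw).symm)
      rw [hp]
      rfl
  refine ⟨⟨_, key Grass.c1 rfl fun z hz => (a.2 z hz).2.1⟩,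
    ⟨_, key Grass.c2 rfl fun z hz => (a.2 z hz).2.2.1⟩,
    ⟨_, key Grass.c12 rfl fun z hz => (a.2 z hz).2.2.2⟩, fun t₁ t₂ h1 h2 => ?_⟩
  refine Subtype.ext (funext fun z => ?_)
  change a.1 z = Grass.const _ * t₁.1 z + Grass.const _ * t₂.1 z +
    Grass.const _ * (t₁.1 z * t₂.1 z)
  rw [h1, h2]
  ext <;> simp [Grass.const, Grass.theta, ha]

/-- The odd coordinate `θ_k` as a section over an open subset of `ℂ^{2|2}`. -/
noncomputable def thetaC22 (A : Opens C22.carrier) (k : Fin 2) : C22.sec A :=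
  ⟨fun _ => Grass.theta k, fun z hz => (SuperAnalyticAt.const (Grass.theta k)).congr (by
    filter_upwards [A.isOpen.mem_nhds hz] with w hw
    exact (extendZero_of_mem (fun _ : A => Grass.theta k) hw).symm)⟩

theorem thetaC22_odd (A : Opens C22.carrier) (k : Fin 2) : thetaC22 A k ∈ C22.odd A :=
  fun _ => P2.theta_isOdd k

theorem IsSupermanifold22.isLocallyGrassmann (hM : M.IsSupermanifold22) :
    M.IsLocallyGrassmann := by
  refine ⟨fun U a ha b hb c hc => ext_of_locally fun x hx => ?_, fun x => ?_⟩
  · obtain ⟨U', hx', A, hA, p, he, ho, -⟩ := hM.exists_local_model x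
    have hV : U ⊓ U' ≤ U' := inf_le_right
    have key : ∀ s ∈ M.odd (U ⊓ U'), ∃ t ∈ C22.odd (A (U ⊓ U')), p _ hV t = s := by
      intro s hs
      obtain ⟨e, he', o, ho', h⟩ := exists_even_add_odd ((p _ hV).symm s)
      refine ⟨o, ho', ?_⟩
      have h1 : p _ hV e + p _ hV o = 0 + s := by
        rw [← map_add, h, AlgEquiv.apply_symm_apply, zero_add]
      exact (parts_eq (he _ _ _ he') (Submodule.zero_mem _) (ho _ _ _ ho') hs h1).2
    refine ⟨U ⊓ U', inf_le_left, ⟨hx, hx'⟩, ?_⟩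
    rw [map_zero, map_mul, map_mul]
    obtain ⟨a', ha', h1⟩ := key _ (res_odd inf_le_left ha)
    obtain ⟨b', hb', h2⟩ := key _ (res_odd inf_le_left hb)
    obtain ⟨c', hc', h3⟩ := key _ (res_odd inf_le_left hc)
    rw [← h1, ← h2, ← h3, ← map_mul, ← map_mul]
    have : a' * b' * c' = 0 := by
      refine Subtype.ext (funext fun z => ?_)
      obtain ⟨h1, h2⟩ : (a'.1 z).IsOdd := ha' z
      obtain ⟨h3, h4⟩ : (b'.1 z).IsOdd := hb' z
      obtain ⟨h5, h6⟩ : (c'.1 z).IsOdd := hc' z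
      change a'.1 z * b'.1 z * c'.1 z = 0
      ext <;> simp [h1, h3, h5]
    rw [this, map_zero]
  · obtain ⟨U, hx, A, hA, p, he, ho, hp⟩ := hM.exists_local_model x
    refine ⟨U, hx, p U le_rfl (thetaC22 _ 0), ho _ _ _ (thetaC22_odd _ 0),
      p U le_rfl (thetaC22 _ 1), ho _ _ _ (thetaC22_odd _ 1), fun V hV a h => ?_⟩
    rw [← hp V hV, ← hp V hV, ← (p V hV).apply_symm_apply a, ← map_mul, ← map_mul] at h
    have h1 := (map_eq_zero_iff (p V hV) (p V hV).injective).1 h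
    obtain ⟨b, c, d, h2⟩ := C22_exists_decomposition ((p V hV).symm a) fun z => by
      have h3 : (((p V hV).symm a).1 z * (Grass.theta 0 * Grass.theta 1)).c12 = 0 :=
        congrArg Grass.c12 (congrFun (congrArg Subtype.val h1) z)
      simpa [Grass.theta] using h3
    have h3 := congrArg (p V hV)
      (h2 (thetaC22 _ 0) (thetaC22 _ 1) (fun _ => rfl) fun _ => rfl)
    rw [AlgEquiv.apply_symm_apply, map_add, map_add, map_mul, map_mul, map_mul, map_mul] at h3
    have o := fun k => odd_le_nil (ho V hV _ (thetaC22_odd (A V) k))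
    rw [h3]
    exact Ideal.add_mem _ (Ideal.add_mem _ (Ideal.mul_mem_left _ _ (o 0))
      (Ideal.mul_mem_left _ _ (o 1))) (Ideal.mul_mem_left _ _ (Ideal.mul_mem_left _ _ (o 1)))

end Superspace

/-! ### Affine charts of the projective plane -/

namespace P2

theorem homog_succAbove (i : Fin 3) (z : Fin 2 → ℂ) (k : Fin 2) :
    homog i z (i.succAbove k) = z k := by simp [homog]

theorem coord_param (i : Fin 3) (z : Fin 2 → ℂ) : coord i (param i z) = z := by
  obtain ⟨a, ha, h⟩ := rep_mk (homog i z) (homog_ne_zero i z)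
  funext k
  simp only [coord, param, h, Pi.smul_apply, smul_eq_mul, homog_self, homog_succAbove]
  field_simp

theorem param_mem_affine_iff {i j : Fin 3} {z : Fin 2 → ℂ} :
    param i z ∈ affine j ↔ homog i z j ≠ 0 := by
  obtain ⟨a, ha, h⟩ := rep_mk (homog i z) (homog_ne_zero i z)
  rw [mem_affine, param, h]
  simp [ha]

theorem exists_mem_affine (x : P2) : ∃ i, x ∈ affine i := by
  by_contra! h
  exact rep_ne_zero x (funext fun i => not_not.1 (h i))

theorem homog_change {i j : Fin 3} {w : Fin 2 → ℂ} (h : homog j w i ≠ 0) (m : Fin 3) :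
    homog i (change i j w) m = homog j w m / homog j w i := by
  refine Fin.succAboveCases i ?_ (fun k => ?_) m
  · rw [homog_self, div_self h]
  · rw [homog_succAbove, change]

theorem change_change {i j k : Fin 3} {w : Fin 2 → ℂ} (h : homog k w j ≠ 0) :
    change i j (change j k w) = change i k w := by
  funext l
  rw [change, homog_change h, homog_change h, change, div_div_div_cancel_right₀ h]

theorem change_self (i : Fin 3) (w : Fin 2 → ℂ) : change i i w = w := by
  funext l
  rw [change, homog_self, homog_succAbove, div_one]

theorem param_change {i j : Fin 3} {w : Fin 2 → ℂ} (h : homog j w i ≠ 0) :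
    param i (change i j w) = param j w := by
  have h1 := param_mem_affine_iff.2 h
  rw [← coord_param j w, change_coord (param_mem j w), coord_param, param_coord h1]

theorem hasFDerivAt_homog (j m : Fin 3) (w : Fin 2 → ℂ) :
    HasFDerivAt (fun w => homog j w m)
      ((oddRow j m).c1 • (ContinuousLinearMap.proj 0 : (Fin 2 → ℂ) →L[ℂ] ℂ) +
      (oddRow j m).c2 • (ContinuousLinearMap.proj 1 : (Fin 2 → ℂ) →L[ℂ] ℂ)) w := by
  refine Fin.succAboveCases j ?_ (fun k => ?_) m
  · simp only [homog_self, oddRow, Fin.insertNth_apply_same]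
    refine HasFDerivAt.congr_fderiv (hasFDerivAt_const (1 : ℂ) w)
      (ContinuousLinearMap.ext fun v => ?_)
    simp
  · simp only [homog_succAbove, oddRow, Fin.insertNth_apply_succAbove]
    have h := (ContinuousLinearMap.proj (R := ℂ) (φ := fun _ : Fin 2 => ℂ) k).hasFDerivAt (x := w)
    refine HasFDerivAt.congr_fderiv h (ContinuousLinearMap.ext fun v => ?_)
    fin_cases k <;> simp [Grass.theta]

theorem analyticAt_homog (j m : Fin 3) (w : Fin 2 → ℂ) : AnalyticAt ℂ (fun w => homog j w m) w := by
  refine Fin.succAboveCases j ?_ (fun k => ?_) m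
  · simp only [homog_self]
    exact analyticAt_const
  · simp only [homog_succAbove]
    exact (ContinuousLinearMap.proj (R := ℂ) (φ := fun _ : Fin 2 => ℂ) k).analyticAt w

theorem analyticAt_change_apply {i j : Fin 3} {w : Fin 2 → ℂ} (h : homog j w i ≠ 0) (k : Fin 2) :
    AnalyticAt ℂ (fun w => change i j w k) w :=
  (analyticAt_homog j _ w).div (analyticAt_homog j _ w) h

theorem analyticAt_change {i j : Fin 3} {w : Fin 2 → ℂ} (h : homog j w i ≠ 0) :
    AnalyticAt ℂ (change i j) w :=
  AnalyticAt.pi fun k => analyticAt_change_apply h k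

theorem eventually_homog_ne_zero {i j : Fin 3} {w : Fin 2 → ℂ} (h : homog j w i ≠ 0) :
    ∀ᶠ w in nhds w, homog j w i ≠ 0 :=
  (analyticAt_homog j i w).continuousAt.eventually_ne h

/-- The odd transition functions of the `Π`-projective plane are the differentials of the
even ones: this is why its fermionic sheaf is `Π Ω¹`. -/
theorem fderiv_change {i j : Fin 3} {w : Fin 2 → ℂ} (h : homog j w i ≠ 0) (k : Fin 2)
    (v : Fin 2 → ℂ) : fderiv ℂ (fun w => change i j w k) w v =
      v 0 * (transOdd i j w k).c1 + v 1 * (transOdd i j w k).c2 := by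
  have h1 := (hasFDerivAt_homog j (i.succAbove k) w).mul
    ((hasFDerivAt_inv' h).comp w (hasFDerivAt_homog j i w))
  have h2 : (fun w => change i j w k) = (fun w => homog j w (i.succAbove k)) *
      (Inv.inv ∘ fun w => homog j w i) := by
    funext w
    exact div_eq_mul_inv _ _
  rw [h2, h1.fderiv, transOdd_apply i j w h k]
  simp [Grass.const, sub_eq_add_neg]
  field_simp
  ring

theorem fderiv_change_single {i j : Fin 3} {w : Fin 2 → ℂ} (h : homog j w i ≠ 0) (k l : Fin 2) :
    fderiv ℂ (fun w => change i j w k) w (Pi.single l 1) =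
      ![(transOdd i j w k).c1, (transOdd i j w k).c2] l := by
  rw [fderiv_change h]
  fin_cases l <;> simp

theorem change_comp_eventuallyEq {i j k : Fin 3} {w : Fin 2 → ℂ} (h : homog k w j ≠ 0) :
    change i j ∘ change j k =ᶠ[nhds w] change i k :=
  (eventually_homog_ne_zero h).mono fun _ h => change_change h

theorem clm_apply_eq_sum (L : (Fin 2 → ℂ) →L[ℂ] ℂ) (v : Fin 2 → ℂ) :
    L v = ∑ k, L (Pi.single k 1) * v k := by
  conv_lhs => rw [← Finset.univ_sum_single v]
  rw [map_sum]
  refine Finset.sum_congr rfl fun k _ => ?_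
  rw [mul_comm, ← smul_eq_mul, ← map_smul, ← Pi.single_smul', smul_eq_mul, mul_one]

/-- The chain rule for the transition to the chart `j`. -/
theorem fderiv_comp_change {i j : Fin 3} {w : Fin 2 → ℂ} (h : homog j w i ≠ 0)
    {f : (Fin 2 → ℂ) → ℂ} (hf : AnalyticAt ℂ f (change i j w)) (v : Fin 2 → ℂ) :
    fderiv ℂ (f ∘ change i j) w v = ∑ k, fderiv ℂ f (change i j w) (Pi.single k 1) *
      fderiv ℂ (fun w => change i j w k) w v := by
  rw [fderiv_comp w hf.differentiableAt (analyticAt_change h).differentiableAt,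
    ContinuousLinearMap.comp_apply, clm_apply_eq_sum]
  refine Finset.sum_congr rfl fun k _ => ?_
  have : fderiv ℂ (change i j) w v k = fderiv ℂ (fun w => change i j w k) w v :=
    ((hasFDerivAt_pi'.1 (analyticAt_change h).differentiableAt.hasFDerivAt k).fderiv ▸ rfl)
  rw [this]

/-- The cocycle property of the Jacobian matrices. -/
theorem fderiv_change_comp {i j k : Fin 3} {w : Fin 2 → ℂ} (h : homog k w j ≠ 0)
    (h' : homog k w i ≠ 0) (l m : Fin 2) :
    fderiv ℂ (fun w => change i k w l) w (Pi.single m 1) =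
      ∑ p, fderiv ℂ (fun w => change i j w l) (change j k w) (Pi.single p 1) *
        fderiv ℂ (fun w => change j k w p) w (Pi.single m 1) := by
  have h1 : homog j (change j k w) i ≠ 0 := by
    rw [homog_change h]
    exact div_ne_zero h' h
  rw [← fderiv_comp_change h (analyticAt_change_apply h1 l)]
  have h2 : (fun w => change i k w l) =ᶠ[nhds w] (fun w => change i j w l) ∘ change j k :=
    (change_comp_eventuallyEq h).symm.mono fun _ e => congrFun e l
  rw [h2.fderiv_eq]

theorem analyticAt_fderiv_apply {f : (Fin 2 → ℂ) → ℂ} {z : Fin 2 → ℂ} (hf : AnalyticAt ℂ f z)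
    (v : Fin 2 → ℂ) : AnalyticAt ℂ (fun z => fderiv ℂ f z v) z :=
  AnalyticAt.comp (g := fun L : (Fin 2 → ℂ) →L[ℂ] ℂ => L v)
    ((ContinuousLinearMap.apply ℂ ℂ v).analyticAt _) hf.fderiv

theorem fderiv_change_refl (i : Fin 3) (w : Fin 2 → ℂ) (k l : Fin 2) :
    fderiv ℂ (fun w => change i i w k) w (Pi.single l 1) = (Pi.single k 1 : Fin 2 → ℂ) l := by
  simp only [change_self]
  rw [(hasFDerivAt_apply (𝕜 := ℂ) k w).fderiv]
  simp [Pi.single_apply, eq_comm]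

/-! ### Holomorphic functions and forms in a chart -/

theorem fnInChart_eventuallyEq {W : Opens P2} (f : W → ℂ) {x : P2} (hx : x ∈ W) {i : Fin 3}
    (hi : x ∈ affine i) {F : (Fin 2 → ℂ) → ℂ}
    (h : ∀ y : W, y.1 ∈ affine i → f y = F (coord i y.1)) :
    fnInChart f i =ᶠ[nhds (coord i x)] F := by
  filter_upwards [eventually_mem hx hi] with z hz
  rw [fnInChart, inChart_of_mem _ hz, h _ (param_mem i z), coord_param]

theorem fnInChart_coord {W : Opens P2} (f : W → ℂ) (x : W) {i : Fin 3} (hi : x.1 ∈ affine i) :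
    fnInChart f i (coord i x.1) = f x := by
  have : param i (coord i x.1) ∈ W := (param_coord hi).symm ▸ x.2
  rw [fnInChart, inChart_of_mem _ this]
  congr 1
  exact Subtype.ext (param_coord hi)

theorem fnInChart_change {W : Opens P2} (f : W → ℂ) {i j : Fin 3} {w : Fin 2 → ℂ}
    (h : homog j w i ≠ 0) : fnInChart f i (change i j w) = fnInChart f j w := by
  have e := param_change h
  by_cases hw : param j w ∈ W
  · rw [fnInChart, fnInChart, inChart_of_mem _ hw, inChart_of_mem _ (e.symm ▸ hw)]
    congr 1
    exact Subtype.ext e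
  · rw [fnInChart, fnInChart, inChart_of_notMem _ hw, inChart_of_notMem _ (e.symm ▸ hw)]

theorem fnInChart_comp_change {W : Opens P2} (f : W → ℂ) {i j : Fin 3} {w : Fin 2 → ℂ}
    (h : homog j w i ≠ 0) : fnInChart f i ∘ change i j =ᶠ[nhds w] fnInChart f j :=
  (eventually_homog_ne_zero h).mono fun _ h => fnInChart_change f h

/-- Holomorphy can be checked in one chart around every point. -/
theorem mem_hol_of_chart {W : Opens P2} (f : W → ℂ)
    (h : ∀ x : W, ∃ i, x.1 ∈ affine i ∧ AnalyticAt ℂ (fnInChart f i) (coord i x.1)) :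
    f ∈ hol W := by
  intro x hx j hj
  obtain ⟨i, hi, ha⟩ := h ⟨x, hx⟩
  have h1 := homog_coord_ne_zero hi hj
  refine AnalyticAt.congr ?_ (fnInChart_comp_change f h1)
  refine AnalyticAt.comp ?_ (analyticAt_change h1)
  rw [change_coord hj]
  exact ha

theorem mem_hol_of_eq {W : Opens P2} {i : Fin 3} (hW : W ≤ affine i) (f : W → ℂ)
    (F : (Fin 2 → ℂ) → ℂ) (hF : ∀ x ∈ W, AnalyticAt ℂ F (coord i x))
    (h : ∀ x : W, f x = F (coord i x.1)) : f ∈ hol W :=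
  mem_hol_of_chart f fun x => ⟨i, hW x.2, (hF x.1 x.2).congr
    (fnInChart_eventuallyEq f x.2 (hW x.2) fun y _ => h y).symm⟩

theorem mem_hol_of_local {W : Opens P2} (f : W → ℂ)
    (h : ∀ x ∈ W, ∃ (V : Opens P2) (hV : V ≤ W), x ∈ V ∧ (fun y : V => f ⟨y.1, hV y.2⟩) ∈ hol V) :
    f ∈ hol W := by
  intro x hx i hi
  obtain ⟨V, hV, hxV, h1⟩ := h x hx
  exact (h1 x hxV i hi).congr (inChart_res hV (fun y _ => f y) hxV hi)

/-- The affine coordinate `z_{li}` as a holomorphic function. -/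
noncomputable def coordHol (i : Fin 3) (l : Fin 2) : hol (affine i) :=
  ⟨fun x => coord i x.1 l, mem_hol_of_eq le_rfl _ (fun z => z l)
    (fun _ _ => (ContinuousLinearMap.proj (R := ℂ) (φ := fun _ : Fin 2 => ℂ) l).analyticAt _)
    fun _ => rfl⟩

theorem forms_coeff_mem_hol {W : Opens P2} {i : Fin 3} (hW : W ≤ affine i) (α : forms W)
    (l : Fin 2) : (fun x : W => α.1 x ⟨i, hW x.2⟩ l) ∈ hol W := by
  refine mem_hol_of_chart _ fun x => ⟨i, hW x.2, ?_⟩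
  have h := α.2.1 x ⟨i, hW x.2⟩
  have h1 : AnalyticAt ℂ (fun z => inChart α.1 i z l) (coord i x.1) :=
    (ContinuousLinearMap.proj (R := ℂ) (φ := fun _ : Fin 2 => ℂ) l).analyticAt _ |>.comp h
  refine h1.congr (Filter.Eventually.of_forall fun z => ?_)
  by_cases hz : param i z ∈ W
  · simp only [fnInChart, inChart_of_mem _ hz]
  · simp only [fnInChart, inChart_of_notMem _ hz, Pi.zero_apply]

/-- A form on an open subset of `U_i` is determined by its coefficients in the chart `i`. -/
theorem forms_ext {W : Opens P2} {i : Fin 3} (hW : W ≤ affine i) {α β : forms W}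
    (h : ∀ x : W, α.1 x ⟨i, hW x.2⟩ = β.1 x ⟨i, hW x.2⟩) : α = β := by
  refine Subtype.ext (funext fun x => funext fun j => funext fun l => ?_)
  rw [α.2.2 x ⟨i, hW x.2⟩ j l, β.2.2 x ⟨i, hW x.2⟩ j l, h]

/-- The form `dz_{ki}` on `U_i`. -/
noncomputable def dz (i : Fin 3) (k : Fin 2) : forms (affine i) :=
  ⟨fun x j l => fderiv ℂ (fun w => change i j.1 w k) (coord j.1 x.1) (Pi.single l 1), by
    refine ⟨fun x j => ?_, fun x j m l => ?_⟩
    · have h := homog_coord_ne_zero x.2 j.2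
      have h1 : AnalyticAt ℂ (fun z (l : Fin 2) =>
          fderiv ℂ (fun w => change i j.1 w k) z (Pi.single l 1)) (coord j.1 x.1) :=
        AnalyticAt.pi fun l => analyticAt_fderiv_apply (analyticAt_change_apply h k) _
      refine h1.congr ?_
      filter_upwards [eventually_mem x.2 j.2] with z hz
      rw [inChart_of_mem _ hz, coord_param]
    · have h := homog_coord_ne_zero j.2 m.2
      have h' := homog_coord_ne_zero x.2 m.2
      refine (fderiv_change_comp h h' k l).trans ?_
      rw [change_coord m.2]⟩

theorem dz_self (i : Fin 3) (k : Fin 2) (x : affine i) :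
    (dz i k).1 x ⟨i, x.2⟩ = Pi.single k 1 := by
  funext l
  exact fderiv_change_refl i _ k l

theorem analyticAt_fnInChart {W : Opens P2} (f : hol W) {x : P2} (hx : x ∈ W) {i : Fin 3}
    (hi : x ∈ affine i) : AnalyticAt ℂ (fnInChart f.1 i) (coord i x) := f.2 x hx i hi

end P2

namespace Superspace.Reduction

theorem stdCoeff_mem_hol {W : Opens P2} (f : P2.hol W) {i : Fin 3} (hW : W ≤ P2.affine i) :
    (fun x : W => stdCoeff f i x.1) ∈ P2.hol W := by
  refine P2.mem_hol_of_eq hW _ (fun z => ![1, -1, -1] i * P2.homog i z (i + 1) ^ 2 *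
    fderiv ℂ (P2.fnInChart f.1 i) z fun l => if i.succAbove l = i + 2 then 1 else 0)
    (fun x hx => ?_) fun x => ?_
  · refine (analyticAt_const.mul ((P2.analyticAt_homog i _ _).pow 2)).mul ?_
    exact P2.analyticAt_fderiv_apply (P2.analyticAt_fnInChart f hx (hW hx)) _
  · simp only [stdCoeff, P2.homog_coord (hW x.2)]

end Superspace.Reduction

/-! ### Grassmann-algebra-valued holomorphic functions -/

namespace P2

/-- Functions on `W` with values in the Grassmann algebra, all of whose coefficients are
holomorphic: the sections over `W` of the split supermanifold, in a fixed frame. -/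
def supHol (W : Opens P2) : Subalgebra ℂ (W → Grass) where
  carrier := {F | (fun x => (F x).c0) ∈ hol W ∧ (fun x => (F x).c1) ∈ hol W ∧
    (fun x => (F x).c2) ∈ hol W ∧ (fun x => (F x).c12) ∈ hol W}
  mul_mem' {F G} hF hG := by
    obtain ⟨a, b, c, d⟩ := hF
    obtain ⟨a', b', c', d'⟩ := hG
    exact ⟨mul_mem a a', add_mem (mul_mem a b') (mul_mem b a'),
      add_mem (mul_mem a c') (mul_mem c a'),
      sub_mem (add_mem (add_mem (mul_mem a d') (mul_mem d a')) (mul_mem b c')) (mul_mem c b')⟩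
  add_mem' {F G} hF hG := ⟨add_mem hF.1 hG.1, add_mem hF.2.1 hG.2.1, add_mem hF.2.2.1 hG.2.2.1,
    add_mem hF.2.2.2 hG.2.2.2⟩
  algebraMap_mem' t := by
    have h : (algebraMap ℂ (W → Grass) t) = fun _ => Grass.const t :=
      funext fun x => Grass.algebraMap_eq t
    rw [h]
    exact ⟨algebraMap_mem (hol W) t, zero_mem (hol W), zero_mem (hol W), zero_mem (hol W)⟩

namespace supHol

variable {W : Opens P2}

/-- The coefficient of `1`; those of `θ₁`, `θ₂` and `θ₁θ₂` are `c1`, `c2` and `c12`. -/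
def c0 (F : supHol W) : hol W := ⟨fun x => (F.1 x).c0, F.2.1⟩
def c1 (F : supHol W) : hol W := ⟨fun x => (F.1 x).c1, F.2.2.1⟩
def c2 (F : supHol W) : hol W := ⟨fun x => (F.1 x).c2, F.2.2.2.1⟩
def c12 (F : supHol W) : hol W := ⟨fun x => (F.1 x).c12, F.2.2.2.2⟩

/-- The superfunction with the given coefficients. -/
def mk (a b c d : hol W) : supHol W :=
  ⟨fun x => ⟨a.1 x, b.1 x, c.1 x, d.1 x⟩, a.2, b.2, c.2, d.2⟩

theorem ext {F G : supHol W} (h0 : c0 F = c0 G) (h1 : c1 F = c1 G) (h2 : c2 F = c2 G)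
    (h12 : c12 F = c12 G) : F = G :=
  Subtype.ext (funext fun x => Grass.ext (congrFun (congrArg Subtype.val h0) x)
    (congrFun (congrArg Subtype.val h1) x) (congrFun (congrArg Subtype.val h2) x)
    (congrFun (congrArg Subtype.val h12) x))

/-- The restriction of superfunctions. -/
def res {V : Opens P2} (h : V ≤ W) (F : supHol W) : supHol V :=
  mk (holRes h (c0 F)) (holRes h (c1 F)) (holRes h (c2 F)) (holRes h (c12 F))

/-- The substitution of two anticommuting elements for the odd coordinates. -/
noncomputable def lift {A : Type} [Ring A] [Algebra ℂ A] (L : hol W →ₐ[ℂ] A) (t₁ t₂ : A)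
    (hL : ∀ f a, L f * a = a * L f) (h11 : t₁ * t₁ = 0) (h22 : t₂ * t₂ = 0)
    (h21 : t₂ * t₁ = -(t₁ * t₂)) : supHol W →ₐ[ℂ] A :=
  AlgHom.ofLinearMap
    { toFun := fun F => L (c0 F) * 1 + L (c1 F) * t₁ + L (c2 F) * t₂ + L (c12 F) * (t₁ * t₂)
      map_add' := fun F G => by
        have h0 : c0 (F + G) = c0 F + c0 G := rfl
        have h1 : c1 (F + G) = c1 F + c1 G := rfl
        have h2 : c2 (F + G) = c2 F + c2 G := rfl
        have h12 : c12 (F + G) = c12 F + c12 G := rfl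
        rw [h0, h1, h2, h12, map_add, map_add, map_add, map_add]
        simp only [add_mul]
        abel
      map_smul' := fun t F => by
        have h0 : c0 (t • F) = t • c0 F := rfl
        have h1 : c1 (t • F) = t • c1 F := rfl
        have h2 : c2 (t • F) = t • c2 F := rfl
        have h12 : c12 (t • F) = t • c12 F := rfl
        rw [h0, h1, h2, h12, map_smul, map_smul, map_smul, map_smul]
        simp only [smul_mul_assoc, smul_add, RingHom.id_apply] }
    (by
      have h0 : c0 (1 : supHol W) = 1 := rfl
      have h1 : c1 (1 : supHol W) = 0 := rfl
      have h2 : c2 (1 : supHol W) = 0 := rfl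
      have h12 : c12 (1 : supHol W) = 0 := rfl
      simp [h0, h1, h2, h12])
    (fun F G => by
      have h0 : c0 (F * G) = c0 F * c0 G := rfl
      have h1 : c1 (F * G) = c0 F * c1 G + c1 F * c0 G := rfl
      have h2 : c2 (F * G) = c0 F * c2 G + c2 F * c0 G := rfl
      have h12 : c12 (F * G) = c0 F * c12 G + c12 F * c0 G + c1 F * c2 G - c2 F * c1 G := rfl
      have key : ∀ f u g v, L f * u * (L g * v) = L (f * g) * (u * v) := by
        intro f u g v
        rw [map_mul, mul_assoc, mul_assoc, ← mul_assoc u, ← hL g u, mul_assoc]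
      have e1 : t₁ * (t₁ * t₂) = 0 := by rw [← mul_assoc, h11, zero_mul]
      have e2 : t₂ * (t₁ * t₂) = 0 := by rw [← mul_assoc, h21, neg_mul, mul_assoc, h22, mul_zero,
        neg_zero]
      have e3 : (t₁ * t₂) * t₁ = 0 := by rw [mul_assoc, h21, mul_neg, e1, neg_zero]
      have e4 : (t₁ * t₂) * t₂ = 0 := by rw [mul_assoc, h22, mul_zero]
      have e5 : (t₁ * t₂) * (t₁ * t₂) = 0 := by rw [mul_assoc, e2, mul_zero]
      change L (c0 (F * G)) * 1 + L (c1 (F * G)) * t₁ + L (c2 (F * G)) * t₂ +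
        L (c12 (F * G)) * (t₁ * t₂) = (L (c0 F) * 1 + L (c1 F) * t₁ + L (c2 F) * t₂ +
        L (c12 F) * (t₁ * t₂)) * (L (c0 G) * 1 + L (c1 G) * t₁ + L (c2 G) * t₂ +
        L (c12 G) * (t₁ * t₂))
      rw [h0, h1, h2, h12]
      simp only [mul_add, add_mul, key]
      simp only [e1, e2, e3, e4, e5, h11, h22, h21, one_mul, mul_one, mul_zero, map_add, map_sub,
        add_mul, sub_mul, mul_neg]
      abel)

end supHol

end P2

namespace Superspace.Reduction

variable {M : Superspace} {r : M.Reduction}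

/-! ### Sections over the preimages of open subsets of the projective plane -/

theorem ext_of_locally {V : Opens P2} {s t : M.sec (r.pre V)}
    (h : ∀ x ∈ V, ∃ (W : Opens P2) (h : W ≤ V), x ∈ W ∧
      M.res (r.pre_mono h) s = M.res (r.pre_mono h) t) : s = t :=
  Superspace.ext_of_locally fun x hx => by
    obtain ⟨W, hW, hxW, e⟩ := h (r.homeo x) hx
    exact ⟨r.pre W, r.pre_mono hW, hxW, e⟩

theorem exists_glue {ι : Type} {V : Opens P2} {U : ι → Opens P2}
    (hU : ∀ i, U i ≤ V) (hc : ∀ x ∈ V, ∃ i, x ∈ U i) (s : ∀ i, M.sec (r.pre (U i)))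
    (hs : ∀ i j, M.res (r.pre_mono (inf_le_left : U i ⊓ U j ≤ U i)) (s i) =
      M.res (r.pre_mono (inf_le_right : U i ⊓ U j ≤ U j)) (s j)) :
    ∃ t : M.sec (r.pre V), ∀ i, M.res (r.pre_mono (hU i)) t = s i :=
  Superspace.exists_glue (fun i => r.pre_mono (hU i)) (fun x hx => hc (r.homeo x) hx) s hs

/-- The preimages of open subsets of `ℙ²` are a basis of the topology of `M`. -/
theorem exists_pre_le (r : M.Reduction) {x : P2} {U : Opens M.carrier} (hx : r.homeo.symm x ∈ U) :
    ∃ W : Opens P2, x ∈ W ∧ r.pre W ≤ U := by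
  refine ⟨U.comap ⟨r.homeo.symm, r.homeo.symm.continuous⟩, hx, fun y hy => ?_⟩
  have h : r.homeo.symm (r.homeo y) ∈ U := hy
  rwa [r.homeo.symm_apply_apply] at h

theorem proj_eq_zero {V : Opens P2} {s : M.sec (r.pre V)} (h : s ∈ M.nil (r.pre V)) :
    r.proj V s = 0 := (r.ker V s).2 h

/-! ### The odd coordinates -/

namespace CotangentFermions

variable (φ : r.CotangentFermions)

/-- The form represented by an odd section. -/
noncomputable def oddForm {V : Opens P2} {s : M.sec (r.pre V)}
    (hs : s ∈ M.odd (r.pre V)) : P2.forms V :=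
  φ.form V ⟨s, odd_le_nil hs⟩

theorem oddForm_res {V W : Opens P2} (h : W ≤ V) {s : M.sec (r.pre V)} (hs : s ∈ M.odd (r.pre V))
    (x : W) (i) : (φ.oddForm (res_odd (r.pre_mono h) hs)).1 x i = (φ.oddForm hs).1 ⟨x.1, h x.2⟩ i :=
  φ.form_res h ⟨s, odd_le_nil hs⟩ x i

theorem oddForm_add {V : Opens P2} {s t : M.sec (r.pre V)} (hs : s ∈ M.odd (r.pre V))
    (ht : t ∈ M.odd (r.pre V)) :
    φ.oddForm (Submodule.add_mem _ hs ht) = φ.oddForm hs + φ.oddForm ht :=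
  (φ.form V).map_add ⟨s, odd_le_nil hs⟩ ⟨t, odd_le_nil ht⟩

theorem oddForm_mul {V : Opens P2} {a s : M.sec (r.pre V)} (ha : a ∈ M.even (r.pre V))
    (hs : s ∈ M.odd (r.pre V)) (x : V) (i) :
    (φ.oddForm (M.even_mul_odd _ a ha s hs)).1 x i = (r.proj V a).1 x • (φ.oddForm hs).1 x i :=
  φ.form_smul V a ⟨s, odd_le_nil hs⟩ x i

variable {φ}

/-- An odd section is determined by its form: the difference of two odd sections with the same form
lies in `J²` and is therefore both even and odd. -/
theorem eq_of_oddForm_eq (hM : M.IsLocallyGrassmann) {V : Opens P2} {s t : M.sec (r.pre V)}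
    (hs : s ∈ M.odd (r.pre V)) (ht : t ∈ M.odd (r.pre V)) (h : φ.oddForm hs = φ.oddForm ht) : s = t := by
  have h1 : φ.form V (⟨s, odd_le_nil hs⟩ - ⟨t, odd_le_nil ht⟩) = 0 := by
    rw [map_sub, sub_eq_zero]
    exact h
  have h2 : s - t ∈ M.nilSq (r.pre V) := (φ.ker V _).1 h1
  exact sub_eq_zero.1 (eq_zero_of_even_of_odd (hM.nilSq_le_even h2) (Submodule.sub_mem _ hs ht))

theorem eq_of_oddForm_eq_chart (hM : M.IsLocallyGrassmann) {V : Opens P2} {i : Fin 3}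
    (hV : V ≤ P2.affine i)
    {s t : M.sec (r.pre V)} (hs : s ∈ M.odd (r.pre V)) (ht : t ∈ M.odd (r.pre V))
    (h : ∀ x : V, (φ.oddForm hs).1 x ⟨i, hV x.2⟩ = (φ.oddForm ht).1 x ⟨i, hV x.2⟩) : s = t :=
  eq_of_oddForm_eq hM hs ht (P2.forms_ext hV h)

/-- Every form is represented by an odd section. The odd parts of local representatives glue because
they are unique. -/
theorem exists_odd_lift (hM : M.IsLocallyGrassmann) (φ : r.CotangentFermions) {V : Opens P2}
    (α : P2.forms V) :
    ∃ (s : M.sec (r.pre V)) (hs : s ∈ M.odd (r.pre V)), φ.oddForm hs = α := by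
  have key : ∀ x : V, ∃ (W : Opens P2) (h : W ≤ V) (s : M.sec (r.pre W)) (hs : s ∈ M.odd (r.pre W)),
      x.1 ∈ W ∧ ∀ (y : W) (i), (φ.oddForm hs).1 y i = α.1 ⟨y.1, h y.2⟩ i := by
    intro x
    obtain ⟨W, hW, s, hx, h⟩ := φ.locally_surjective V α x.1 x.2
    obtain ⟨e, he, o, ho, h1⟩ := exists_even_add_odd s.1
    have h2 : e ∈ M.nil (r.pre W) := by
      rw [eq_sub_of_add_eq h1]
      exact Ideal.sub_mem _ s.2 (odd_le_nil ho)
    have h3 : φ.form W s = φ.form W ⟨e, h2⟩ + φ.oddForm ho := by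
      rw [oddForm, ← map_add]
      congr 1
      exact Subtype.ext h1.symm
    rw [(φ.ker W ⟨e, h2⟩).2 (mem_nilSq_of_even h2 he), zero_add] at h3
    exact ⟨W, hW, o, ho, hx, h3 ▸ h⟩
  choose W hW s hs hx h using key
  obtain ⟨t, ht⟩ := exists_glue (r := r) hW (fun x hx' => ⟨⟨x, hx'⟩, hx _⟩) s fun x y => by
    refine eq_of_oddForm_eq (φ := φ) hM (res_odd _ (hs x)) (res_odd _ (hs y)) ?_
    refine Subtype.ext (funext fun z => funext fun i => ?_)
    rw [oddForm_res φ inf_le_left (hs x), oddForm_res φ inf_le_right (hs y), h, h]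
  have ho : t ∈ M.odd (r.pre V) := odd_of_locally fun x hx' =>
    ⟨r.pre (W ⟨r.homeo x, hx'⟩), r.pre_mono (hW _), hx ⟨r.homeo x, hx'⟩, by
      rw [ht]
      exact hs _⟩
  refine ⟨t, ho, Subtype.ext (funext fun x => funext fun i => ?_)⟩
  have h1 := oddForm_res φ (hW x) ho ⟨x.1, hx x⟩ i
  have h2 : φ.oddForm (res_odd (r.pre_mono (hW x)) ho) = φ.oddForm (hs x) := by
    rw [oddForm, oddForm]
    congr 1
    exact Subtype.ext (ht x)
  rw [h2, h] at h1
  exact h1.symm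

/-- The odd coordinate `θ_{li}` on `U_i`: the odd section representing `dz_{li}`. -/
noncomputable def theta (hM : M.IsLocallyGrassmann) (φ : r.CotangentFermions) (i : Fin 3)
    (l : Fin 2) : M.sec (r.pre (P2.affine i)) := (exists_odd_lift hM φ (P2.dz i l)).choose

theorem theta_odd (hM : M.IsLocallyGrassmann) (φ : r.CotangentFermions) (i : Fin 3) (l : Fin 2) :
    theta hM φ i l ∈ M.odd (r.pre (P2.affine i)) :=
  (exists_odd_lift hM φ (P2.dz i l)).choose_spec.choose

theorem oddForm_theta (hM : M.IsLocallyGrassmann) (φ : r.CotangentFermions) (i : Fin 3)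
    (l : Fin 2) : φ.oddForm (theta_odd hM φ i l) = P2.dz i l :=
  (exists_odd_lift hM φ (P2.dz i l)).choose_spec.choose_spec

end CotangentFermions

end Superspace.Reduction

namespace Superspace

theorem mem_nil_of_locally {M : Superspace} {U : Opens M.carrier} {s : M.sec U}
    (h : ∀ x ∈ U, ∃ (V : Opens M.carrier) (hV : V ≤ U), x ∈ V ∧ M.res hV s ∈ M.nil V) :
    s ∈ M.nil U := by
  intro x hx
  obtain ⟨V, hV, hxV, h1⟩ := h x hx
  obtain ⟨W, hW, hxW, h2⟩ := h1 x hxV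
  refine ⟨W, hW.trans hV, hxW, ?_⟩
  rwa [M.res_res] at h2

namespace Reduction

open CotangentFermions P2.supHol

variable {M : Superspace} {r : M.Reduction} {i : Fin 3}

/-! ### The frame of sections given by a splitting -/

/-- The restriction of the odd coordinate `θ_{li}` to an open subset of `U_i`. -/
noncomputable def thetaOn (hM : M.IsLocallyGrassmann) (φ : r.CotangentFermions) {W : Opens P2}
    (hW : W ≤ P2.affine i) (l : Fin 2) : M.sec (r.pre W) :=
  M.res (r.pre_mono hW) (theta hM φ i l)

section frame

variable (hM : M.IsLocallyGrassmann) (φ : r.CotangentFermions)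
  (σ : r.Splitting (P2.affine i)) {W : Opens P2} (hW : W ≤ P2.affine i)

theorem thetaOn_odd (l : Fin 2) : thetaOn hM φ hW l ∈ M.odd (r.pre W) :=
  res_odd _ (theta_odd hM φ i l)

theorem res_thetaOn {V : Opens P2} (h : V ≤ W) (l : Fin 2) :
    M.res (r.pre_mono h) (thetaOn hM φ hW l) = thetaOn hM φ (h.trans hW) l :=
  M.res_res _ _ _

theorem oddForm_thetaOn (l : Fin 2) (x : W) (j) :
    (φ.oddForm (thetaOn_odd hM φ hW l)).1 x j = (P2.dz i l).1 ⟨x.1, hW x.2⟩ j := by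
  rw [← oddForm_theta hM φ i l]
  exact oddForm_res φ hW (theta_odd hM φ i l) x j

theorem Splitting.lift_comm (f : P2.hol W) (a : M.sec (r.pre W)) :
    σ.lift W hW f * a = a * σ.lift W hW f :=
  M.even_comm _ _ (σ.lift_even W hW f) a

theorem combination_odd (b c : P2.hol W) : σ.lift W hW b * thetaOn hM φ hW 0 +
    σ.lift W hW c * thetaOn hM φ hW 1 ∈ M.odd (r.pre W) :=
  Submodule.add_mem _ (M.even_mul_odd _ _ (σ.lift_even W hW b) _ (thetaOn_odd hM φ hW 0))
    (M.even_mul_odd _ _ (σ.lift_even W hW c) _ (thetaOn_odd hM φ hW 1))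

theorem oddForm_combination (b c : P2.hol W) (x : W) (j) :
    (φ.oddForm (combination_odd hM φ σ hW b c)).1 x j =
      b.1 x • (P2.dz i 0).1 ⟨x.1, hW x.2⟩ j + c.1 x • (P2.dz i 1).1 ⟨x.1, hW x.2⟩ j := by
  have h1 := oddForm_add φ (M.even_mul_odd _ _ (σ.lift_even W hW b) _ (thetaOn_odd hM φ hW 0))
    (M.even_mul_odd _ _ (σ.lift_even W hW c) _ (thetaOn_odd hM φ hW 1))
  refine (congrArg (fun α => α.1 x j) h1).trans ?_
  change (φ.oddForm _).1 x j + (φ.oddForm _).1 x j = _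
  rw [oddForm_mul φ (σ.lift_even W hW b) (thetaOn_odd hM φ hW 0),
    oddForm_mul φ (σ.lift_even W hW c) (thetaOn_odd hM φ hW 1), σ.proj_lift, σ.proj_lift,
    oddForm_thetaOn, oddForm_thetaOn]

theorem oddForm_combination_self (b c : P2.hol W) (x : W) :
    (φ.oddForm (combination_odd hM φ σ hW b c)).1 x ⟨i, hW x.2⟩ = ![b.1 x, c.1 x] := by
  rw [oddForm_combination, P2.dz_self, P2.dz_self]
  funext l
  fin_cases l <;> simp

theorem exists_combination {s : M.sec (r.pre W)} (hs : s ∈ M.odd (r.pre W)) :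
    ∃ b c : P2.hol W,
      s = σ.lift W hW b * thetaOn hM φ hW 0 + σ.lift W hW c * thetaOn hM φ hW 1 := by
  refine ⟨⟨_, P2.forms_coeff_mem_hol hW (φ.oddForm hs) 0⟩,
    ⟨_, P2.forms_coeff_mem_hol hW (φ.oddForm hs) 1⟩, ?_⟩
  refine eq_of_oddForm_eq_chart (φ := φ) hM hW hs (combination_odd hM φ σ hW _ _) fun x => ?_
  rw [oddForm_combination_self]
  funext l
  fin_cases l <;> rfl

theorem combination_mul_combination (a b c d : P2.hol W) :
    (σ.lift W hW a * thetaOn hM φ hW 0 + σ.lift W hW b * thetaOn hM φ hW 1) *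
      (σ.lift W hW c * thetaOn hM φ hW 0 + σ.lift W hW d * thetaOn hM φ hW 1) =
      σ.lift W hW (a * d - b * c) * (thetaOn hM φ hW 0 * thetaOn hM φ hW 1) := by
  have key : ∀ f u g v, σ.lift W hW f * u * (σ.lift W hW g * v) =
      σ.lift W hW (f * g) * (u * v) := by
    intro f u g v
    rw [map_mul, mul_assoc, mul_assoc, ← mul_assoc u, ← σ.lift_comm hW g u, mul_assoc]
  simp only [mul_add, add_mul, key]
  rw [odd_mul_self (thetaOn_odd hM φ hW 0), odd_mul_self (thetaOn_odd hM φ hW 1),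
    M.odd_anticomm _ _ (thetaOn_odd hM φ hW 1) _ (thetaOn_odd hM φ hW 0), map_sub, sub_mul]
  simp only [mul_zero, mul_neg, zero_add, add_zero]
  abel

/-- The annihilator of `θ_{1i}θ_{2i}` is `J`: locally `J²` is generated by a product of two odd
sections with this property, and this product is a multiple of `θ_{1i}θ_{2i}`. -/
theorem mem_nil_of_mul_theta_eq_zero (σ : r.Splitting (P2.affine i)) {a : M.sec (r.pre W)}
    (h : a * (thetaOn hM φ hW 0 * thetaOn hM φ hW 1) = 0) : a ∈ M.nil (r.pre W) := by
  refine mem_nil_of_locally fun x hx => ?_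
  obtain ⟨U, hxU, e₁, he₁, e₂, he₂, hU⟩ := hM.exists_pair x
  obtain ⟨V, hxV, hV⟩ := r.exists_pre_le (x := r.homeo x) (U := U) (by
    rw [r.homeo.symm_apply_apply]
    exact hxU)
  have h1 : V ⊓ W ≤ W := inf_le_right
  have h2 : r.pre (V ⊓ W) ≤ U := (r.pre_mono inf_le_left).trans hV
  refine ⟨r.pre (V ⊓ W), r.pre_mono h1, ⟨hxV, hx⟩, hU _ h2 _ ?_⟩
  obtain ⟨b, c, h3⟩ := exists_combination hM φ σ (h1.trans hW) (res_odd h2 he₁)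
  obtain ⟨b', c', h4⟩ := exists_combination hM φ σ (h1.trans hW) (res_odd h2 he₂)
  rw [h3, h4, combination_mul_combination, ← mul_assoc, ← σ.lift_comm, mul_assoc,
    ← res_thetaOn hM φ hW h1, ← res_thetaOn hM φ hW h1, ← map_mul, ← map_mul, h, map_zero, mul_zero]

/-- `J²` is torsion-free over `O_{ℙ²}`, its generator having the annihilator `J`. -/
theorem lift_mul_theta_injective {d d' : P2.hol W}
    (h : σ.lift W hW d * (thetaOn hM φ hW 0 * thetaOn hM φ hW 1) =
      σ.lift W hW d' * (thetaOn hM φ hW 0 * thetaOn hM φ hW 1)) : d = d' := by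
  rw [← sub_eq_zero, ← sub_mul, ← map_sub] at h
  have h1 := proj_eq_zero (mem_nil_of_mul_theta_eq_zero hM φ hW σ h)
  rw [σ.proj_lift] at h1
  exact sub_eq_zero.1 h1

theorem theta_mul_theta_mem : thetaOn hM φ hW 0 * thetaOn hM φ hW 1 ∈ M.nilSq (r.pre W) :=
  odd_mul_odd_mem_nilSq (thetaOn_odd hM φ hW 0) (thetaOn_odd hM φ hW 1)

theorem sub_lift_proj_mem_nil {U W : Opens P2} (σ : r.Splitting U) (hW : W ≤ U)
    (a : M.sec (r.pre W)) :
    a - σ.lift W hW (r.proj W a) ∈ M.nil (r.pre W) := by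
  rw [← r.ker, map_sub, σ.proj_lift, sub_self]

/-- On `J²` a section acts through its reduction. -/
theorem mul_eq_lift_mul (hM : M.IsLocallyGrassmann) (a : M.sec (r.pre W)) {s : M.sec (r.pre W)}
    (hs : s ∈ M.nilSq (r.pre W)) :
    a * s = σ.lift W hW (r.proj W a) * s := by
  rw [← sub_eq_zero, ← sub_mul]
  exact hM.nil_mul_nilSq (sub_lift_proj_mem_nil σ hW a) hs

theorem res_lift_mul_theta {V : Opens P2} (h : V ≤ W) (d : P2.hol W) :
    M.res (r.pre_mono h) (σ.lift W hW d * (thetaOn hM φ hW 0 * thetaOn hM φ hW 1)) =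
      σ.lift V (h.trans hW) (P2.holRes h d) *
        (thetaOn hM φ (h.trans hW) 0 * thetaOn hM φ (h.trans hW) 1) := by
  rw [map_mul, map_mul, res_thetaOn hM φ hW h, res_thetaOn hM φ hW h, ← σ.lift_res h hW]

/-- The local form of `exists_of_mem_nilSq`. -/
theorem exists_of_mem_oddIdealSq {s : M.sec (r.pre W)} (hs : s ∈ M.oddIdealSq (r.pre W)) :
    ∃ d : P2.hol W, s = σ.lift W hW d * (thetaOn hM φ hW 0 * thetaOn hM φ hW 1) := by
  induction hs using Submodule.span_induction with
  | mem s h =>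
    obtain ⟨a, ha, b, hb, rfl⟩ := h
    obtain ⟨c, d, h1⟩ := exists_combination hM φ σ hW ha
    obtain ⟨c', d', h2⟩ := exists_combination hM φ σ hW hb
    exact ⟨_, by rw [h1, h2, combination_mul_combination]⟩
  | zero => exact ⟨0, by rw [map_zero, zero_mul]⟩
  | add s t _ _ h1 h2 =>
    obtain ⟨d, rfl⟩ := h1
    obtain ⟨d', rfl⟩ := h2
    exact ⟨d + d', by rw [map_add, add_mul]⟩
  | smul a s _ h =>
    obtain ⟨d, rfl⟩ := h
    refine ⟨r.proj W a * d, ?_⟩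
    rw [smul_eq_mul, mul_eq_lift_mul σ hW hM a (Ideal.mul_mem_left _ _
      (theta_mul_theta_mem hM φ hW)), map_mul, mul_assoc]

/-- `J²` is free over `O_{ℙ²}` with the generator `θ_{1i}θ_{2i}`. -/
theorem exists_of_mem_nilSq {s : M.sec (r.pre W)} (hs : s ∈ M.nilSq (r.pre W)) :
    ∃ d : P2.hol W, s = σ.lift W hW d * (thetaOn hM φ hW 0 * thetaOn hM φ hW 1) := by
  have key : ∀ x : W, ∃ (V : Opens P2) (h : V ≤ W) (d : P2.hol V), x.1 ∈ V ∧
      M.res (r.pre_mono h) s = σ.lift V (h.trans hW) d *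
        (thetaOn hM φ (h.trans hW) 0 * thetaOn hM φ (h.trans hW) 1) := by
    intro x
    have hx : r.homeo (r.homeo.symm x.1) = x.1 := r.homeo.apply_symm_apply x.1
    obtain ⟨U, hU, hxU, h1⟩ := hs (r.homeo.symm x.1) (by
      change r.homeo (r.homeo.symm x.1) ∈ W
      rw [hx]
      exact x.2)
    obtain ⟨V, hxV, hV⟩ := r.exists_pre_le hxU
    have h2 : V ⊓ W ≤ W := inf_le_right
    have h3 : M.res (r.pre_mono h2) s ∈ M.oddIdealSq (r.pre (V ⊓ W)) := by
      have := M.res_mem_oddIdealSq ((r.pre_mono (inf_le_left : V ⊓ W ≤ V)).trans hV) _ h1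
      rwa [M.res_res] at this
    obtain ⟨d, hd⟩ := exists_of_mem_oddIdealSq hM φ σ (h2.trans hW) h3
    exact ⟨V ⊓ W, h2, d, ⟨hxV, x.2⟩, hd⟩
  choose V hV d hx hd using key
  have hc : ∀ (x y : W) (hy : y.1 ∈ V x), (d y).1 ⟨y.1, hx y⟩ = (d x).1 ⟨y.1, hy⟩ := by
    intro x y hy
    have h1 : V x ⊓ V y ≤ V x := inf_le_left
    have h2 : V x ⊓ V y ≤ V y := inf_le_right
    have e1 := congrArg (M.res (r.pre_mono h1)) (hd x)
    have e2 := congrArg (M.res (r.pre_mono h2)) (hd y)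
    rw [M.res_res, res_lift_mul_theta hM φ σ _ h1] at e1
    rw [M.res_res, res_lift_mul_theta hM φ σ _ h2] at e2
    have e3 := lift_mul_theta_injective hM φ σ ((h1.trans (hV x)).trans hW) (e2.symm.trans e1)
    exact congrFun (congrArg Subtype.val e3) ⟨y.1, hy, hx y⟩
  have hm : (fun y : W => (d y).1 ⟨y.1, hx y⟩) ∈ P2.hol W := by
    refine P2.mem_hol_of_local _ fun x hx' => ⟨V ⟨x, hx'⟩, hV _, hx _, ?_⟩
    have : (fun y : V ⟨x, hx'⟩ => (d ⟨y.1, hV _ y.2⟩).1 ⟨y.1, hx ⟨y.1, hV _ y.2⟩⟩) =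
        (d ⟨x, hx'⟩).1 := funext fun y => hc ⟨x, hx'⟩ ⟨y.1, hV _ y.2⟩ y.2
    rw [this]
    exact (d ⟨x, hx'⟩).2
  refine ⟨⟨_, hm⟩, ext_of_locally fun x hx' => ⟨V ⟨x, hx'⟩, hV _, hx _, ?_⟩⟩
  rw [hd ⟨x, hx'⟩, res_lift_mul_theta hM φ σ hW (hV ⟨x, hx'⟩)]
  congr 2
  exact Subtype.ext (funext fun y => (hc ⟨x, hx'⟩ ⟨y.1, hV _ y.2⟩ y.2).symm)

/-- The homomorphism from the Grassmann-algebra-valued holomorphic functions to the sections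
of `M` over the part of `U_i` above `W`, given by a splitting over `U_i` and the odd coordinates. -/
noncomputable def frame : P2.supHol W →ₐ[ℂ] M.sec (r.pre W) :=
  P2.supHol.lift (σ.lift W hW) (thetaOn hM φ hW 0) (thetaOn hM φ hW 1) (σ.lift_comm hW)
    (odd_mul_self (thetaOn_odd hM φ hW 0)) (odd_mul_self (thetaOn_odd hM φ hW 1))
    (M.odd_anticomm _ _ (thetaOn_odd hM φ hW 1) _ (thetaOn_odd hM φ hW 0))

theorem frame_apply (F : P2.supHol W) : frame hM φ σ hW F =
    (σ.lift W hW (c0 F) + σ.lift W hW (c12 F) * (thetaOn hM φ hW 0 * thetaOn hM φ hW 1)) +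
    (σ.lift W hW (c1 F) * thetaOn hM φ hW 0 + σ.lift W hW (c2 F) * thetaOn hM φ hW 1) := by
  change σ.lift W hW (c0 F) * 1 + _ + _ + _ = _
  rw [mul_one]
  abel

theorem frame_even_part (F : P2.supHol W) : σ.lift W hW (c0 F) +
    σ.lift W hW (c12 F) * (thetaOn hM φ hW 0 * thetaOn hM φ hW 1) ∈ M.even (r.pre W) :=
  Submodule.add_mem _ (σ.lift_even W hW _) (M.even_mul_even _ _ (σ.lift_even W hW _) _
    (M.odd_mul_odd _ _ (thetaOn_odd hM φ hW 0) _ (thetaOn_odd hM φ hW 1)))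

theorem frame_res {V : Opens P2} (h : V ≤ W) (F : P2.supHol W) :
    M.res (r.pre_mono h) (frame hM φ σ hW F) =
      frame hM φ σ (h.trans hW) (P2.supHol.res h F) := by
  simp only [frame_apply, map_add, map_mul (M.res _), res_thetaOn hM φ hW h, ← σ.lift_res h hW]
  rfl

theorem combination_eq_zero {b c : P2.hol W} (h : σ.lift W hW b * thetaOn hM φ hW 0 +
    σ.lift W hW c * thetaOn hM φ hW 1 = 0) : b = 0 ∧ c = 0 := by
  have h1 : φ.oddForm (combination_odd hM φ σ hW b c) = 0 := by
    rw [oddForm, ← map_zero (φ.form W)]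
    congr 1
    exact Subtype.ext h
  have h2 : ∀ x : W, ![b.1 x, c.1 x] = 0 := by
    intro x
    rw [← oddForm_combination_self hM φ σ hW b c x, h1]
    rfl
  exact ⟨Subtype.ext (funext fun x => congrFun (h2 x) 0),
    Subtype.ext (funext fun x => congrFun (h2 x) 1)⟩

theorem frame_mem_even_iff (F : P2.supHol W) :
    frame hM φ σ hW F ∈ M.even (r.pre W) ↔ (c1 F) = 0 ∧ (c2 F) = 0 := by
  rw [frame_apply]
  constructor
  · intro h
    have h1 := (parts_eq (frame_even_part hM φ σ hW F) h (combination_odd hM φ σ hW (c1 F) (c2 F))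
      (Submodule.zero_mem _) (add_zero _).symm).2
    exact combination_eq_zero hM φ σ hW h1
  · rintro ⟨h1, h2⟩
    rw [h1, h2, map_zero, zero_mul, zero_mul, add_zero, add_zero]
    exact frame_even_part hM φ σ hW F

theorem even_part_eq_zero {F : P2.supHol W} (h : σ.lift W hW (c0 F) +
    σ.lift W hW (c12 F) * (thetaOn hM φ hW 0 * thetaOn hM φ hW 1) = 0) :
    c0 F = 0 ∧ c12 F = 0 := by
  have h0 : (c0 F) = 0 := by
    have h1 := congrArg (r.proj W) h
    rwa [map_add, σ.proj_lift, proj_eq_zero (nilSq_le_nil (Ideal.mul_mem_left _ _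
      (theta_mul_theta_mem hM φ hW))), add_zero, map_zero] at h1
  refine ⟨h0, lift_mul_theta_injective hM φ σ hW ?_⟩
  rwa [h0, map_zero, zero_add, ← zero_mul (thetaOn hM φ hW 0 * thetaOn hM φ hW 1),
    ← map_zero (σ.lift W hW)] at h

theorem frame_mem_odd_iff (F : P2.supHol W) :
    frame hM φ σ hW F ∈ M.odd (r.pre W) ↔ (c0 F) = 0 ∧ (c12 F) = 0 := by
  rw [frame_apply]
  constructor
  · intro h
    have h1 := (parts_eq (frame_even_part hM φ σ hW F) (Submodule.zero_mem _)
      (combination_odd hM φ σ hW (c1 F) (c2 F)) h (zero_add _).symm).1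
    exact even_part_eq_zero hM φ σ hW h1
  · rintro ⟨h1, h2⟩
    rw [h1, h2, map_zero, zero_mul, zero_add, zero_add]
    exact combination_odd hM φ σ hW (c1 F) (c2 F)

/-- A splitting and the odd coordinates trivialize `O_M`: an odd section is a combination of the
`θ_{li}`, and an even one differs from the lift of its reduction by a multiple of `θ_{1i}θ_{2i}`. -/
theorem frame_bijective : Function.Bijective (frame hM φ σ hW) := by
  constructor
  · refine (injective_iff_map_eq_zero _).2 fun F h => ?_
    obtain ⟨h1, h2⟩ := (frame_mem_even_iff hM φ σ hW F).1 (h ▸ Submodule.zero_mem _)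
    obtain ⟨h3, h4⟩ := (frame_mem_odd_iff hM φ σ hW F).1 (h ▸ Submodule.zero_mem _)
    exact P2.supHol.ext h3 h1 h2 h4
  · intro s
    obtain ⟨e, he, o, ho, rfl⟩ := exists_even_add_odd s
    obtain ⟨b, c, h1⟩ := exists_combination hM φ σ hW ho
    obtain ⟨d, h2⟩ := exists_of_mem_nilSq hM φ σ hW (mem_nilSq_of_even
      (sub_lift_proj_mem_nil σ hW e) (Submodule.sub_mem _ he (σ.lift_even W hW _)))
    refine ⟨P2.supHol.mk (r.proj W e) b c d, ?_⟩
    rw [frame_apply]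
    change (σ.lift W hW (r.proj W e) + σ.lift W hW d * _) +
      (σ.lift W hW b * _ + σ.lift W hW c * _) = e + o
    rw [← h1, ← h2, add_sub_cancel]

/-- The sections of `M` over an open subset of `U_i` are the sections of the split
supermanifold. -/
noncomputable def frameEquiv : P2.supHol W ≃ₐ[ℂ] M.sec (r.pre W) :=
  AlgEquiv.ofBijective (frame hM φ σ hW) (frame_bijective hM φ σ hW)

end frame

end Reduction

end Superspace

namespace Superspace.Reduction

open CotangentFermions P2.supHol

/-! ### Splittings adapted to the standard cocycle -/

section adapted

variable {M : Superspace} {r : M.Reduction}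

/-- The difference of a splitting and a derivation with values in `J²`, which is a splitting since
products of two elements of `J²` vanish. -/
noncomputable def Splitting.sub (hM : M.IsLocallyGrassmann) {U : Opens P2} (σ : r.Splitting U)
    (d : r.Derivation U) : r.Splitting U where
  lift W hW := AlgHom.ofLinearMap ((σ.lift W hW).toLinearMap - d.toFun W hW) (by
      have h := d.leibniz W hW 1 (M.one_even _) 1 (M.one_even _)
      rw [map_one, mul_one, one_mul] at h
      have h1 : d.toFun W hW 1 = 0 := by simpa using h
      simp [h1]) (fun f g => by
      have h := d.leibniz W hW _ (σ.lift_even W hW f) _ (σ.lift_even W hW g)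
      rw [σ.proj_lift, σ.proj_lift] at h
      have h1 := hM.nil_mul_nilSq (nilSq_le_nil (d.mem_nilSq W hW f)) (d.mem_nilSq W hW g)
      simp only [LinearMap.sub_apply, AlgHom.toLinearMap_apply, map_mul, h, sub_mul, mul_sub, h1]
      rw [M.even_comm _ _ (σ.lift_even W hW g)]
      abel)
  lift_res h hV f := by
    change σ.lift _ _ _ - d.toFun _ _ _ = M.res (r.pre_mono h) (σ.lift _ hV f - d.toFun _ hV f)
    rw [map_sub, σ.lift_res h hV, d.map_res h hV]
  lift_even W hW f := Submodule.sub_mem _ (σ.lift_even W hW f)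
    (hM.nilSq_le_even (d.mem_nilSq W hW f))
  proj_lift W hW f := by
    change r.proj W (σ.lift W hW f - d.toFun W hW f) = f
    rw [map_sub, σ.proj_lift, proj_eq_zero (nilSq_le_nil (d.mem_nilSq W hW f)), sub_zero]

theorem Splitting.sub_apply (hM : M.IsLocallyGrassmann) {U : Opens P2} (σ : r.Splitting U)
    (d : r.Derivation U) {W : Opens P2} (hW : W ≤ U) (f : P2.hol W) :
    (σ.sub hM d).lift W hW f = σ.lift W hW f - d.toFun W hW f := rfl

/-- The coefficient of the standard cocycle as a holomorphic function. -/
noncomputable def stdHol {W : Opens P2} {i : Fin 3} (hW : W ≤ P2.affine i) (f : P2.hol W) :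
    P2.hol W := ⟨_, stdCoeff_mem_hol f hW⟩

/-- The differences of the splittings `σ_i` over `U_i` are `lam` times the standard cocycle. -/
def IsAdapted (hM : M.IsLocallyGrassmann) (φ : r.CotangentFermions) (lam : ℂ)
    (σ : ∀ i : Fin 3, r.Splitting (P2.affine i)) : Prop :=
  ∀ (i : Fin 3) (W : Opens P2) (hi : W ≤ P2.affine i) (hj : W ≤ P2.affine (i + 1)) (f : P2.hol W),
    (σ i).lift W hi f = (σ (i + 1)).lift W hj f + (σ (i + 1)).lift W hj (lam • stdHol hi f) *
      (thetaOn hM φ hj 0 * thetaOn hM φ hj 1)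

/-- The coboundary in the definition of the obstruction class is absorbed in the splittings. -/
theorem HasObstructionClass.exists_isAdapted (hM : M.IsLocallyGrassmann) {φ : r.CotangentFermions}
    {lam : ℂ} (h : HasObstructionClass φ lam) : ∃ σ, IsAdapted hM φ lam σ := by
  obtain ⟨c, hc, σ, d, h⟩ := h
  refine ⟨fun i => (σ i).sub hM (d i), fun i W hi hj f => ?_⟩
  have h1 := h i W (le_inf hi hj) f
  have hf : ∀ (l : Fin 2) (x : W), (φ.oddForm (thetaOn_odd hM φ hj l)).1 x ⟨i + 1, hj x.2⟩ =
      Pi.single l 1 := fun l x => by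
    rw [oddForm_thetaOn, P2.dz_self]
  have h2 := hc i W (le_inf hi hj) f
    (((σ (i + 1)).sub hM (d (i + 1))).lift W hj (stdHol hi f)) (Splitting.lift_even _ _ _ _)
    (fun x => by rw [Splitting.proj_lift]; rfl) ⟨_, odd_le_nil (thetaOn_odd hM φ hj 0)⟩
    ⟨_, odd_le_nil (thetaOn_odd hM φ hj 1)⟩ (hf 0) (hf 1)
  rw [map_smul, smul_mul_assoc]
  dsimp only at h2
  rw [← h2, Splitting.sub_apply, Splitting.sub_apply, sub_add_eq_add_sub, sub_eq_sub_iff_add_eq_add]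
  rw [sub_eq_iff_eq_add] at h1
  rw [h1]
  abel

variable (hM : M.IsLocallyGrassmann) (φ : r.CotangentFermions)

/-- The partial derivative of `z_{ki}` with respect to `z_{lj}`. -/
noncomputable def jac {W : Opens P2} {i j : Fin 3} (hi : W ≤ P2.affine i) (hj : W ≤ P2.affine j)
    (k l : Fin 2) : P2.hol W :=
  ⟨fun x => (P2.dz i k).1 ⟨x.1, hi x.2⟩ ⟨j, hj x.2⟩ l, P2.mem_hol_of_eq hj _
    (fun w => fderiv ℂ (fun w => P2.change i j w k) w (Pi.single l 1))
    (fun _ hx => P2.analyticAt_fderiv_apply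
      (P2.analyticAt_change_apply (P2.homog_coord_ne_zero (hi hx) (hj hx)) k) _) fun _ => rfl⟩

theorem thetaOn_eq {W : Opens P2} {i j : Fin 3} (hi : W ≤ P2.affine i) (hj : W ≤ P2.affine j)
    (σ : r.Splitting (P2.affine j)) (k : Fin 2) :
    thetaOn hM φ hi k = σ.lift W hj (jac hi hj k 0) * thetaOn hM φ hj 0 +
      σ.lift W hj (jac hi hj k 1) * thetaOn hM φ hj 1 := by
  refine eq_of_oddForm_eq_chart (φ := φ) hM hj (thetaOn_odd hM φ hi k)
    (combination_odd hM φ σ hj _ _) fun x => ?_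
  rw [oddForm_combination_self, oddForm_thetaOn]
  funext l
  fin_cases l <;> rfl

/-- The determinant of the Jacobian matrix. -/
noncomputable def jacDet {W : Opens P2} {i j : Fin 3} (hi : W ≤ P2.affine i)
    (hj : W ≤ P2.affine j) : P2.hol W :=
  jac hi hj 0 0 * jac hi hj 1 1 - jac hi hj 0 1 * jac hi hj 1 0

/-- The change of the generator of `J²`. -/
theorem theta_mul_theta_eq {W : Opens P2} {i j : Fin 3} (hi : W ≤ P2.affine i)
    (hj : W ≤ P2.affine j) (σ : r.Splitting (P2.affine j)) :
    thetaOn hM φ hi 0 * thetaOn hM φ hi 1 =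
      σ.lift W hj (jacDet hi hj) * (thetaOn hM φ hj 0 * thetaOn hM φ hj 1) := by
  rw [thetaOn_eq hM φ hi hj σ 0, thetaOn_eq hM φ hi hj σ 1, combination_mul_combination]
  rfl

theorem lift_sub_lift_mem {U V W : Opens P2} (hi : W ≤ U) (hj : W ≤ V) (σ : r.Splitting U)
    (τ : r.Splitting V) (f : P2.hol W) : σ.lift W hi f - τ.lift W hj f ∈ M.nilSq (r.pre W) := by
  refine mem_nilSq_of_even ?_ (Submodule.sub_mem _ (σ.lift_even W hi f) (τ.lift_even W hj f))
  rw [← r.ker, map_sub, σ.proj_lift, τ.proj_lift, sub_self]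

/-- On `J` the actions of `O_{ℙ²}` by different splittings agree. -/
theorem lift_mul_eq {W : Opens P2} {i j : Fin 3} (hi : W ≤ P2.affine i)
    (hj : W ≤ P2.affine j) (σ : r.Splitting (P2.affine i)) (τ : r.Splitting (P2.affine j))
    (hM : M.IsLocallyGrassmann) (f : P2.hol W) {s : M.sec (r.pre W)} (hs : s ∈ M.nil (r.pre W)) :
    σ.lift W hi f * s = τ.lift W hj f * s := by
  rw [← sub_eq_zero, ← sub_mul]
  exact hM.nilSq_mul_nil (lift_sub_lift_mem hi hj σ τ f) hs

/-- The coordinate change from the frame over `U_i` to the frame over `U_{i+1}`. -/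
noncomputable def transition (lam : ℂ) {i : Fin 3} {W : Opens P2} (hi : W ≤ P2.affine i)
    (hj : W ≤ P2.affine (i + 1)) (F : P2.supHol W) : P2.supHol W :=
  P2.supHol.mk (c0 F) (c1 F * jac hi hj 0 0 + c2 F * jac hi hj 1 0)
    (c1 F * jac hi hj 0 1 + c2 F * jac hi hj 1 1) (c12 F * jacDet hi hj + lam • stdHol hi (c0 F))

/-- The frames given by adapted splittings differ by a coordinate change which depends on `lam`
only, and not on the supermanifold. -/
theorem frame_transition {lam : ℂ} {σ : ∀ i : Fin 3, r.Splitting (P2.affine i)}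
    (hσ : IsAdapted hM φ lam σ) {i : Fin 3} {W : Opens P2} (hi : W ≤ P2.affine i)
    (hj : W ≤ P2.affine (i + 1)) (F : P2.supHol W) :
    frame hM φ (σ i) hi F = frame hM φ (σ (i + 1)) hj (transition lam hi hj F) := by
  have h1 : ∀ f (k : Fin 2), (σ i).lift W hi f * thetaOn hM φ hi k =
      (σ (i + 1)).lift W hj (f * jac hi hj k 0) * thetaOn hM φ hj 0 +
        (σ (i + 1)).lift W hj (f * jac hi hj k 1) * thetaOn hM φ hj 1 := by
    intro f k
    rw [lift_mul_eq hi hj (σ i) (σ (i + 1)) hM f (odd_le_nil (thetaOn_odd hM φ hi k)),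
      thetaOn_eq hM φ hi hj (σ (i + 1)) k, mul_add, map_mul, map_mul, mul_assoc, mul_assoc]
  rw [frame_apply, frame_apply, h1, h1, lift_mul_eq hi hj (σ i) (σ (i + 1)) hM _
    (nilSq_le_nil (theta_mul_theta_mem hM φ hi)), theta_mul_theta_eq hM φ hi hj (σ (i + 1)),
    hσ i W hi hj, ← mul_assoc ((σ (i + 1)).lift W hj (c12 F)), ← map_mul]
  change _ = ((σ (i + 1)).lift W hj (c0 F) + (σ (i + 1)).lift W hj (c12 F * jacDet hi hj +
    lam • stdHol hi (c0 F)) * _) + ((σ (i + 1)).lift W hj (c1 F * jac hi hj 0 0 +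
    c2 F * jac hi hj 1 0) * _ + (σ (i + 1)).lift W hj (c1 F * jac hi hj 0 1 +
    c2 F * jac hi hj 1 1) * _)
  simp only [map_add, add_mul]
  abel

end adapted

/-! ### Isomorphisms from local isomorphisms -/

section glue

variable {M N : Superspace}

/-- Homomorphisms of the algebras of sections over the open subsets of the standard affine planes,
which are compatible with restrictions and do not depend on the plane. -/
structure LocalHom (rM : M.Reduction) (rN : N.Reduction) where
  hom : ∀ (i : Fin 3) (W : Opens P2), W ≤ P2.affine i → (N.sec (rN.pre W) →ₐ[ℂ] M.sec (rM.pre W))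
  hom_res : ∀ (i : Fin 3) {V W : Opens P2} (h : W ≤ V) (hV : V ≤ P2.affine i)
    (s : N.sec (rN.pre V)), hom i W (h.trans hV) (N.res (rN.pre_mono h) s) =
      M.res (rM.pre_mono h) (hom i V hV s)
  agree : ∀ (i j : Fin 3) (W : Opens P2) (hi : W ≤ P2.affine i) (hj : W ≤ P2.affine j)
    (s : N.sec (rN.pre W)), hom i W hi s = hom j W hj s

namespace LocalHom

variable {rM : M.Reduction} {rN : N.Reduction} (p : LocalHom rM rN)

theorem ext_of_affine {V : Opens P2} {s t : M.sec (rM.pre V)}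
    (h : ∀ i, M.res (rM.pre_mono (inf_le_left : V ⊓ P2.affine i ≤ V)) s =
      M.res (rM.pre_mono inf_le_left) t) : s = t :=
  ext_of_locally fun x hx => by
    obtain ⟨i, hi⟩ := P2.exists_mem_affine x
    exact ⟨V ⊓ P2.affine i, inf_le_left, ⟨hx, hi⟩, h i⟩

theorem exists_glued (V : Opens P2) (s : N.sec (rN.pre V)) : ∃ t : M.sec (rM.pre V), ∀ i,
    M.res (rM.pre_mono (inf_le_left : V ⊓ P2.affine i ≤ V)) t =
      p.hom i _ inf_le_right (N.res (rN.pre_mono inf_le_left) s) := by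
  refine exists_glue (r := rM) (fun _ => inf_le_left) (fun x hx => ?_) _ fun i j => ?_
  · obtain ⟨i, hi⟩ := P2.exists_mem_affine x
    exact ⟨i, hx, hi⟩
  · have h1 : (V ⊓ P2.affine i) ⊓ (V ⊓ P2.affine j) ≤ V ⊓ P2.affine i := inf_le_left
    have h2 : (V ⊓ P2.affine i) ⊓ (V ⊓ P2.affine j) ≤ V ⊓ P2.affine j := inf_le_right
    rw [← p.hom_res i h1, ← p.hom_res j h2, N.res_res, N.res_res]
    exact p.agree i j _ _ _ _

/-- The value of the glued homomorphism. -/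
noncomputable def glueFun (V : Opens P2) (s : N.sec (rN.pre V)) : M.sec (rM.pre V) :=
  (p.exists_glued V s).choose

theorem res_glueFun_inf (V : Opens P2) (s : N.sec (rN.pre V)) (i : Fin 3) :
    M.res (rM.pre_mono (inf_le_left : V ⊓ P2.affine i ≤ V)) (p.glueFun V s) =
      p.hom i _ inf_le_right (N.res (rN.pre_mono inf_le_left) s) :=
  (p.exists_glued V s).choose_spec i

/-- The global homomorphism glued from local ones. -/
noncomputable def glue (V : Opens P2) : N.sec (rN.pre V) →ₐ[ℂ] M.sec (rM.pre V) :=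
  AlgHom.ofLinearMap
    { toFun := p.glueFun V
      map_add' := fun s t => ext_of_affine fun i => by
        rw [map_add, res_glueFun_inf, res_glueFun_inf, res_glueFun_inf, map_add, map_add]
      map_smul' := fun a s => ext_of_affine fun i => by
        rw [map_smul, res_glueFun_inf, res_glueFun_inf, map_smul, map_smul]
        rfl }
    (ext_of_affine fun i => by
      change M.res _ (p.glueFun V 1) = _
      rw [res_glueFun_inf, map_one, map_one, map_one])
    (fun s t => ext_of_affine fun i => by
      change M.res _ (p.glueFun V (s * t)) = M.res _ (p.glueFun V s * p.glueFun V t)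
      rw [map_mul, res_glueFun_inf, res_glueFun_inf, res_glueFun_inf, map_mul, map_mul])

theorem res_glue {V W : Opens P2} (h : W ≤ V) {i : Fin 3} (hW : W ≤ P2.affine i)
    (s : N.sec (rN.pre V)) : M.res (rM.pre_mono h) (p.glue V s) =
      p.hom i W hW (N.res (rN.pre_mono h) s) := by
  have h1 := congrArg (M.res (rM.pre_mono (le_inf h hW))) (p.res_glueFun_inf V s i)
  rw [M.res_res, ← p.hom_res i (le_inf h hW), N.res_res] at h1
  exact h1

theorem glue_res {V W : Opens P2} (h : W ≤ V) (s : N.sec (rN.pre V)) :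
    p.glue W (N.res (rN.pre_mono h) s) = M.res (rM.pre_mono h) (p.glue V s) :=
  ext_of_affine fun i => by
    rw [p.res_glue inf_le_left inf_le_right, M.res_res, N.res_res]
    exact (p.res_glue (inf_le_left.trans h) inf_le_right s).symm

theorem glue_glue (q : LocalHom rN rM) (h : ∀ i W hW s, q.hom i W hW (p.hom i W hW s) = s)
    (V : Opens P2) (s : N.sec (rN.pre V)) : q.glue V (p.glue V s) = s :=
  ext_of_affine fun i => by
    rw [q.res_glue inf_le_left inf_le_right, p.res_glue inf_le_left inf_le_right, h]

theorem glue_even (h : ∀ i W hW, ∀ s ∈ N.even (rN.pre W), p.hom i W hW s ∈ M.even (rM.pre W))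
    {V : Opens P2} {s : N.sec (rN.pre V)} (hs : s ∈ N.even (rN.pre V)) :
    p.glue V s ∈ M.even (rM.pre V) :=
  even_of_locally fun x hx => by
    obtain ⟨i, hi⟩ := P2.exists_mem_affine (rM.homeo x)
    refine ⟨rM.pre (V ⊓ P2.affine i), rM.pre_mono inf_le_left, ⟨hx, hi⟩, ?_⟩
    rw [p.res_glue inf_le_left inf_le_right]
    exact h _ _ _ _ (res_even _ hs)

theorem glue_odd (h : ∀ i W hW, ∀ s ∈ N.odd (rN.pre W), p.hom i W hW s ∈ M.odd (rM.pre W))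
    {V : Opens P2} {s : N.sec (rN.pre V)} (hs : s ∈ N.odd (rN.pre V)) :
    p.glue V s ∈ M.odd (rM.pre V) :=
  odd_of_locally fun x hx => by
    obtain ⟨i, hi⟩ := P2.exists_mem_affine (rM.homeo x)
    refine ⟨rM.pre (V ⊓ P2.affine i), rM.pre_mono inf_le_left, ⟨hx, hi⟩, ?_⟩
    rw [p.res_glue inf_le_left inf_le_right]
    exact h _ _ _ _ (res_odd _ hs)

/-- Mutually inverse local homomorphisms which preserve parity give an isomorphism. -/
theorem nonempty_iso (q : LocalHom rN rM) (hq : ∀ i W hW s, q.hom i W hW (p.hom i W hW s) = s)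
    (hp : ∀ i W hW s, p.hom i W hW (q.hom i W hW s) = s)
    (he : ∀ i W hW, ∀ s ∈ N.even (rN.pre W), p.hom i W hW s ∈ M.even (rM.pre W))
    (ho : ∀ i W hW, ∀ s ∈ N.odd (rN.pre W), p.hom i W hW s ∈ M.odd (rM.pre W)) :
    Nonempty (M.Iso N) := by
  let D : Opens N.carrier → Opens P2 := fun V =>
    V.comap ⟨rN.homeo.symm, rN.homeo.symm.continuous⟩
  have hD : ∀ V, rN.pre (D V) = V := by
    intro V
    ext x
    change rN.homeo.symm (rN.homeo x) ∈ V ↔ x ∈ V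
    rw [rN.homeo.symm_apply_apply]
  have hDm : ∀ {V W : Opens N.carrier}, W ≤ V → D W ≤ D V := fun h x hx => h hx
  let e : ∀ V : Opens P2, N.sec (rN.pre V) ≃ₐ[ℂ] M.sec (rM.pre V) := fun V =>
    AlgEquiv.ofAlgHom (p.glue V) (q.glue V) (AlgHom.ext fun s => q.glue_glue p hp V s)
      (AlgHom.ext fun s => p.glue_glue q hq V s)
  refine ⟨⟨rM.homeo.trans rN.homeo.symm, fun V => (N.resEquiv (hD V)).trans (e (D V)), ?_, ?_, ?_⟩⟩
  · intro V W h s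
    have h1 := p.glue_res (hDm h) (N.res (hD V).le s)
    rw [N.res_res] at h1
    refine Eq.trans ?_ h1
    exact congrArg (p.glue (D W)) (N.res_res _ _ _)
  · intro V s hs
    exact p.glue_even he (res_even (hD V).le hs)
  · intro V s hs
    exact p.glue_odd ho (res_odd (hD V).le hs)

end LocalHom

theorem fin3_forall {P : Fin 3 → Fin 3 → Prop} (h0 : ∀ i, P i i) (h1 : ∀ i, P i (i + 1))
    (h2 : ∀ i j, P i j → P j i) (i j : Fin 3) : P i j := by
  have h01 := h1 0
  have h12 := h1 1
  have h20 := h1 2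
  fin_cases i <;> fin_cases j
  exacts [h0 _, h01, h2 _ _ h20, h2 _ _ h01, h0 _, h12, h20, h2 _ _ h12, h0 _]

variable {rM : M.Reduction} {rN : N.Reduction}

/-- The comparison of two supermanifolds with splittings adapted to the same multiple of the
standard cocycle: the frames correspond to each other. -/
noncomputable def compare (hM : M.IsLocallyGrassmann) (hN : N.IsLocallyGrassmann)
    (φ : rM.CotangentFermions) (ψ : rN.CotangentFermions) {lam : ℂ}
    {σ : ∀ i : Fin 3, rM.Splitting (P2.affine i)} {τ : ∀ i : Fin 3, rN.Splitting (P2.affine i)}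
    (hσ : IsAdapted hM φ lam σ) (hτ : IsAdapted hN ψ lam τ) : LocalHom rM rN where
  hom i W hW := (frame hM φ (σ i) hW).comp (frameEquiv hN ψ (τ i) hW).symm.toAlgHom
  hom_res i V W h hV s := by
    obtain ⟨F, rfl⟩ := (frameEquiv hN ψ (τ i) hV).surjective s
    have h1 : N.res (rN.pre_mono h) (frameEquiv hN ψ (τ i) hV F) =
      frameEquiv hN ψ (τ i) (h.trans hV) (P2.supHol.res h F) := frame_res hN ψ (τ i) hV h F
    rw [h1]
    change frame hM φ (σ i) _ ((frameEquiv hN ψ (τ i) _).symm _) =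
      M.res _ (frame hM φ (σ i) _ ((frameEquiv hN ψ (τ i) _).symm _))
    rw [AlgEquiv.symm_apply_apply, AlgEquiv.symm_apply_apply]
    exact (frame_res hM φ (σ i) hV h F).symm
  agree := by
    refine fin3_forall (fun i W hi hj s => rfl) (fun i W hi hj s => ?_)
      fun i j h W hi hj s => (h W hj hi s).symm
    obtain ⟨F, rfl⟩ := (frameEquiv hN ψ (τ i) hi).surjective s
    change frame hM φ (σ i) _ ((frameEquiv hN ψ (τ i) _).symm _) =
      frame hM φ (σ (i + 1)) _ ((frameEquiv hN ψ (τ (i + 1)) _).symm _)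
    rw [AlgEquiv.symm_apply_apply]
    have h1 : frameEquiv hN ψ (τ i) hi F =
      frameEquiv hN ψ (τ (i + 1)) hj (transition lam hi hj F) := frame_transition hN ψ hτ hi hj F
    rw [h1, AlgEquiv.symm_apply_apply]
    exact frame_transition hM φ hσ hi hj F

theorem compare_frame (hM : M.IsLocallyGrassmann) (hN : N.IsLocallyGrassmann)
    (φ : rM.CotangentFermions) (ψ : rN.CotangentFermions) {lam : ℂ}
    {σ : ∀ i : Fin 3, rM.Splitting (P2.affine i)} {τ : ∀ i : Fin 3, rN.Splitting (P2.affine i)}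
    (hσ : IsAdapted hM φ lam σ) (hτ : IsAdapted hN ψ lam τ) (i : Fin 3) (W : Opens P2)
    (hW : W ≤ P2.affine i) (F : P2.supHol W) :
    (compare hM hN φ ψ hσ hτ).hom i W hW (frame hN ψ (τ i) hW F) = frame hM φ (σ i) hW F :=
  congrArg (frame hM φ (σ i) hW) ((frameEquiv hN ψ (τ i) hW).symm_apply_apply F)

end glue

end Superspace.Reduction

/-- The obstruction class determines the supermanifold. -/
theorem Superspace.IsGivenByTriple.nonempty_iso {M N : Superspace} {lam : ℂ}
    (hM : M.IsGivenByTriple lam) (hN : N.IsGivenByTriple lam) : Nonempty (M.Iso N) := by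
  obtain ⟨hM, rM, φ, hφ⟩ := hM
  obtain ⟨hN, rN, ψ, hψ⟩ := hN
  obtain ⟨σ, hσ⟩ := hφ.exists_isAdapted hM.isLocallyGrassmann
  obtain ⟨τ, hτ⟩ := hψ.exists_isAdapted hN.isLocallyGrassmann
  have hM := hM.isLocallyGrassmann
  have hN := hN.isLocallyGrassmann
  refine (Reduction.compare hM hN φ ψ hσ hτ).nonempty_iso (Reduction.compare hN hM ψ φ hτ hσ)
    ?_ ?_ ?_ ?_
  · intro i W hW s
    obtain ⟨F, rfl⟩ := (Reduction.frame_bijective hN ψ (τ i) hW).2 s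
    rw [Reduction.compare_frame, Reduction.compare_frame]
  · intro i W hW s
    obtain ⟨F, rfl⟩ := (Reduction.frame_bijective hM φ (σ i) hW).2 s
    rw [Reduction.compare_frame, Reduction.compare_frame]
  · intro i W hW s hs
    obtain ⟨F, rfl⟩ := (Reduction.frame_bijective hN ψ (τ i) hW).2 s
    rw [Reduction.compare_frame, Reduction.frame_mem_even_iff]
    exact (Reduction.frame_mem_even_iff hN ψ (τ i) hW F).1 hs
  · intro i W hW s hs
    obtain ⟨F, rfl⟩ := (Reduction.frame_bijective hN ψ (τ i) hW).2 s
    rw [Reduction.compare_frame, Reduction.frame_mem_odd_iff]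
    exact (Reduction.frame_mem_odd_iff hN ψ (τ i) hW F).1 hs

/-! ### Non-projectedness -/

/-- A nonzero multiple of `z` is not the sum of an entire function divisible by `z²` and an entire
function of `z⁻¹`: the entire function `z² G(z) + c z` is bounded, and hence constant by
Liouville's theorem. -/
theorem eq_zero_of_sq_mul_add_eq {G H : ℂ → ℂ} {c : ℂ} (hG : Differentiable ℂ G)
    (hH : Differentiable ℂ H) (h : ∀ z ≠ 0, z ^ 2 * G z + c * z + H z⁻¹ = 0) : c = 0 := by
  have hF : Differentiable ℂ fun z => z ^ 2 * G z + c * z := by fun_prop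
  obtain ⟨A, hA⟩ := (isCompact_closedBall (0 : ℂ) 1).exists_bound_of_continuousOn
    hF.continuous.continuousOn
  obtain ⟨B, hB⟩ := (isCompact_closedBall (0 : ℂ) 1).exists_bound_of_continuousOn
    hH.continuous.continuousOn
  have hb : Bornology.IsBounded (Set.range fun z => z ^ 2 * G z + c * z) := by
    refine isBounded_iff_forall_norm_le.2 ⟨max A B, ?_⟩
    rintro _ ⟨z, rfl⟩
    rcases le_total ‖z‖ 1 with hz | hz
    · exact (hA z (by simpa using hz)).trans (le_max_left _ _)
    · have hz0 : z ≠ 0 := by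
        rintro rfl
        simp at hz
        linarith
      dsimp only
      rw [eq_neg_of_add_eq_zero_left (h z hz0), norm_neg]
      refine (hB _ ?_).trans (le_max_right _ _)
      simpa using inv_le_one_of_one_le₀ hz
  have h0 : ∀ z, z ^ 2 * G z + c * z = 0 := fun z => by
    simpa using hF.apply_eq_apply_of_bounded hb z 0
  have h1 : (fun z => z * G z + c) = fun _ => 0 := by
    refine Continuous.ext_on (dense_compl_singleton (0 : ℂ))
      (by have := hG.continuous; fun_prop) continuous_const fun z hz => ?_
    have : z * (z * G z + c) = 0 := by rw [← h0 z]; ring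
    exact (mul_eq_zero.1 this).resolve_left hz
  simpa using congrFun h1 0

namespace P2

theorem homog_zero (w : Fin 2 → ℂ) : homog 0 w = ![1, w 0, w 1] := by
  funext m
  fin_cases m <;> rfl

theorem homog_one (w : Fin 2 → ℂ) : homog 1 w = ![w 0, 1, w 1] := by
  funext m
  fin_cases m <;> rfl

theorem oddRow_one : oddRow 1 = ![Grass.theta 0, 0, Grass.theta 1] := by
  funext m
  fin_cases m <;> rfl

theorem differentiable_line {i : Fin 3} (f : hol (affine i)) :
    Differentiable ℂ fun z : ℂ => fnInChart f.1 i ![z, 0] := by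
  intro z
  have h := analyticAt_fnInChart f (param_mem i ![z, 0]) (param_mem i ![z, 0])
  rw [coord_param] at h
  have h1 : DifferentiableAt ℂ (fun z : ℂ => (![z, 0] : Fin 2 → ℂ)) z := by
    refine differentiableAt_pi.2 fun k => ?_
    fin_cases k
    · exact differentiableAt_id
    · exact differentiableAt_const _
  exact DifferentiableAt.comp (g := fnInChart f.1 i) z h.differentiableAt h1

end P2

namespace Superspace.Reduction

open CotangentFermions P2.supHol

variable {M : Superspace} {r : M.Reduction}

/-- A supermanifold with the obstruction class `lam ≠ 0` is not projected. The class is detected by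
the functions `X_2/X_0`, `X_0/X_1`, `X_2/X_1` along the line `X_2 = 0`. -/
theorem false_of_isProjected (hM : M.IsLocallyGrassmann) (φ : r.CotangentFermions) {lam : ℂ}
    (hlam : lam ≠ 0) {σ : ∀ i : Fin 3, r.Splitting (P2.affine i)} (hσ : IsAdapted hM φ lam σ)
    (he : M.IsProjected) : False := by
  obtain ⟨e, e_res, e_even, e_nil, e_sub⟩ := he
  -- The global splitting turns the local splittings into derivations, whose differences are
  -- the multiple `lam` of the standard cocycle.
  let D : ∀ (i : Fin 3) {W : Opens P2} (_ : W ≤ P2.affine i), P2.hol W → M.sec (r.pre W) :=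
    fun i W hW f => (σ i).lift W hW f - e _ ((σ i).lift W hW f)
  have D_res : ∀ (i : Fin 3) {V W : Opens P2} (h : V ≤ W) (hW : W ≤ P2.affine i) (f : P2.hol W),
      M.res (r.pre_mono h) (D i hW f) = D i (h.trans hW) (P2.holRes h f) := by
    intro i V W h hW f
    simp only [D]
    rw [map_sub, ← e_res, ← (σ i).lift_res h hW]
  have D_mem : ∀ (i : Fin 3) {W : Opens P2} (hW : W ≤ P2.affine i) (f : P2.hol W),
      D i hW f ∈ M.nilSq (r.pre W) := fun i W hW f => mem_nilSq_of_even (e_sub _ _)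
    (Submodule.sub_mem _ ((σ i).lift_even W hW f) (e_even _ _))
  have D_mul : ∀ (i : Fin 3) {W : Opens P2} (hW : W ≤ P2.affine i) (f g : P2.hol W),
      D i hW (f * g) = (σ i).lift W hW f * D i hW g + (σ i).lift W hW g * D i hW f := by
    intro i W hW f g
    have h1 := hM.nilSq_mul_nil (D_mem i hW f) (e_sub _ ((σ i).lift W hW g))
    have h2 := fun a => M.even_comm _ _ ((σ i).lift_even W hW g) a
    simp only [D] at h1 ⊢
    rw [map_mul, map_mul, mul_sub ((σ i).lift W hW g), h2, h2]
    rw [← sub_eq_zero]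
    rw [← neg_eq_zero, ← h1]
    noncomm_ring
  let W : Opens P2 := P2.affine 0 ⊓ P2.affine 1
  have hi : W ≤ P2.affine 0 := inf_le_left
  have hj : W ≤ P2.affine 1 := inf_le_right
  -- `D_0 z₂₀`, `D_1 z₁₁` and `D_1 z₂₁` are multiples of the generators of `J²` with coefficients `g`,
  -- `k`, `h` which are holomorphic on a whole affine plane.
  obtain ⟨g, hg⟩ := exists_of_mem_nilSq hM φ (σ 0) le_rfl (D_mem 0 le_rfl (P2.coordHol 0 1))
  obtain ⟨k, hk⟩ := exists_of_mem_nilSq hM φ (σ 1) le_rfl (D_mem 1 le_rfl (P2.coordHol 1 0))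
  obtain ⟨h, hh⟩ := exists_of_mem_nilSq hM φ (σ 1) le_rfl (D_mem 1 le_rfl (P2.coordHol 1 1))
  let z₂₀ : P2.hol W := P2.holRes hi (P2.coordHol 0 1)
  let z₁₁ : P2.hol W := P2.holRes hj (P2.coordHol 1 0)
  let z₂₁ : P2.hol W := P2.holRes hj (P2.coordHol 1 1)
  have hz : z₂₀ * z₁₁ = z₂₁ := by
    refine Subtype.ext (funext fun x => ?_)
    have h0 : P2.rep x.1 0 ≠ 0 := x.2.1
    exact div_mul_div_cancel₀ h0
  have e0 := congrArg (M.res (r.pre_mono hi)) hg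
  have e1 := congrArg (M.res (r.pre_mono hj)) hk
  have e2 := congrArg (M.res (r.pre_mono hj)) hh
  rw [D_res 0 hi, res_lift_mul_theta hM φ (σ 0) le_rfl hi] at e0
  rw [D_res 1 hj, res_lift_mul_theta hM φ (σ 1) le_rfl hj] at e1 e2
  rw [theta_mul_theta_eq hM φ _ hj (σ 1), lift_mul_eq hi hj (σ 0) (σ 1) hM _
    (nilSq_le_nil (Ideal.mul_mem_left _ _ (theta_mul_theta_mem hM φ hj))), ← mul_assoc,
    ← map_mul] at e0
  have e3 : D 0 hi z₂₀ - D 1 hj z₂₀ = (σ 1).lift W hj (lam • stdHol hi z₂₀) *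
      (thetaOn hM φ hj 0 * thetaOn hM φ hj 1) := by
    have h1 : (σ 0).lift W hi z₂₀ = (σ 1).lift W hj z₂₀ + (σ 1).lift W hj (lam • stdHol hi z₂₀) *
      (thetaOn hM φ hj 0 * thetaOn hM φ hj 1) := hσ 0 W hi hj z₂₀
    simp only [D]
    rw [h1, map_add, e_nil _ ((σ 1).lift W hj (lam • stdHol hi z₂₀) * _)
      (nilSq_le_nil (Ideal.mul_mem_left _ _ (theta_mul_theta_mem hM φ hj)))]
    abel
  -- `z₂₀` is not defined on all of `U_1`; the Leibniz rule for `z₂₁ = z₂₀ z₁₁` eliminates `D_1 z₂₀`.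
  have e4 := D_mul 1 hj z₂₀ z₁₁
  rw [hz] at e4
  have e5 := congrArg ((σ 1).lift W hj z₁₁ * ·) e3
  have hmul : ∀ a b : P2.hol W, (σ 1).lift W hj a * ((σ 1).lift W hj b *
      (thetaOn hM φ hj 0 * thetaOn hM φ hj 1)) =
      (σ 1).lift W hj (a * b) * (thetaOn hM φ hj 0 * thetaOn hM φ hj 1) := fun a b => by
    rw [← mul_assoc, ← map_mul]
  rw [mul_sub, eq_sub_of_add_eq' e4.symm, e0, e1, e2, hmul, hmul, hmul, ← sub_mul, ← sub_mul,
    ← map_sub, ← map_sub] at e5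
  have key := lift_mul_theta_injective hM φ (σ 1) hj e5
  refine hlam (eq_zero_of_sq_mul_add_eq (P2.differentiable_line g) (P2.differentiable_line h)
    fun z hz0 => ?_)
  -- Evaluation at the point with the coordinates `(z, 0)` in `U_0` and `(z⁻¹, 0)` in `U_1`. There `z₂₀`
  -- vanishes, so that the coefficient `k` drops out.
  have hx0 : P2.param 0 ![z, 0] ∈ P2.affine 0 := P2.param_mem 0 _
  have hx1 : P2.param 0 ![z, 0] ∈ P2.affine 1 := P2.param_mem_affine_iff.2 hz0
  have c0 : P2.coord 0 (P2.param 0 ![z, 0]) = ![z, 0] := P2.coord_param 0 _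
  have c1 : P2.coord 1 (P2.param 0 ![z, 0]) = ![z⁻¹, 0] := by
    rw [← P2.change_coord hx0, c0]
    funext l
    rw [P2.change, P2.homog_zero]
    fin_cases l <;> simp [Fin.succAbove]
  generalize P2.param 0 ![z, 0] = x at hx0 hx1 c0 c1
  have h1 := congrFun (congrArg Subtype.val key) ⟨x, hx0, hx1⟩
  have h2 : z₁₁.1 ⟨x, hx0, hx1⟩ * (g.1 ⟨x, hx0⟩ * (jacDet hi hj).1 ⟨x, hx0, hx1⟩) -
      (h.1 ⟨x, hx1⟩ - z₂₀.1 ⟨x, hx0, hx1⟩ * k.1 ⟨x, hx1⟩) =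
      z₁₁.1 ⟨x, hx0, hx1⟩ * (lam * stdCoeff z₂₀ 0 x) := h1
  have v1 : z₁₁.1 ⟨x, hx0, hx1⟩ = z⁻¹ := congrFun c1 0
  have v2 : z₂₀.1 ⟨x, hx0, hx1⟩ = 0 := congrFun c0 1
  have v3 : stdCoeff z₂₀ 0 x = z ^ 2 := by
    have h3 : P2.fnInChart z₂₀.1 0 =ᶠ[nhds (P2.coord 0 x)] fun w => w 1 :=
      P2.fnInChart_eventuallyEq (W := W) z₂₀.1 ⟨hx0, hx1⟩ hx0 fun y _ => rfl
    have h4 : HasFDerivAt (fun w : Fin 2 → ℂ => w 1)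
        (ContinuousLinearMap.proj 1 : (Fin 2 → ℂ) →L[ℂ] ℂ) (P2.coord 0 x) :=
      (ContinuousLinearMap.proj (R := ℂ) (φ := fun _ : Fin 2 => ℂ) 1).hasFDerivAt
    have h5 : P2.rep x 1 / P2.rep x 0 = z := congrFun c0 0
    rw [stdCoeff, h3.fderiv_eq, h4.fderiv, zero_add, h5]
    simp [Fin.succAbove]
  have v4 : (jacDet hi hj).1 ⟨x, hx0, hx1⟩ = -z ^ 3 := by
    have h3 := P2.homog_coord_ne_zero hx0 hx1
    change fderiv ℂ (fun w => P2.change 0 1 w 0) (P2.coord 1 x) (Pi.single 0 1) *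
      fderiv ℂ (fun w => P2.change 0 1 w 1) (P2.coord 1 x) (Pi.single 1 1) -
      fderiv ℂ (fun w => P2.change 0 1 w 0) (P2.coord 1 x) (Pi.single 1 1) *
      fderiv ℂ (fun w => P2.change 0 1 w 1) (P2.coord 1 x) (Pi.single 0 1) = -z ^ 3
    rw [P2.fderiv_change_single h3, P2.fderiv_change_single h3, P2.fderiv_change_single h3,
      P2.fderiv_change_single h3, P2.transOdd_apply _ _ _ h3, P2.transOdd_apply _ _ _ h3, c1]
    simp [P2.homog_one, P2.oddRow_one, Fin.succAbove, Grass.const, Grass.theta, sub_eq_add_neg]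
    field_simp
  rw [v1, v2, v3, v4, ← P2.fnInChart_coord g.1 ⟨x, hx0⟩ hx0, ← P2.fnInChart_coord h.1 ⟨x, hx1⟩ hx1,
    c0, c1] at h2
  have hu : z⁻¹ * z = 1 := inv_mul_cancel₀ hz0
  linear_combination -h2 - (z ^ 2 * P2.fnInChart g.1 0 ![z, 0] + lam * z) * hu

end Superspace.Reduction

/-! ### The transition functions of the `Π`-projective plane -/

namespace P2

/-- The coefficient of `θ_{1j}θ_{2j}` in the expression in the chart `j` of a function of the even
coordinates of the chart `i`. If `f` is this function in terms of the even coordinates of the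
chart `j`, it is the coefficient of `d log x_i ∧ df` for `x_i = X_i / X_j`. -/
noncomputable def defect (i j : Fin 3) (f : (Fin 2 → ℂ) → ℂ) (w : Fin 2 → ℂ) : ℂ :=
  (homog j w i)⁻¹ * ((oddRow j i).c1 * fderiv ℂ f w (Pi.single 1 1) -
    (oddRow j i).c2 * fderiv ℂ f w (Pi.single 0 1))

theorem defect_congr {i j : Fin 3} {f g : (Fin 2 → ℂ) → ℂ} {w : Fin 2 → ℂ}
    (h : f =ᶠ[nhds w] g) : defect i j f w = defect i j g w := by
  rw [defect, defect, h.fderiv_eq]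

/-- The nilpotent part of the even transition functions. -/
theorem transEven_c12 {i j : Fin 3} {w : Fin 2 → ℂ} (h : homog j w i ≠ 0) (k : Fin 2) :
    (transEven i j w k).c12 = (homog j w i)⁻¹ * ((oddRow j i).c1 * (transOdd i j w k).c2 -
      (oddRow j i).c2 * (transOdd i j w k).c1) := by
  obtain ⟨h0, h12⟩ := oddRow_isOdd j i
  rw [transEven_apply i j w h, transOdd_apply i j w h]
  simp [Grass.const, sub_eq_add_neg, h0, h12]
  field_simp
  ring

theorem fderiv_transEven_c12 {i j : Fin 3} {w : Fin 2 → ℂ} (h : homog j w i ≠ 0)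
    {f : (Fin 2 → ℂ) → ℂ} (hf : AnalyticAt ℂ f (change i j w)) :
    fderiv ℂ f (change i j w) (fun k => (transEven i j w k).c12) =
      defect i j (f ∘ change i j) w := by
  rw [defect, fderiv_comp_change h hf, fderiv_comp_change h hf, clm_apply_eq_sum,
    Fin.sum_univ_two, Fin.sum_univ_two, Fin.sum_univ_two]
  simp only [fderiv_change_single h, transEven_c12 h]
  simp
  ring

/-- The substitution of the transition functions: the reduced change of coordinates, its Jacobian
matrix on the odd coordinates, and the defect. -/
theorem superEval_trans {i j : Fin 3} {w : Fin 2 → ℂ} (h : homog j w i ≠ 0)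
    {F : (Fin 2 → ℂ) → Grass} (hF : AnalyticAt ℂ (fun z => (F z).c0) (change i j w)) :
    superEval F (transEven i j w) (transOdd i j w) =
      ⟨(F (change i j w)).c0,
        (F (change i j w)).c1 * (transOdd i j w 0).c1 +
          (F (change i j w)).c2 * (transOdd i j w 1).c1,
        (F (change i j w)).c1 * (transOdd i j w 0).c2 +
          (F (change i j w)).c2 * (transOdd i j w 1).c2,
        (F (change i j w)).c12 * ((transOdd i j w 0).c1 * (transOdd i j w 1).c2 -
          (transOdd i j w 0).c2 * (transOdd i j w 1).c1) +
          defect i j ((fun z => (F z).c0) ∘ change i j) w⟩ := by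
  obtain ⟨h1, h2⟩ := transOdd_isOdd i j w h 0
  obtain ⟨h3, h4⟩ := transOdd_isOdd i j w h 1
  rw [← fderiv_transEven_c12 h hF, ← transEven_body i j w h]
  ext <;> simp [superEval, taylor, h1, h2, h3, h4]
  ring

/-- The odd row of the chart `j` in terms of that of the chart `k`. -/
theorem oddRow_trans {j k : Fin 3} {w : Fin 2 → ℂ} (h : homog k w j ≠ 0) (m : Fin 3) :
    Grass.const (oddRow j m).c1 * transOdd j k w 0 +
      Grass.const (oddRow j m).c2 * transOdd j k w 1 =
      Grass.const (homog k w j)⁻¹ * oddRow k m -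
        Grass.const (homog k w m / (homog k w j) ^ 2) * oddRow k j := by
  refine Fin.succAboveCases j ?_ (fun l => ?_) m
  · have h1 : oddRow j j = 0 := by
      simp only [oddRow, Fin.insertNth_apply_same]
    rw [h1]
    ext <;> simp [Grass.const, sub_eq_add_neg]
    all_goals field_simp
    all_goals ring
  · have h1 : oddRow j (j.succAbove l) = Grass.theta l := by
      simp only [oddRow, Fin.insertNth_apply_succAbove]
    rw [h1, ← transOdd_apply j k w h l]
    fin_cases l <;> ext <;> simp [Grass.const, Grass.theta]

/-- The cocycle property of the obstruction, a consequence of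
`d log (X_i/X_j) + d log (X_j/X_k) = d log (X_i/X_k)`. -/
theorem defect_cocycle {i j k : Fin 3} {w : Fin 2 → ℂ} (hj : homog k w j ≠ 0)
    (hi : homog k w i ≠ 0) {f : (Fin 2 → ℂ) → ℂ} (hf : AnalyticAt ℂ f (change j k w)) :
    defect i j f (change j k w) * ((transOdd j k w 0).c1 * (transOdd j k w 1).c2 -
      (transOdd j k w 0).c2 * (transOdd j k w 1).c1) + defect j k (f ∘ change j k) w =
      defect i k (f ∘ change j k) w := by
  have h1 := congrArg Grass.c1 (oddRow_trans hj i)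
  have h2 := congrArg Grass.c2 (oddRow_trans hj i)
  simp only [Grass.const, sub_eq_add_neg, Grass.add_c1, Grass.mul_c1, Grass.neg_c1, Grass.add_c2,
    Grass.mul_c2, Grass.neg_c2, zero_mul, add_zero] at h1 h2
  rw [defect, defect, defect, fderiv_comp_change hj hf, fderiv_comp_change hj hf,
    Fin.sum_univ_two, Fin.sum_univ_two]
  simp only [fderiv_change_single hj, homog_change hj]
  simp only [Matrix.cons_val_zero, Matrix.cons_val_one]
  generalize fderiv ℂ f (change j k w) (Pi.single 0 1) = g0
  generalize fderiv ℂ f (change j k w) (Pi.single 1 1) = g1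
  generalize (transOdd j k w 0).c1 = a at *
  generalize (transOdd j k w 0).c2 = b at *
  generalize (transOdd j k w 1).c1 = c at *
  generalize (transOdd j k w 1).c2 = d at *
  have e1 : (homog k w i / homog k w j)⁻¹ * ((oddRow j i).c1 * a + (oddRow j i).c2 * c) =
      (homog k w i)⁻¹ * (oddRow k i).c1 - (homog k w j)⁻¹ * (oddRow k j).c1 := by
    rw [h1]
    field_simp
    ring
  have e2 : (homog k w i / homog k w j)⁻¹ * ((oddRow j i).c1 * b + (oddRow j i).c2 * d) =
      (homog k w i)⁻¹ * (oddRow k i).c2 - (homog k w j)⁻¹ * (oddRow k j).c2 := by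
    rw [h2]
    field_simp
    ring
  linear_combination (g0 * b + g1 * d) * e1 - (g0 * a + g1 * c) * e2

/-- The coefficient of the standard cocycle is the defect. -/
theorem stdCoeff_eq_defect {W : Opens P2} (f : hol W) (i : Fin 3) {x : P2} (hx : x ∈ W)
    (hi : x ∈ affine i) (hj : x ∈ affine (i + 1)) :
    Superspace.Reduction.stdCoeff f i x =
      defect i (i + 1) (fnInChart f.1 (i + 1)) (coord (i + 1) x) := by
  have h := homog_coord_ne_zero hi hj
  have h1 : AnalyticAt ℂ (fnInChart f.1 i) (change i (i + 1) (coord (i + 1) x)) := by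
    rw [change_coord hj]
    exact analyticAt_fnInChart f hx hi
  rw [← defect_congr (fnInChart_comp_change f.1 h), ← fderiv_transEven_c12 h h1,
    change_coord hj, Superspace.Reduction.stdCoeff, ← smul_eq_mul, ← map_smul]
  congr 1
  funext k
  have e : (rep x (i + 1) / rep x i) ^ 2 = (homog (i + 1) (coord (i + 1) x) i ^ 2)⁻¹ := by
    rw [homog_coord hj, div_pow, div_pow, inv_div]
  rw [transEven_apply _ _ _ h, Pi.smul_apply, e]
  generalize (homog (i + 1) (coord (i + 1) x) i ^ 2)⁻¹ = c
  clear e h1 h hi hj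
  fin_cases i <;> fin_cases k <;>
    simp [Grass.const, oddRow, Grass.theta, Fin.insertNth, Fin.succAboveCases, Fin.succAbove]

end P2

namespace P2

open supHol

theorem transOdd_cocycle {i j k : Fin 3} {w : Fin 2 → ℂ} (hj : homog k w j ≠ 0)
    (hi : homog k w i ≠ 0) (l : Fin 2) :
    (transOdd i k w l).c1 = (transOdd i j (change j k w) l).c1 * (transOdd j k w 0).c1 +
      (transOdd i j (change j k w) l).c2 * (transOdd j k w 1).c1 ∧
    (transOdd i k w l).c2 = (transOdd i j (change j k w) l).c1 * (transOdd j k w 0).c2 +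
      (transOdd i j (change j k w) l).c2 * (transOdd j k w 1).c2 := by
  have h1 : homog j (change j k w) i ≠ 0 := by
    rw [homog_change hj]
    exact div_ne_zero hi hj
  have h2 := fderiv_change_comp hj hi l 0
  have h3 := fderiv_change_comp hj hi l 1
  rw [Fin.sum_univ_two] at h2 h3
  simp only [fderiv_change_single hj, fderiv_change_single hi, fderiv_change_single h1] at h2 h3
  exact ⟨h2, h3⟩

theorem transOdd_self (i : Fin 3) (w : Fin 2 → ℂ) : transOdd i i w = Grass.theta := by
  have h : homog i w i ≠ 0 := by
    rw [homog_self]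
    exact one_ne_zero
  funext k
  have h0 := fderiv_change_refl i w k 0
  have h1 := fderiv_change_refl i w k 1
  rw [fderiv_change_single h] at h0 h1
  obtain ⟨h2, h3⟩ := transOdd_isOdd i i w h k
  refine Grass.ext ?_ (h0.trans ?_) (h1.trans ?_) ?_
  · rw [h2]
    exact (theta_isOdd k).1.symm
  · fin_cases k <;> simp [Grass.theta]
  · fin_cases k <;> simp [Grass.theta]
  · rw [h3]
    exact (theta_isOdd k).2.symm

theorem defect_self (i : Fin 3) (f : (Fin 2 → ℂ) → ℂ) (w : Fin 2 → ℂ) : defect i i f w = 0 := by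
  have h : oddRow i i = 0 := by simp only [oddRow, Fin.insertNth_apply_same]
  simp [defect, h]

theorem analyticAt_transOdd {i j : Fin 3} {w : Fin 2 → ℂ} (h : homog j w i ≠ 0) (k : Fin 2) :
    AnalyticAt ℂ (fun w => (transOdd i j w k).c1) w ∧
      AnalyticAt ℂ (fun w => (transOdd i j w k).c2) w := by
  refine ⟨(analyticAt_fderiv_apply (analyticAt_change_apply h k) (Pi.single 0 1)).congr ?_,
    (analyticAt_fderiv_apply (analyticAt_change_apply h k) (Pi.single 1 1)).congr ?_⟩
  · exact (eventually_homog_ne_zero h).mono fun w h => fderiv_change_single h k 0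
  · exact (eventually_homog_ne_zero h).mono fun w h => fderiv_change_single h k 1

theorem analyticAt_defect {i j : Fin 3} {w : Fin 2 → ℂ} (h : homog j w i ≠ 0)
    {f : (Fin 2 → ℂ) → ℂ} (hf : AnalyticAt ℂ f w) : AnalyticAt ℂ (defect i j f) w :=
  ((analyticAt_homog j i w).inv h).mul
    ((analyticAt_const.mul (analyticAt_fderiv_apply hf _)).sub
      (analyticAt_const.mul (analyticAt_fderiv_apply hf _)))

/-! ### Superfunctions on the `Π`-projective plane in one chart -/

/-- The expression of a Grassmann-algebra-valued function in the chart `i`. -/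
noncomputable def chartFn {W : Opens P2} (F : supHol W) (i : Fin 3) (z : Fin 2 → ℂ) : Grass :=
  ⟨fnInChart (c0 F).1 i z, fnInChart (c1 F).1 i z, fnInChart (c2 F).1 i z,
    fnInChart (c12 F).1 i z⟩

theorem chartFn_coord {W : Opens P2} (F : supHol W) (x : W) {i : Fin 3} (hi : x.1 ∈ affine i) :
    chartFn F i (coord i x.1) = F.1 x := by
  simp only [chartFn, fnInChart_coord _ x hi]
  rfl

/-- The substitution of the transition functions from the chart `i` to the chart `j`. -/
noncomputable def pullChart {W : Opens P2} (F : supHol W) (i j : Fin 3) (w : Fin 2 → ℂ) : Grass :=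
  superEval (chartFn F i) (transEven i j w) (transOdd i j w)

theorem pullChart_eq {W : Opens P2} (F : supHol W) {i j : Fin 3} {w : Fin 2 → ℂ}
    (h : homog j w i ≠ 0) (hw : param j w ∈ W) :
    pullChart F i j w = ⟨fnInChart (c0 F).1 j w,
      fnInChart (c1 F).1 j w * (transOdd i j w 0).c1 +
        fnInChart (c2 F).1 j w * (transOdd i j w 1).c1,
      fnInChart (c1 F).1 j w * (transOdd i j w 0).c2 +
        fnInChart (c2 F).1 j w * (transOdd i j w 1).c2,
      fnInChart (c12 F).1 j w * ((transOdd i j w 0).c1 * (transOdd i j w 1).c2 -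
        (transOdd i j w 0).c2 * (transOdd i j w 1).c1) +
        defect i j (fnInChart (c0 F).1 j) w⟩ := by
  have hi := param_mem_affine_iff.2 h
  have h1 : AnalyticAt ℂ (fun z => (chartFn F i z).c0) (change i j w) := by
    have := analyticAt_fnInChart (c0 F) hw hi
    rwa [← change_coord (param_mem j w), coord_param] at this
  rw [pullChart, superEval_trans h h1]
  simp only [chartFn, fnInChart_change _ h]
  rw [← defect_congr (fnInChart_comp_change (c0 F).1 h)]

theorem superAnalyticAt_pullChart {W : Opens P2} (F : supHol W) {i j : Fin 3} {x : P2}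
    (hx : x ∈ W) (hi : x ∈ affine i) (hj : x ∈ affine j) :
    SuperAnalyticAt (pullChart F i j) (coord j x) := by
  have h := homog_coord_ne_zero hi hj
  have h0 := analyticAt_transOdd h 0
  have h1 := analyticAt_transOdd h 1
  have a0 := analyticAt_fnInChart (c0 F) hx hj
  have a1 := analyticAt_fnInChart (c1 F) hx hj
  have a2 := analyticAt_fnInChart (c2 F) hx hj
  have a12 := analyticAt_fnInChart (c12 F) hx hj
  refine SuperAnalyticAt.congr (F := fun w => ⟨fnInChart (c0 F).1 j w,
      fnInChart (c1 F).1 j w * (transOdd i j w 0).c1 +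
        fnInChart (c2 F).1 j w * (transOdd i j w 1).c1,
      fnInChart (c1 F).1 j w * (transOdd i j w 0).c2 +
        fnInChart (c2 F).1 j w * (transOdd i j w 1).c2,
      fnInChart (c12 F).1 j w * ((transOdd i j w 0).c1 * (transOdd i j w 1).c2 -
        (transOdd i j w 0).c2 * (transOdd i j w 1).c1) +
        defect i j (fnInChart (c0 F).1 j) w⟩)
    ⟨a0, (a1.mul h0.1).add (a2.mul h1.1), (a1.mul h0.2).add (a2.mul h1.2),
      (a12.mul ((h0.1.mul h1.2).sub (h0.2.mul h1.1))).add (analyticAt_defect h a0)⟩ ?_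
  filter_upwards [eventually_mem hx hj, eventually_homog_ne_zero h] with w hw hw'
  exact (pullChart_eq F hw' hw).symm

theorem pullChart_self {W : Opens P2} (F : supHol W) (i : Fin 3) {w : Fin 2 → ℂ}
    (hw : param i w ∈ W) : pullChart F i i w = chartFn F i w := by
  rw [pullChart_eq F (by rw [homog_self]; exact one_ne_zero) hw, transOdd_self, defect_self]
  simp [Grass.theta, chartFn]

/-- The cocycle property of the transition functions between the big cells. -/
theorem superEval_pullChart {W : Opens P2} (F : supHol W) {i j k : Fin 3} {w : Fin 2 → ℂ}
    (hw : param k w ∈ W) (hj : homog k w j ≠ 0) (hi : homog k w i ≠ 0) :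
    superEval (pullChart F i j) (transEven j k w) (transOdd j k w) = pullChart F i k w := by
  have hij : homog j (change j k w) i ≠ 0 := by
    rw [homog_change hj]
    exact div_ne_zero hi hj
  have hw' : param j (change j k w) ∈ W := by rwa [param_change hj]
  have hA : AnalyticAt ℂ (fnInChart (c0 F).1 j) (change j k w) := by
    have := analyticAt_fnInChart (c0 F) hw' (param_mem j _)
    rwa [coord_param] at this
  have hc : (fun z => (pullChart F i j z).c0) =ᶠ[nhds (change j k w)] fnInChart (c0 F).1 j := by
    have h1 := eventually_mem hw' (param_mem j _)
    rw [coord_param] at h1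
    filter_upwards [h1, eventually_homog_ne_zero hij] with z hz hz'
    rw [pullChart_eq F hz' hz]
  have hc' : (fun z => (pullChart F i j z).c0) ∘ change j k =ᶠ[nhds w]
      fnInChart (c0 F).1 j ∘ change j k :=
    hc.comp_tendsto (analyticAt_change hj).continuousAt
  rw [superEval_trans hj (hA.congr hc.symm), pullChart_eq F hij hw', pullChart_eq F hi hw,
    defect_congr hc', ← defect_congr (fnInChart_comp_change (c0 F).1 hj),
    ← defect_cocycle hj hi hA]
  obtain ⟨h1, h2⟩ := transOdd_cocycle hj hi 0
  obtain ⟨h3, h4⟩ := transOdd_cocycle hj hi 1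
  simp only [fnInChart_change _ hj, h1, h2, h3, h4]
  ext
  · rfl
  · simp only
    ring
  · simp only
    ring
  · simp only
    ring

theorem inChart_coord {U : Opens P2} {E : Type} [Zero E] (s : ∀ x : U, {i // x.1 ∈ affine i} → E)
    (x : U) (i : {i // x.1 ∈ affine i}) : inChart s i.1 (coord i.1 x.1) = s x i := by
  have key : ∀ (y : P2) (hy : y ∈ U) (hi : y ∈ affine i.1), y = x.1 →
      s ⟨y, hy⟩ ⟨i.1, hi⟩ = s x i := by
    rintro y hy hi rfl
    rfl
  rw [inChart_of_mem _ ((param_coord i.2).symm ▸ x.2)]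
  exact key _ _ _ (param_coord i.2)

/-- The values in the chart `i` of a superfunction on an open subset of `U_i`. -/
noncomputable def evalChart {W : Opens P2} {i : Fin 3} (hW : W ≤ affine i) :
    superfunctionsPi.sub W →ₐ[ℂ] supHol W where
  toFun s := ⟨fun x => s.1 x ⟨i, hW x.2⟩, by
    have h1 : ∀ (p : Grass → ℂ), p 0 = 0 →
        (∀ x ∈ W, AnalyticAt ℂ (fun z => p (inChart s.1 i z)) (coord i x)) →
        (fun x : W => p (s.1 x ⟨i, hW x.2⟩)) ∈ hol W := fun p hp h =>
      mem_hol_of_eq hW _ _ h fun x => by rw [inChart_coord s.1 x ⟨i, hW x.2⟩]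
    have h2 := fun x hx => (s.2 ⟨x, hx⟩ ⟨i, hW hx⟩).1
    exact ⟨h1 Grass.c0 rfl fun x hx => (h2 x hx).1, h1 Grass.c1 rfl fun x hx => (h2 x hx).2.1,
      h1 Grass.c2 rfl fun x hx => (h2 x hx).2.2.1, h1 Grass.c12 rfl fun x hx => (h2 x hx).2.2.2⟩⟩
  map_one' := rfl
  map_mul' _ _ := rfl
  map_zero' := rfl
  map_add' _ _ := rfl
  commutes' _ := rfl

theorem evalChart_apply {W : Opens P2} {i : Fin 3} (hW : W ≤ affine i)
    (s : superfunctionsPi.sub W) (x : W) : (evalChart hW s).1 x = s.1 x ⟨i, hW x.2⟩ := rfl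

theorem chartFn_evalChart {W : Opens P2} {i : Fin 3} (hW : W ≤ affine i)
    (s : superfunctionsPi.sub W) (z : Fin 2 → ℂ) :
    chartFn (evalChart hW s) i z = inChart s.1 i z := by
  by_cases hz : param i z ∈ W
  · simp only [chartFn, fnInChart, inChart_of_mem _ hz]
    rfl
  · simp only [chartFn, fnInChart, inChart_of_notMem _ hz]
    rfl

/-- The expression in any chart of a superfunction on an open subset of `U_i`. -/
theorem eq_pullChart {W : Opens P2} {i : Fin 3} (hW : W ≤ affine i)
    (s : superfunctionsPi.sub W) (x : W) (j : {j // x.1 ∈ affine j}) :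
    s.1 x j = pullChart (evalChart hW s) i j.1 (coord j.1 x.1) := by
  have h1 : chartFn (evalChart hW s) i = inChart s.1 i := funext (chartFn_evalChart hW s)
  rw [pullChart, h1]
  exact (s.2 x ⟨i, hW x.2⟩).2 j

/-- A superfunction over an open subset of `U_i` is the same thing as its expression in the chart
`i`; the other expressions are obtained by substitution and are consistent by the cocycle property
of the transition functions. -/
theorem evalChart_bijective {W : Opens P2} {i : Fin 3} (hW : W ≤ affine i) :
    Function.Bijective (evalChart hW) := by
  constructor
  · intro s t h
    refine Subtype.ext (funext fun x => funext fun j => ?_)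
    rw [eq_pullChart hW s, eq_pullChart hW t, h]
  · intro F
    let s : ∀ x : W, {j // x.1 ∈ affine j} → Grass := fun x j => pullChart F i j.1 (coord j.1 x.1)
    have hs : ∀ (x : W) (j : {j // x.1 ∈ affine j}),
        inChart s j.1 =ᶠ[nhds (coord j.1 x.1)] pullChart F i j.1 := by
      intro x j
      filter_upwards [eventually_mem x.2 j.2] with z hz
      rw [inChart_of_mem _ hz]
      simp only [s, coord_param]
    have h : IsPiSuperfunction s := by
      intro x j
      refine ⟨(superAnalyticAt_pullChart F x.2 (hW x.2) j.2).congr (hs x j).symm, fun k => ?_⟩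
      have hb := transEven_body_coord j.2 k.2
      rw [superEval_congr (hb ▸ hs x j)]
      refine (superEval_pullChart F ?_ (homog_coord_ne_zero j.2 k.2)
        (homog_coord_ne_zero (hW x.2) k.2)).symm
      rw [param_coord k.2]
      exact x.2
    refine ⟨⟨s, h⟩, Subtype.ext (funext fun x => ?_)⟩
    change pullChart F i i (coord i x.1) = F.1 x
    rw [pullChart_self, chartFn_coord F x (hW x.2)]
    rw [param_coord (hW x.2)]
    exact x.2

/-- Superfunctions on an open subset of `U_i` in the coordinates of the chart `i`. -/
noncomputable def evalChartEquiv {W : Opens P2} {i : Fin 3} (hW : W ≤ affine i) :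
    superfunctionsPi.sub W ≃ₐ[ℂ] supHol W :=
  AlgEquiv.ofBijective (evalChart hW) (evalChart_bijective hW)

/-- The components of a superfunction in the chart `j` in terms of those in the chart `i`. -/
theorem apply_eq {W : Opens P2} (s : superfunctionsPi.sub W) (x : W)
    (i j : {j // x.1 ∈ affine j}) : s.1 x j = ⟨(s.1 x i).c0,
      (s.1 x i).c1 * (transOdd i.1 j.1 (coord j.1 x.1) 0).c1 +
        (s.1 x i).c2 * (transOdd i.1 j.1 (coord j.1 x.1) 1).c1,
      (s.1 x i).c1 * (transOdd i.1 j.1 (coord j.1 x.1) 0).c2 +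
        (s.1 x i).c2 * (transOdd i.1 j.1 (coord j.1 x.1) 1).c2,
      (s.1 x i).c12 * ((transOdd i.1 j.1 (coord j.1 x.1) 0).c1 *
        (transOdd i.1 j.1 (coord j.1 x.1) 1).c2 - (transOdd i.1 j.1 (coord j.1 x.1) 0).c2 *
        (transOdd i.1 j.1 (coord j.1 x.1) 1).c1) +
        defect i.1 j.1 ((fun z => (inChart s.1 i.1 z).c0) ∘ change i.1 j.1) (coord j.1 x.1)⟩ := by
  have h1 := (s.2 x i).2 j
  have h2 := (s.2 x i).1.1
  have hb := change_coord (i := i.1) j.2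
  rw [superEval_trans (homog_coord_ne_zero i.2 j.2) (hb ▸ h2), hb, inChart_coord s.1 x i] at h1
  exact h1

end P2

/-! ### The `Π`-projective plane is a supermanifold -/

namespace P2

open supHol

theorem isOpen_coord_preimage (i : Fin 3) {s : Set (Fin 2 → ℂ)} (hs : IsOpen s) :
    IsOpen {x : P2 | x ∈ affine i ∧ coord i x ∈ s} := by
  rw [isOpen_iff]
  have h1 : ((fun v : {v : Fin 3 → ℂ // v ≠ 0} => mk v.1 v.2) ⁻¹'
      {x : P2 | x ∈ affine i ∧ coord i x ∈ s}) =
      {v | v.1 i ≠ 0} ∩ (fun v k => v.1 (i.succAbove k) / v.1 i) ⁻¹' s := by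
    ext v
    obtain ⟨a, ha, h⟩ := rep_mk v.1 v.2
    have h2 : coord i (mk v.1 v.2) = fun k => v.1 (i.succAbove k) / v.1 i := by
      funext k
      simp only [coord, h, Pi.smul_apply, smul_eq_mul]
      rw [mul_div_mul_left _ _ ha]
    simp [mem_affine, h, h2, ha]
  rw [h1]
  have h2 : ∀ m : Fin 3, Continuous fun v : {v : Fin 3 → ℂ // v ≠ 0} => v.1 m := fun m =>
    (continuous_apply m).comp continuous_subtype_val
  refine ContinuousOn.isOpen_inter_preimage ?_ (isOpen_ne_fun (h2 i) continuous_const) hs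
  exact continuousOn_pi.2 fun k => (h2 _).continuousOn.div (h2 i).continuousOn fun v hv => hv

/-- The affine chart `U_i ≃ ℂ²`. -/
noncomputable def affineHomeo (i : Fin 3) : affine i ≃ₜ (⊤ : Opens (Fin 2 → ℂ)) where
  toFun x := ⟨coord i x.1, trivial⟩
  invFun z := ⟨param i z.1, param_mem i z.1⟩
  left_inv x := Subtype.ext (param_coord x.2)
  right_inv z := Subtype.ext (coord_param i z.1)
  continuous_toFun := by
    refine Continuous.subtype_mk (continuous_def.2 fun s hs => ?_) _
    have h := (isOpen_coord_preimage i hs).preimage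
      (continuous_subtype_val (p := fun x => x ∈ affine i))
    convert h using 1
    ext x
    exact ⟨fun hx => ⟨x.2, hx⟩, fun hx => hx.2⟩
  continuous_invFun := ((continuous_param i).comp continuous_subtype_val).subtype_mk _

/-- Superfunctions on an open subset of `ℂ^{2|2}` as superfunctions on an open subset of `U_i`. -/
noncomputable def chartEquiv {i : Fin 3} {A : Opens (Fin 2 → ℂ)} {W : Opens P2}
    (hW : W ≤ affine i) (h : ∀ x ∈ W, coord i x ∈ A) (h' : ∀ z ∈ A, param i z ∈ W) :
    superfunctionsC22.sub A ≃ₐ[ℂ] supHol W where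
  toFun s := ⟨fun x => s.1 ⟨coord i x.1, h x.1 x.2⟩, by
    have key : ∀ (p : Grass → ℂ), (∀ z ∈ A, AnalyticAt ℂ (fun w => p (extendZero s.1 w)) z) →
        (fun x : W => p (s.1 ⟨coord i x.1, h x.1 x.2⟩)) ∈ hol W := fun p hp =>
      mem_hol_of_eq hW _ _ (fun x hx => hp _ (h x hx)) fun x => by
        rw [extendZero_of_mem s.1 (h x.1 x.2)]
    exact ⟨key Grass.c0 fun z hz => (s.2 z hz).1, key Grass.c1 fun z hz => (s.2 z hz).2.1,
      key Grass.c2 fun z hz => (s.2 z hz).2.2.1, key Grass.c12 fun z hz => (s.2 z hz).2.2.2⟩⟩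
  invFun F := ⟨fun z => F.1 ⟨param i z.1, h' z.1 z.2⟩, fun z hz => by
    have key : ∀ f : hol W, AnalyticAt ℂ (fnInChart f.1 i) z := fun f => by
      have := analyticAt_fnInChart f (h' z hz) (param_mem i z)
      rwa [coord_param] at this
    refine SuperAnalyticAt.congr (F := chartFn F i) ⟨key _, key _, key _, key _⟩ ?_
    filter_upwards [A.isOpen.mem_nhds hz] with w hw
    rw [extendZero_of_mem _ hw]
    simp only [chartFn, fnInChart, inChart_of_mem _ (h' w hw)]
    rfl⟩
  left_inv s := Subtype.ext (funext fun z => congrArg s.1 (Subtype.ext (coord_param i z.1)))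
  right_inv F := Subtype.ext (funext fun x => congrArg F.1 (Subtype.ext (param_coord (hW x.2))))
  map_mul' _ _ := rfl
  map_add' _ _ := rfl
  commutes' _ := rfl

theorem mem_even_iff {W : Opens P2} {i : Fin 3} (hW : W ≤ affine i)
    (s : superfunctionsPi.sub W) : s ∈ PiProjectivePlane.even W ↔
      ∀ x, ((evalChart hW s).1 x).IsEven := by
  refine ⟨fun h x => h x ⟨i, hW x.2⟩, fun h x j => ?_⟩
  obtain ⟨h1, h2⟩ := h x
  rw [evalChart_apply] at h1 h2
  rw [apply_eq s x ⟨i, hW x.2⟩ j]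
  constructor <;> simp [h1, h2]

/-- That the body and the top coefficient vanish is independent of the chart: if the body vanishes
locally, there is no defect. -/
theorem mem_odd_iff {W : Opens P2} {i : Fin 3} (hW : W ≤ affine i)
    (s : superfunctionsPi.sub W) : s ∈ PiProjectivePlane.odd W ↔
      ∀ x, ((evalChart hW s).1 x).IsOdd := by
  refine ⟨fun h x => h x ⟨i, hW x.2⟩, fun h x j => ?_⟩
  have h1 : inChart (fun (y : W) _ => ((evalChart hW s).1 y).c0) j.1 = 0 := by
    funext z
    by_cases hz : param j.1 z ∈ W
    · rw [inChart_of_mem _ hz]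
      exact (h _).1
    · exact inChart_of_notMem _ hz
  have hx : param j.1 (coord j.1 x.1) ∈ W := (param_coord j.2).symm ▸ x.2
  rw [eq_pullChart hW s, pullChart_eq _ (homog_coord_ne_zero (hW x.2) j.2) hx]
  simp only [fnInChart_coord _ x j.2]
  have h2 : (c0 (evalChart hW s)).1 x = 0 := (h x).1
  have h3 : (c12 (evalChart hW s)).1 x = 0 := (h x).2
  have h4 : fnInChart (c0 (evalChart hW s)).1 j.1 = 0 := h1
  constructor
  · exact h2
  · simp [h3, h4, defect]

end P2

open P2 in
/-- Each of the three big cells is a copy of `ℂ^{2|2}`. -/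
theorem PiProjectivePlane.isSupermanifold22 : PiProjectivePlane.IsSupermanifold22 := by
  intro x
  obtain ⟨i, hi⟩ := exists_mem_affine x
  let e := affineHomeo i
  let e' : C(affine i, (⊤ : Opens (Fin 2 → ℂ))) := ⟨e, e.continuous⟩
  have hU : ∀ V : Opens (⊤ : Opens (Fin 2 → ℂ)),
      ((affine i).isOpenEmbedding.isOpenMap.functor.obj (V.comap e')) ≤ affine i := by
    rintro V _ ⟨y, _, rfl⟩
    exact y.2
  have h1 : ∀ V : Opens (⊤ : Opens (Fin 2 → ℂ)), ∀ x ∈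
      ((affine i).isOpenEmbedding.isOpenMap.functor.obj (V.comap e')),
      coord i x ∈
        (Opens.isOpenEmbedding (X := TopCat.of (Fin 2 → ℂ)) ⊤).isOpenMap.functor.obj V := by
    rintro V _ ⟨y, hy, rfl⟩
    exact ⟨_, hy, rfl⟩
  have h2 : ∀ V : Opens (⊤ : Opens (Fin 2 → ℂ)), ∀ z ∈
      (Opens.isOpenEmbedding (X := TopCat.of (Fin 2 → ℂ)) ⊤).isOpenMap.functor.obj V,
      param i z ∈ ((affine i).isOpenEmbedding.isOpenMap.functor.obj (V.comap e')) := by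
    rintro V _ ⟨z, hz, rfl⟩
    exact ⟨e.symm z, (congrArg (fun w => w ∈ V) (e.apply_symm_apply z)).mpr hz, rfl⟩
  refine ⟨affine i, hi, ⊤, ⟨{
    homeo := e
    pull := fun V => (chartEquiv (hU V) (h1 V) (h2 V)).trans (evalChartEquiv (hU V)).symm
    pull_res := fun {V W} h s => ?_
    pull_even := fun V s hs => ?_
    pull_odd := fun V s hs => ?_ }⟩⟩
  · refine (evalChartEquiv (hU W)).injective ?_
    refine ((evalChartEquiv (hU W)).apply_symm_apply _).trans ?_
    refine Subtype.ext (funext fun y => ?_)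
    have h3 := (evalChartEquiv (hU V)).apply_symm_apply (chartEquiv (hU V) (h1 V) (h2 V) s)
    exact (congrFun (congrArg Subtype.val h3) ⟨y.1, _⟩).symm
  · refine (mem_even_iff (hU V) _).2 fun y => ?_
    have h3 := (evalChartEquiv (hU V)).apply_symm_apply (chartEquiv (hU V) (h1 V) (h2 V) s)
    exact (congrArg Grass.IsEven (congrFun (congrArg Subtype.val h3) y)).mpr (hs _)
  · refine (mem_odd_iff (hU V) _).2 fun y => ?_
    have h3 := (evalChartEquiv (hU V)).apply_symm_apply (chartEquiv (hU V) (h1 V) (h2 V) s)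
    exact (congrArg Grass.IsOdd (congrFun (congrArg Subtype.val h3) y)).mpr (hs _)

/-! ### The reduction of the `Π`-projective plane and its odd coordinates -/

namespace P2

open supHol

/-- The superfunction with the given coefficients in the chart `i`. -/
noncomputable def ofChart {W : Opens P2} {i : Fin 3} (hW : W ≤ affine i) (a b c d : hol W) :
    superfunctionsPi.sub W := (evalChartEquiv hW).symm (supHol.mk a b c d)

theorem evalChart_ofChart {W : Opens P2} {i : Fin 3} (hW : W ≤ affine i) (a b c d : hol W) :
    evalChart hW (ofChart hW a b c d) = supHol.mk a b c d :=
  (evalChartEquiv hW).apply_symm_apply _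

theorem ofChart_apply {W : Opens P2} {i : Fin 3} (hW : W ≤ affine i) (a b c d : hol W) (x : W) :
    (ofChart hW a b c d).1 x ⟨i, hW x.2⟩ = ⟨a.1 x, b.1 x, c.1 x, d.1 x⟩ :=
  congrFun (congrArg Subtype.val (evalChart_ofChart hW a b c d)) x

theorem ofChart_odd {W : Opens P2} {i : Fin 3} (hW : W ≤ affine i) (b c : hol W) :
    ofChart hW 0 b c 0 ∈ PiProjectivePlane.odd W :=
  (mem_odd_iff hW _).2 fun x => by
    rw [evalChart_ofChart]
    exact ⟨rfl, rfl⟩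

theorem ofChart_even {W : Opens P2} {i : Fin 3} (hW : W ≤ affine i) (a d : hol W) :
    ofChart hW a 0 0 d ∈ PiProjectivePlane.even W :=
  (mem_even_iff hW _).2 fun x => by
    rw [evalChart_ofChart]
    exact ⟨rfl, rfl⟩

/-- The expansion in the odd coordinates. -/
theorem eq_add_of_evalChart {W : Opens P2} {i : Fin 3} (hW : W ≤ affine i)
    (s : superfunctionsPi.sub W) : s = ofChart hW (c0 (evalChart hW s)) 0 0 0 +
      ofChart hW 0 (c1 (evalChart hW s)) (c2 (evalChart hW s)) 0 +
      ofChart hW (c12 (evalChart hW s)) 0 0 0 * (ofChart hW 0 1 0 0 * ofChart hW 0 0 1 0) := by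
  refine (evalChart_bijective hW).1 ?_
  simp only [map_add, map_mul, evalChart_ofChart]
  refine Subtype.ext (funext fun x => ?_)
  change _ = (⟨(c0 (evalChart hW s)).1 x, 0, 0, 0⟩ : Grass) +
    ⟨0, (c1 (evalChart hW s)).1 x, (c2 (evalChart hW s)).1 x, 0⟩ +
      ⟨(c12 (evalChart hW s)).1 x, 0, 0, 0⟩ * (⟨0, 1, 0, 0⟩ * ⟨0, 0, 1, 0⟩)
  ext <;> simp <;> rfl

theorem ofChart_zero {W : Opens P2} {i : Fin 3} (hW : W ≤ affine i) : ofChart hW 0 0 0 0 = 0 :=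
  (evalChart_bijective hW).1 ((evalChart_ofChart hW 0 0 0 0).trans (map_zero _).symm)

theorem mem_oddIdealSq_of_chart {W : Opens P2} {i : Fin 3} (hW : W ≤ affine i)
    (s : superfunctionsPi.sub W) (h0 : c0 (evalChart hW s) = 0) (h1 : c1 (evalChart hW s) = 0)
    (h2 : c2 (evalChart hW s) = 0) : s ∈ PiProjectivePlane.oddIdealSq W := by
  have h := eq_add_of_evalChart hW s
  rw [h0, h1, h2, ofChart_zero, zero_add, zero_add] at h
  rw [h]
  exact Ideal.mul_mem_left (PiProjectivePlane.oddIdealSq W) _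
    (Ideal.subset_span ⟨_, ofChart_odd hW 1 0, _, ofChart_odd hW 0 1, rfl⟩)

theorem mem_oddIdeal_of_chart {W : Opens P2} {i : Fin 3} (hW : W ≤ affine i)
    (s : superfunctionsPi.sub W) (h0 : c0 (evalChart hW s) = 0) :
    s ∈ PiProjectivePlane.oddIdeal W := by
  have h := eq_add_of_evalChart hW s
  rw [h0, ofChart_zero, zero_add] at h
  rw [h]
  exact Ideal.add_mem (PiProjectivePlane.oddIdeal W) (Ideal.subset_span (ofChart_odd hW _ _))
    (Ideal.mul_mem_left _ _ (Ideal.mul_mem_left _ _ (Ideal.subset_span (ofChart_odd hW 0 1))))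

theorem mem_nil_iff {V : Opens P2} (s : superfunctionsPi.sub V) :
    s ∈ PiProjectivePlane.nil V ↔ ∀ x i, (s.1 x i).c0 = 0 := by
  constructor
  · intro hs x i
    obtain ⟨W, hW, hx, h⟩ := hs x.1 x.2
    have key : ∀ t : superfunctionsPi.sub W, t ∈ PiProjectivePlane.oddIdeal W →
        (t.1 ⟨x.1, hx⟩ i).c0 = 0 := by
      intro t ht
      induction ht using Submodule.span_induction with
      | mem t h => exact (h ⟨x.1, hx⟩ i).1
      | zero => rfl
      | add t u _ _ h1 h2 => exact (congrArg₂ (· + ·) h1 h2).trans (add_zero 0)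
      | smul a t _ h1 =>
        exact (congrArg (fun w => ((show superfunctionsPi.sub W from a).1 ⟨x.1, hx⟩ i).c0 * w)
          h1).trans (mul_zero _)
    exact key _ h
  · intro h x hx
    obtain ⟨i, hi⟩ := exists_mem_affine x
    refine ⟨V ⊓ affine i, inf_le_left, ⟨hx, hi⟩, mem_oddIdeal_of_chart inf_le_right _ ?_⟩
    exact Subtype.ext (funext fun y => h _ _)

theorem mem_nilSq_iff {V : Opens P2} (s : superfunctionsPi.sub V) :
    s ∈ PiProjectivePlane.nilSq V ↔
      ∀ x i, (s.1 x i).c0 = 0 ∧ (s.1 x i).c1 = 0 ∧ (s.1 x i).c2 = 0 := by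
  constructor
  · intro hs x i
    obtain ⟨W, hW, hx, h⟩ := hs x.1 x.2
    have key : ∀ t : superfunctionsPi.sub W, t ∈ PiProjectivePlane.oddIdealSq W →
        (t.1 ⟨x.1, hx⟩ i).c0 = 0 ∧ (t.1 ⟨x.1, hx⟩ i).c1 = 0 ∧ (t.1 ⟨x.1, hx⟩ i).c2 = 0 := by
      intro t ht
      induction ht using Submodule.span_induction with
      | mem t h =>
        obtain ⟨a, ha, b, hb, rfl⟩ := h
        obtain ⟨h1, h2⟩ := ha ⟨x.1, hx⟩ i
        obtain ⟨h3, h4⟩ := hb ⟨x.1, hx⟩ i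
        exact ⟨(Grass.mul_c0 _ _).trans (by rw [h1, zero_mul]),
          (Grass.mul_c1 _ _).trans (by rw [h1, h3, zero_mul, mul_zero, add_zero]),
          (Grass.mul_c2 _ _).trans (by rw [h1, h3, zero_mul, mul_zero, add_zero])⟩
      | zero => exact ⟨rfl, rfl, rfl⟩
      | add t u _ _ h1 h2 =>
        exact ⟨(Grass.add_c0 _ _).trans (by rw [h1.1, h2.1, add_zero]),
          (Grass.add_c1 _ _).trans (by rw [h1.2.1, h2.2.1, add_zero]),
          (Grass.add_c2 _ _).trans (by rw [h1.2.2, h2.2.2, add_zero])⟩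
      | smul a t _ h =>
        exact ⟨(Grass.mul_c0 _ _).trans (by rw [h.1, mul_zero]),
          (Grass.mul_c1 _ _).trans (by rw [h.1, h.2.1, mul_zero, mul_zero, add_zero]),
          (Grass.mul_c2 _ _).trans (by rw [h.1, h.2.2, mul_zero, mul_zero, add_zero])⟩
    exact key _ h
  · intro h x hx
    obtain ⟨i, hi⟩ := exists_mem_affine x
    refine ⟨V ⊓ affine i, inf_le_left, ⟨hx, hi⟩, mem_oddIdealSq_of_chart inf_le_right _ ?_ ?_ ?_⟩
    · exact Subtype.ext (funext fun y => (h _ _).1)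
    · exact Subtype.ext (funext fun y => (h _ _).2.1)
    · exact Subtype.ext (funext fun y => (h _ _).2.2)

/-- The underlying function on `ℙ²` of a superfunction on the `Π`-projective plane, computed in
any chart. -/
noncomputable def body {V : Opens P2} (s : superfunctionsPi.sub V) (x : V) : ℂ :=
  (s.1 x ⟨(exists_mem_affine x.1).choose, (exists_mem_affine x.1).choose_spec⟩).c0

theorem body_eq {V : Opens P2} (s : superfunctionsPi.sub V) (x : V) (i) :
    body s x = (s.1 x i).c0 := by
  rw [body, apply_eq s x i]

theorem body_mem_hol {V : Opens P2} (s : superfunctionsPi.sub V) : body s ∈ hol V := by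
  refine mem_hol_of_local _ fun x hx => ?_
  obtain ⟨i, hi⟩ := exists_mem_affine x
  refine ⟨V ⊓ affine i, inf_le_left, ⟨hx, hi⟩, ?_⟩
  have h := (c0 (evalChart (inf_le_right : V ⊓ affine i ≤ affine i)
    (superfunctionsPi.resHom inf_le_left s))).2
  convert h using 1
  funext y
  exact body_eq s _ ⟨i, y.2.2⟩

end P2

namespace PiProjectivePlane

open P2

/-- The reduced manifold of the `Π`-projective plane is `ℙ²`. -/
noncomputable def reduction : PiProjectivePlane.Reduction where
  homeo := Homeomorph.refl P2
  proj V :=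
    { toFun := fun s => ⟨body (V := V) s, body_mem_hol (V := V) s⟩
      map_one' := rfl
      map_mul' := fun _ _ => rfl
      map_zero' := rfl
      map_add' := fun _ _ => rfl
      commutes' := fun a => Subtype.ext (funext fun _ => mul_one a) }
  proj_res _ _ := rfl
  locally_surjective V f x hx := by
    obtain ⟨i, hi⟩ := exists_mem_affine x
    refine ⟨V ⊓ affine i, inf_le_left,
      ofChart inf_le_right (holRes inf_le_left f) 0 0 0, ⟨hx, hi⟩, ?_⟩
    refine Subtype.ext (funext fun y => (body_eq _ y ⟨i, y.2.2⟩).trans ?_)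
    exact congrArg Grass.c0 (ofChart_apply inf_le_right _ 0 0 0 y)
  ker V s := by
    refine Iff.trans ?_ (mem_nil_iff (V := V) s).symm
    refine ⟨fun h x i => ?_, fun h => Subtype.ext (funext fun x => h x _)⟩
    rw [← body_eq (V := V) s x i]
    exact congrFun (congrArg Subtype.val h) x

theorem proj_apply {V : Opens P2} (s : superfunctionsPi.sub V) (x : V) (i) :
    (reduction.proj V s).1 x = (s.1 x i).c0 := body_eq s x i

/-- The form `t (b dz_{1i} + c dz_{2i})` given by the coefficients `b`, `c` of `θ_{1i}`, `θ_{2i}` of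
a superfunction. -/
noncomputable def linearPart (t : ℂ) {V : Opens P2} (s : superfunctionsPi.sub V) : forms V :=
  ⟨fun x i => ![t * (s.1 x i).c1, t * (s.1 x i).c2], by
    refine ⟨fun x i => ?_, fun x i j l => ?_⟩
    · have h := (s.2 x i).1
      refine AnalyticAt.congr (f := fun z => ![t * (inChart s.1 i.1 z).c1,
        t * (inChart s.1 i.1 z).c2]) ?_ (Filter.Eventually.of_forall fun z => ?_)
      · refine analyticAt_pi_iff.2 fun l => ?_
        fin_cases l
        · exact analyticAt_const.mul h.2.1
        · exact analyticAt_const.mul h.2.2.1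
      · by_cases hz : param i.1 z ∈ V
        · simp only [inChart_of_mem _ hz]
        · simp only [inChart_of_notMem _ hz]
          funext l
          fin_cases l <;> simp
    · simp only [fderiv_change_single (homog_coord_ne_zero i.2 j.2), Fin.sum_univ_two]
      rw [apply_eq s x i j]
      fin_cases l <;> simp <;> ring⟩

/-- The isomorphism `F_M ≅ Π Ω¹` which takes `θ_{li}` to `t dz_{li}`. -/
noncomputable def fermions (t : ℂ) (ht : t ≠ 0) : reduction.CotangentFermions where
  form V :=
    { toFun := fun s => linearPart t (V := V) s.1
      map_zero' := by
        refine Subtype.ext (funext fun x => funext fun i => funext fun l => ?_)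
        fin_cases l <;> exact mul_zero t
      map_add' := fun s u => by
        refine Subtype.ext (funext fun x => funext fun i => funext fun l => ?_)
        fin_cases l <;> exact mul_add t _ _ }
  form_res _ _ _ _ := rfl
  form_smul V a s x i := by
    have h := (mem_nil_iff (V := V) s.1).1 s.2 x i
    rw [proj_apply (V := V) a x i]
    funext l
    fin_cases l
    · exact (congrArg (t * ·) (Grass.mul_c1 _ _)).trans (by rw [h]; simp [linearPart]; ring)
    · exact (congrArg (t * ·) (Grass.mul_c2 _ _)).trans (by rw [h]; simp [linearPart]; ring)
  locally_surjective V α x hx := by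
    obtain ⟨i, hi⟩ := exists_mem_affine x
    have hW : V ⊓ affine i ≤ affine i := inf_le_right
    let β : forms (V ⊓ affine i) := ⟨fun y j => α.1 ⟨y.1, y.2.1⟩ j, fun y j =>
      (α.2.1 ⟨y.1, y.2.1⟩ j).congr (inChart_res inf_le_left α.1 y.2 j.2).symm,
      fun y => α.2.2 ⟨y.1, y.2.1⟩⟩
    let s := ofChart hW 0 (t⁻¹ • ⟨_, forms_coeff_mem_hol hW β 0⟩)
      (t⁻¹ • ⟨_, forms_coeff_mem_hol hW β 1⟩) 0
    refine ⟨V ⊓ affine i, inf_le_left, ⟨s, Superspace.odd_le_nil (ofChart_odd hW _ _)⟩,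
      ⟨hx, hi⟩, fun y j => ?_⟩
    have h : linearPart t s = β := forms_ext hW fun y => by
      have h1 := ofChart_apply hW 0 (t⁻¹ • ⟨_, forms_coeff_mem_hol hW β 0⟩)
        (t⁻¹ • ⟨_, forms_coeff_mem_hol hW β 1⟩) 0 y
      funext l
      fin_cases l
      · refine (congrArg (fun g => t * g.c1) h1).trans ?_
        exact mul_inv_cancel_left₀ ht _
      · refine (congrArg (fun g => t * g.c2) h1).trans ?_
        exact mul_inv_cancel_left₀ ht _
    exact congrFun (congrFun (congrArg Subtype.val h) y) j
  ker V s := by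
    have h := (mem_nil_iff (V := V) s.1).1 s.2
    refine Iff.trans ?_ (mem_nilSq_iff (V := V) s.1).symm
    refine ⟨fun h' x i => ⟨h x i, ?_⟩, fun h' => ?_⟩
    · have h1 := congrFun (congrFun (congrArg Subtype.val h') x) i
      exact ⟨(mul_eq_zero.1 (congrFun h1 0)).resolve_left ht,
        (mul_eq_zero.1 (congrFun h1 1)).resolve_left ht⟩
    · refine Subtype.ext (funext fun x => funext fun i => funext fun l => ?_)
      fin_cases l
      · exact mul_eq_zero_of_right t (h' x i).2.1
      · exact mul_eq_zero_of_right t (h' x i).2.2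

end PiProjectivePlane

/-! ### The obstruction class of the `Π`-projective plane -/

namespace Superspace.Reduction

variable {M : Superspace} {r : M.Reduction}

/-- A multiple of the difference of two splittings, as a derivation with values in `J²`. -/
noncomputable def Splitting.smulDiff (hM : M.IsLocallyGrassmann) {U V : Opens P2}
    (σ : r.Splitting U) (τ : r.Splitting V) (t : ℂ) : r.Derivation (U ⊓ V) where
  toFun W hW := t • ((σ.lift W (hW.trans inf_le_left)).toLinearMap -
    (τ.lift W (hW.trans inf_le_right)).toLinearMap)
  map_res {V W} h hV f := by
    have h1 := σ.lift_res h (hV.trans inf_le_left) f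
    have h2 := τ.lift_res h (hV.trans inf_le_right) f
    change t • (σ.lift W _ _ - τ.lift W _ _) = M.res _ (t • (σ.lift V _ _ - τ.lift V _ _))
    rw [map_smul, map_sub, h1, h2]
  mem_nilSq W hW f := Submodule.smul_of_tower_mem (M.nilSq (r.pre W)) t
    (lift_sub_lift_mem (hW.trans inf_le_left) (hW.trans inf_le_right) σ τ f)
  leibniz W hW a ha b hb := by
    have hσ := hW.trans inf_le_left
    have hτ := hW.trans inf_le_right
    have h1 := lift_sub_lift_mem hσ hτ σ τ
    have h2 := hM.nil_mul_nilSq (sub_lift_proj_mem_nil σ hσ a) (h1 (r.proj W b))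
    have h3 := hM.nil_mul_nilSq (sub_lift_proj_mem_nil τ hτ b) (h1 (r.proj W a))
    change t • (σ.lift W hσ _ - τ.lift W hτ _) =
      a * (t • (σ.lift W hσ _ - τ.lift W hτ _)) + b * (t • (σ.lift W hσ _ - τ.lift W hτ _))
    rw [mul_smul_comm, mul_smul_comm, ← smul_add, map_mul, map_mul]
    congr 1
    rw [sub_mul, sub_eq_zero] at h2 h3
    rw [h2, h3, mul_sub, mul_sub, M.even_comm _ _ (τ.lift_even W hτ (r.proj W b)) (σ.lift W hσ _),
      M.even_comm _ _ (τ.lift_even W hτ (r.proj W b)) (τ.lift W hτ _)]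
    abel

instance {U : Opens P2} : Zero (r.Derivation U) where
  zero :=
    { toFun := fun _ _ => 0
      map_res := fun h _ _ => (map_zero (M.res (r.pre_mono h))).symm
      mem_nilSq := fun _ _ _ => Ideal.zero_mem _
      leibniz := fun _ _ _ _ _ _ => by simp }

end Superspace.Reduction

namespace PiProjectivePlane

open P2 supHol

/-- The splitting over `U_i` which takes a function of the even coordinates to itself. -/
noncomputable def splitting (i : Fin 3) : reduction.Splitting (affine i) where
  lift W hW := AlgHom.comp (R := ℂ) (B := supHol W) (C := superfunctionsPi.sub W)
    (evalChartEquiv hW).symm.toAlgHom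
    { toFun := fun f => supHol.mk f 0 0 0
      map_one' := rfl
      map_mul' := fun f g => Subtype.ext (funext fun x => by ext <;> simp [supHol.mk])
      map_zero' := rfl
      map_add' := fun f g => Subtype.ext (funext fun x => by ext <;> simp [supHol.mk])
      commutes' := fun t => Subtype.ext (funext fun x => (Grass.algebraMap_eq t).symm) }
  lift_res {V W} h hV f := (evalChart_bijective (h.trans hV)).1
    ((evalChart_ofChart (h.trans hV) (holRes h f) 0 0 0).trans
      (Subtype.ext (funext fun x => (ofChart_apply hV f 0 0 0 ⟨x.1, h x.2⟩).symm)))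
  lift_even W hW f := ofChart_even hW f 0
  proj_lift W hW f := Subtype.ext (funext fun x =>
    (proj_apply (ofChart hW f 0 0 0) x ⟨i, hW x.2⟩).trans
      (congrArg Grass.c0 (ofChart_apply hW f 0 0 0 x)))

/-- The values of the splitting over `U_i`, in the coordinates of the chart `j`. -/
theorem splitting_apply {i j : Fin 3} {W : Opens P2} (hi : W ≤ affine i) (hj : W ≤ affine j)
    (f : hol W) (x : W) : (show superfunctionsPi.sub W from (splitting i).lift W hi f).1 x
      ⟨j, hj x.2⟩ = ⟨f.1 x, 0, 0, defect i j (fnInChart f.1 j) (coord j x.1)⟩ := by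
  refine (eq_pullChart hi (ofChart hi f 0 0 0) x ⟨j, hj x.2⟩).trans ?_
  rw [evalChart_ofChart, pullChart_eq _ (homog_coord_ne_zero (hi x.2) (hj x.2))
    ((param_coord (hj x.2)).symm ▸ x.2)]
  simp only [fnInChart_coord _ x (hj x.2)]
  ext <;> simp [supHol.mk, c0, c1, c2, c12]

/-- The splittings over the big cells differ by `d log (X_i/X_{i+1}) ∧ df`, that is, by the standard
cocycle formed with the `θ_{li}`; if these represent `t dz_{li}`, it is `t²` times the cocycle formed
with the representatives of `dz_{li}`. -/
theorem hasObstructionClass {t : ℂ} (ht : t ≠ 0) :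
    Superspace.Reduction.HasObstructionClass (fermions t ht) (t ^ 2) := by
  have hM := isSupermanifold22.isLocallyGrassmann
  have ht2 : t ^ 2 ≠ 0 := pow_ne_zero 2 ht
  refine ⟨fun i => (splitting i).smulDiff hM (splitting (i + 1)) (t ^ 2)⁻¹, ?_, splitting,
    fun _ => 0, fun i W hW f => ?_⟩
  · intro i W hW f a _ ha t₁ t₂ h1 h2
    have hi : W ≤ affine i := hW.trans inf_le_left
    have hj : W ≤ affine (i + 1) := hW.trans inf_le_right
    refine (evalChart_bijective hj).1 (Subtype.ext (funext fun x => ?_))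
    let j : {j // x.1 ∈ affine j} := ⟨i + 1, hj x.2⟩
    change (t ^ 2)⁻¹ • ((show superfunctionsPi.sub W from (splitting i).lift W hi f).1 x j -
      (show superfunctionsPi.sub W from (splitting (i + 1)).lift W hj f).1 x j) =
      (show superfunctionsPi.sub W from a).1 x j * ((show superfunctionsPi.sub W from t₁.1).1 x j *
        (show superfunctionsPi.sub W from t₂.1).1 x j)
    rw [splitting_apply hi hj, splitting_apply hj hj, defect_self]
    -- In the chart `i + 1` the lifts of `dz_{1j}`, `dz_{2j}` are `t⁻¹ θ_{1j}`, `t⁻¹ θ_{2j}` modulo `J²`.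
    have b1 : t * ((show superfunctionsPi.sub W from t₁.1).1 x j).c1 = 1 := congrFun (h1 x) 0
    have b2 : t * ((show superfunctionsPi.sub W from t₁.1).1 x j).c2 = 0 := congrFun (h1 x) 1
    have b3 : t * ((show superfunctionsPi.sub W from t₂.1).1 x j).c1 = 0 := congrFun (h2 x) 0
    have b4 : t * ((show superfunctionsPi.sub W from t₂.1).1 x j).c2 = 1 := congrFun (h2 x) 1
    have n1 := (mem_nil_iff (V := W) t₁.1).1 t₁.2 x j
    have n2 := (mem_nil_iff (V := W) t₂.1).1 t₂.2 x j
    have ha' := ha x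
    rw [proj_apply (V := W) a x j, stdCoeff_eq_defect f i x.2 (hi x.2) (hj x.2)] at ha'
    rw [← ha']
    generalize (show superfunctionsPi.sub W from a).1 x j = A
    generalize (show superfunctionsPi.sub W from t₁.1).1 x j = T₁ at *
    generalize (show superfunctionsPi.sub W from t₂.1).1 x j = T₂ at *
    have e1 : T₁.c1 = t⁻¹ := eq_inv_of_mul_eq_one_right b1
    have e2 : T₁.c2 = 0 := (mul_eq_zero.1 b2).resolve_left ht
    have e3 : T₂.c1 = 0 := (mul_eq_zero.1 b3).resolve_left ht
    have e4 : T₂.c2 = t⁻¹ := eq_inv_of_mul_eq_one_right b4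
    ext <;> simp [sub_eq_add_neg, n1, n2, e1, e2, e3, e4]
    ring
  · have e : (splitting i).lift W (hW.trans inf_le_left) f -
        (splitting (i + 1)).lift W (hW.trans inf_le_right) f = t ^ 2 • ((t ^ 2)⁻¹ •
          ((splitting i).lift W (hW.trans inf_le_left) f -
            (splitting (i + 1)).lift W (hW.trans inf_le_right) f)) :=
      (smul_inv_smul₀ ht2 _).symm
    refine e.trans ((add_zero _).symm.trans ?_)
    congr 1
    exact (sub_zero _).symm

theorem isGivenByTriple {lam : ℂ} (hlam : lam ≠ 0) : PiProjectivePlane.IsGivenByTriple lam := by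
  obtain ⟨t, rfl⟩ := IsAlgClosed.exists_pow_nat_eq lam two_pos
  exact ⟨isSupermanifold22, reduction, fermions t (fun h => hlam (by simp [h])),
    hasObstructionClass _⟩

end PiProjectivePlane

theorem mainTheorem7 (lam : ℂ) (hlam : lam ≠ 0) :
    PiProjectivePlane.IsGivenByTriple lam ∧
      ∀ M : Superspace, M.IsGivenByTriple lam →
        ¬ M.IsProjected ∧ Nonempty (M.Iso PiProjectivePlane) := by
  refine ⟨PiProjectivePlane.isGivenByTriple hlam, fun M hM => ⟨fun he => ?_,
    hM.nonempty_iso (PiProjectivePlane.isGivenByTriple hlam)⟩⟩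
  obtain ⟨h, r, φ, hc⟩ := hM
  obtain ⟨σ, hσ⟩ := hc.exists_isAdapted h.isLocallyGrassmann
  exact Superspace.Reduction.false_of_isProjected h.isLocallyGrassmann φ hlam hσ he
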